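/- Let $n,k$ be integers with $k\ge 3$ and $n-k\ge 3$, let $Q$ be a positive definite quadratic form on $\mathbb{Q}^n$ (for instance an integral one), let $L\subseteq\mathbb{Q}^n$ be a $k$-dimensional rational subspace and let $L^{\perp}$ be its orthogonal complement with respect to $Q$. Let $F_L$ be the stabilizer of $L$ in the algebraic group $\mathrm{Spin}_Q$ (which acts on vectors through $\mathrm{Spin}_Q\to\mathrm{SO}_Q$), and let $H_L=F_L^{\circ}$ be its Zariski connected component of the identity. For a prime $p$, a connected algebraic $\mathbb{Q}$-group $G$ is called strongly isotropic at $p$ if for every non-trivial connected normal algebraic subgroup $N$ of $G$ defined over $\mathbb{Q}_p$ the group $N(\mathbb{Q}_p)$ is not compact. A quadratic space $(q,W)$ over a field is called isotropic if there is $w\in W\setminus\{0\}$ with $q(w)=0$. Let $p$ be an odd prime. Then $H_L$ is strongly isotropic at $p$ if and only if the quadratic spaces $(Q|_{\mathbb{Q}_p\otimes L},\mathbb{Q}_p\otimes L)$ and $(Q|_{\mathbb{Q}_p\otimes L^{\perp}},\mathbb{Q}_p\otimes L^{\perp})$ are both isotropic. -/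

import Mathlib

open scoped TensorProduct Pointwise

noncomputable section

namespace SpinStabilizer

/-! Linear algebraic groups are treated classically: a group is given by its points over an
algebraically closed field `Ω` of characteristic zero, as a Zariski closed subset of a finite
dimensional vector space, together with the subfield `K` over which it is defined. -/

section Zariski

variable (Ω : Type*) [Field Ω] (X : Type*) [AddCommGroup X] [Module Ω X]

/-- The Zariski topology of a (finite dimensional) `Ω`-vector space `X`: it is generated by the
sets on which a polynomial function does not vanish. A polynomial function is a polynomial in
linear functionals. -/
@[reducible] def zariskiTopology : TopologicalSpace X :=
  TopologicalSpace.generateFrom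
    {U | ∃ f : MvPolynomial (Module.Dual Ω X) Ω,
      U = {x | MvPolynomial.eval (fun φ => φ x) f ≠ 0}}

/-- Linear maps are continuous for the Zariski topology. -/
theorem continuous_zariski (T : X →ₗ[Ω] X) :
    @Continuous X X (zariskiTopology Ω X) (zariskiTopology Ω X) T := by
  let := zariskiTopology Ω X
  refine continuous_generateFrom_iff.2 ?_
  rintro U ⟨f, rfl⟩
  refine TopologicalSpace.isOpen_generateFrom_of_mem
    ⟨MvPolynomial.rename (fun φ : Module.Dual Ω X => φ.comp T) f, ?_⟩
  ext x
  simp [MvPolynomial.eval_rename, Function.comp_def]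

end Zariski

variable {V : Type*} [AddCommGroup V] [Module ℚ V] (Q : QuadraticForm ℚ V)

/-- The Clifford algebra of `F ⊗ V`, with the quadratic form extended from `V`. -/
abbrev Clifford (F : Type*) [Field F] [Algebra ℚ F] : Type _ :=
  CliffordAlgebra (Q.baseChange F)

/-- The group `Spin_Q(F)`. -/
abbrev Spin (F : Type*) [Field F] [Algebra ℚ F] : Type _ :=
  spinGroup (Q.baseChange F)

section Group

variable (Ω : Type*) [Field Ω] [Algebra ℚ Ω]

/-- The group `F_L(Ω)` of all `g ∈ Spin_Q(Ω)` with `g (Ω ⊗ L) = Ω ⊗ L`. The spin group acts on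
vectors by conjugation inside the Clifford algebra. -/
def spinStabilizer (L : Submodule ℚ V) : Subgroup (Spin Q Ω) :=
  (MulAction.stabilizer (ConjAct (Clifford Q Ω)ˣ)
      ((L.baseChange Ω).map (CliffordAlgebra.ι (Q.baseChange Ω)))).comap
    ((ConjAct.toConjAct (G := (Clifford Q Ω)ˣ)).toMonoidHom.comp spinGroup.toUnits)

/-- The points of a subgroup of `Spin_Q(Ω)`, as a subset of the Clifford algebra. -/
def points (N : Subgroup (Spin Q Ω)) : Set (Clifford Q Ω) :=
  (fun g : Spin Q Ω => (g : Clifford Q Ω)) '' (N : Set (Spin Q Ω))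

/-- Connectedness of a subgroup of `Spin_Q(Ω)` in the Zariski topology. -/
def IsZariskiConnected (N : Subgroup (Spin Q Ω)) : Prop :=
  @IsConnected (Clifford Q Ω) (zariskiTopology Ω _) (points Q Ω N)

variable {Q Ω} in
/-- The Zariski connected component of the identity is stable under `(x, y) ↦ x⁻¹ y`. -/
theorem inv_mul_mem_component (F : Subgroup (Spin Q Ω)) {x y : Spin Q Ω}
    (hx : (x : Clifford Q Ω) ∈ @connectedComponentIn _ (zariskiTopology Ω _) (points Q Ω F) 1)
    (hy : (y : Clifford Q Ω) ∈ @connectedComponentIn _ (zariskiTopology Ω _) (points Q Ω F) 1) :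
    ((x⁻¹ * y : Spin Q Ω) : Clifford Q Ω) ∈
      @connectedComponentIn _ (zariskiTopology Ω _) (points Q Ω F) 1 := by
  let := zariskiTopology Ω (Clifford Q Ω)
  set H : Set (Clifford Q Ω) := connectedComponentIn (points Q Ω F) 1 with hH
  let T : Clifford Q Ω →ₗ[Ω] Clifford Q Ω :=
    LinearMap.mulLeft Ω ((x⁻¹ : Spin Q Ω) : Clifford Q Ω)
  have hT : Continuous T := continuous_zariski Ω _ T
  have hpre : IsPreconnected (T '' H) :=
    isPreconnected_connectedComponentIn.image T hT.continuousOn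
  have hsub : T '' H ⊆ points Q Ω F := by
    rintro _ ⟨z, hz, rfl⟩
    obtain ⟨g, hg, rfl⟩ := connectedComponentIn_subset _ _ hz
    obtain ⟨g', hg', hx'⟩ := connectedComponentIn_subset _ _ hx
    have : g' = x := Subtype.ext hx'
    subst this
    exact ⟨g'⁻¹ * g, F.mul_mem (F.inv_mem hg') hg, rfl⟩
  have h1 : (1 : Clifford Q Ω) ∈ T '' H := by
    refine ⟨x, hx, ?_⟩
    change ((x⁻¹ * x : Spin Q Ω) : Clifford Q Ω) = 1
    rw [inv_mul_cancel]; rfl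
  exact hpre.subset_connectedComponentIn h1 hsub ⟨y, hy, rfl⟩

/-- The Zariski connected component `F°` of the identity in a subgroup `F` of `Spin_Q(Ω)`. -/
def identityComponent (F : Subgroup (Spin Q Ω)) : Subgroup (Spin Q Ω) :=
  have h1 : ((1 : Spin Q Ω) : Clifford Q Ω) ∈
      @connectedComponentIn _ (zariskiTopology Ω _) (points Q Ω F) 1 :=
    @mem_connectedComponentIn _ (zariskiTopology Ω _) _ _ ⟨1, F.one_mem, rfl⟩
  have hinv : ∀ {x : Spin Q Ω},
      (x : Clifford Q Ω) ∈ @connectedComponentIn _ (zariskiTopology Ω _) (points Q Ω F) 1 →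
      ((x⁻¹ : Spin Q Ω) : Clifford Q Ω) ∈
        @connectedComponentIn _ (zariskiTopology Ω _) (points Q Ω F) 1 := fun {x} hx => by
    simpa only [mul_one] using inv_mul_mem_component F hx h1
  { carrier := {g | (g : Clifford Q Ω) ∈
      @connectedComponentIn _ (zariskiTopology Ω _) (points Q Ω F) 1}
    one_mem' := h1
    mul_mem' := fun {x y} hx hy => by
      have h := inv_mul_mem_component F (hinv hx) hy
      rw [inv_inv] at h
      exact h
    inv_mem' := hinv }

/-- The group `H_L = F_L°`, the identity component of the stabilizer of `L` in `Spin_Q`. -/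
def H (L : Submodule ℚ V) : Subgroup (Spin Q Ω) :=
  identityComponent Q Ω (spinStabilizer Q Ω L)

end Group

section Rationality

variable (K : Type*) [Field K] [Algebra ℚ K] (Ω : Type*) [Field Ω] [Algebra ℚ Ω] [Algebra K Ω]

/-- The coordinate function on the Clifford algebra over `Ω` which extends the linear functional
`φ` on the Clifford algebra over `ℚ`. -/
def coordinate (φ : Module.Dual ℚ (CliffordAlgebra Q)) (x : Clifford Q Ω) : Ω :=
  Module.Dual.baseChange Ω φ (CliffordAlgebra.equivBaseChange Ω Q x)

/-- A subgroup of `Spin_Q(Ω)` is closed and defined over `K` if it is the set of common zeros of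
a family of polynomials with coefficients in `K` in the rational coordinates of the Clifford
algebra. (In characteristic zero there is no difference between being `K`-closed and being
defined over `K`.) -/
def IsClosedDefinedOver (N : Subgroup (Spin Q Ω)) : Prop :=
  ∃ S : Set (MvPolynomial (Module.Dual ℚ (CliffordAlgebra Q)) K),
    points Q Ω N = {x | ∀ f ∈ S, MvPolynomial.aeval (fun φ => coordinate Q Ω φ x) f = 0}

/-- The canonical embedding of the Clifford algebra over `K` in the one over `Ω`. -/
def cliffordMap [IsScalarTower ℚ K Ω] : Clifford Q K →+* Clifford Q Ω :=
  ((CliffordAlgebra.equivBaseChange Ω Q).symm.toRingEquiv.toRingHom.comp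
    (Algebra.TensorProduct.map (IsScalarTower.toAlgHom ℚ K Ω)
      (AlgHom.id ℚ (CliffordAlgebra Q))).toRingHom).comp
    (CliffordAlgebra.equivBaseChange K Q).toRingEquiv.toRingHom

/-- The group `N(K)` of `K`-points of `N`, as a subset of the Clifford algebra over `K`. -/
def rationalPoints [IsScalarTower ℚ K Ω] (N : Subgroup (Spin Q Ω)) : Set (Clifford Q K) :=
  {x | cliffordMap Q K Ω x ∈ points Q Ω N}

/-- A connected algebraic subgroup `G` of `Spin_Q` is strongly isotropic over the topological
field `K` if `N(K)` is non-compact for every non-trivial connected normal algebraic subgroup `N`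
of `G` defined over `K`. The topology on `N(K)` is induced by the canonical topology of the
Clifford algebra over `K` as a finite dimensional `K`-vector space. -/
def IsStronglyIsotropic [TopologicalSpace K] [IsScalarTower ℚ K Ω]
    (G : Subgroup (Spin Q Ω)) : Prop :=
  ∀ N : Subgroup (Spin Q Ω), N ≤ G → (N.subgroupOf G).Normal →
    IsClosedDefinedOver Q K Ω N → IsZariskiConnected Q Ω N → N ≠ ⊥ →
      ¬ @IsCompact (Clifford Q K) (moduleTopology K (Clifford Q K)) (rationalPoints Q K Ω N)

/-- `G` is strongly isotropic at the prime `p`. -/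
def IsStronglyIsotropicAt (p : ℕ) [Fact p.Prime]
    (G : Subgroup (Spin Q (AlgebraicClosure ℚ_[p]))) : Prop :=
  IsStronglyIsotropic Q ℚ_[p] (AlgebraicClosure ℚ_[p]) G

end Rationality

/-- The `Q`-orthogonal complement of `L`. -/
def orthogonalComplement (L : Submodule ℚ V) : Submodule ℚ V :=
  Submodule.orthogonalBilin (QuadraticMap.polarBilin Q) L

/-- A quadratic space is isotropic if the form represents zero non-trivially. -/
def IsIsotropic {F W : Type*} [Field F] [AddCommGroup W] [Module F W]
    (q : QuadraticForm F W) : Prop :=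
  ∃ w : W, w ≠ 0 ∧ q w = 0

/-- The quadratic space `(Q|_{F ⊗ L}, F ⊗ L)`. -/
def restrictBaseChange (F : Type*) [Field F] [Algebra ℚ F] (L : Submodule ℚ V) :
    QuadraticForm F (F ⊗[ℚ] L) :=
  QuadraticForm.baseChange F (Q.comp L.subtype)

end SpinStabilizer

end

open scoped TensorProduct Pointwise

noncomputable section

namespace SpinStabilizer

/-! ### Generalities on Clifford algebras -/

section CliffordGeneral

open CliffordAlgebra

variable {F : Type*} [Field F] {W : Type*} [AddCommGroup W] [Module F W] {q : QuadraticForm F W}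

/-! Let `K` be the base field (here the `p`-adic numbers), `Ω` its algebraic closure, and `U`, `U'`
the two summands spanned by `L` and its orthogonal complement over `Ω`. The products of two unit
vectors of `U` generate the spin group of `U`, and likewise for `U'`. Both groups lie in the
identity component of the stabilizer, because such products are reached from 1 along rational curves
(`unitPairs_subset_identityComponent`).

Strong isotropy forces isotropy. Suppose `L` is anisotropic over `K`. The spin group of `U` is a
non-trivial connected normal subgroup, and it is cut out by equations over `K`: an element of the
Clifford algebra that is even, unitary, maps vectors to vectors by conjugation and commutes with
`U'` is a product of vectors of `U` (a Cartan–Dieudonné argument, `exists_eq_smul_prod`). The same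
argument over `K` writes each rational point as a scalar times a product of boundedly many vectors
of `L`. Normalise these vectors. Since the form is bounded away from 0 on the unit sphere, the
unitarity equation bounds the scalar, so the rational points form a compact group
(`isCompact_rationalPoints`). The same reasoning applies to the complement.

Isotropy forces strong isotropy. Let `N` be a non-trivial connected normal subgroup defined over
`K`. If it acted by scalars on both summands, these would be signs and `N` would be finite, hence
trivial (`eq_bot_of_isScalar`). So some `g` in `N` is not scalar on one summand, say `U`. It has an
isotropic eigenvector, and its commutators with a torus acting on a hyperbolic plane through that
vector are unipotent elements `1 + u y` of `N` (`exists_unipotent`). The isotropic lines of `U` are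
conjugate under the spin group of `U`, so `u` may be taken to be the isotropic vector given over
`K`. The vectors `w` for which all `1 + t u w` lie in `N` form a Galois stable subspace not
contained in the line of `u`. By descent it contains a vector `w` over `K` independent of `u`. The
rational points of `N` then contain the affine line `1 + t u w`, and are not compact
(`not_isCompact_rationalPoints`). -/

theorem ι_mul_self_eq_smul (v : W) : ι q v * ι q v = q v • (1 : CliffordAlgebra q) := by
  rw [ι_sq_scalar, Algebra.algebraMap_eq_smul_one]

theorem ι_mul_ι_swap (v w : W) :
    ι q v * ι q w = QuadraticMap.polar q v w • (1 : CliffordAlgebra q) - ι q w * ι q v := by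
  rw [← Algebra.algebraMap_eq_smul_one, ← ι_mul_ι_add_swap, add_sub_cancel_right]

/-- The twisted commutator with a vector is a contraction. -/
theorem contractLeft_polar (v : W) (x : CliffordAlgebra q) :
    contractLeft (q.polarBilin v) x = ι q v * x - involute x * ι q v := by
  induction x using CliffordAlgebra.left_induction with
  | algebraMap r =>
    rw [contractLeft_algebraMap, AlgHom.commutes, Algebra.commutes, sub_self]
  | add x y hx hy => rw [map_add, hx, hy, map_add, mul_add, add_mul]; abel
  | ι_mul x m hx =>
    rw [contractLeft_ι_mul, hx, map_mul, involute_ι, ← mul_assoc, ι_mul_ι_swap]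
    simp only [QuadraticMap.polarBilin_apply_apply, sub_mul, smul_mul_assoc, one_mul, mul_sub,
      neg_mul, mul_assoc]
    abel

variable [CharZero F]

theorem clifford_finite [FiniteDimensional F W] : Module.Finite F (CliffordAlgebra q) := by
  let : Invertible (2 : F) := invertibleOfNonzero two_ne_zero
  have : Module.Finite F (ExteriorAlgebra F W) :=
    Module.Finite.of_basis (Module.finBasis F W).ExteriorAlgebra
  exact Module.Finite.equiv (equivExterior q).symm

theorem clifford_nontrivial : Nontrivial (CliffordAlgebra q) := by
  let : Invertible (2 : F) := invertibleOfNonzero two_ne_zero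
  infer_instance

variable (q) in
/-- The projection of the Clifford algebra onto the vectors. -/
def vectorPart : CliffordAlgebra q →ₗ[F] W :=
  let : Invertible (2 : F) := invertibleOfNonzero two_ne_zero
  ExteriorAlgebra.ιInv ∘ₗ (equivExterior q).toLinearMap

@[simp]
theorem vectorPart_ι (v : W) : vectorPart q (ι q v) = v := by
  simp only [vectorPart, LinearMap.comp_apply, LinearEquiv.coe_coe, equivExterior,
    changeFormEquiv_apply, changeForm_ι]
  exact ExteriorAlgebra.ι_leftInverse v

theorem ι_injective : Function.Injective (ι q) :=
  Function.LeftInverse.injective (g := vectorPart q) vectorPart_ι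

theorem algebraMap_injective' : Function.Injective (algebraMap F (CliffordAlgebra q)) := by
  have := clifford_nontrivial (q := q)
  exact (algebraMap F (CliffordAlgebra q)).injective

/-- The Euler operator of the exterior algebra. -/
theorem sum_ι_mul_contractLeft (b : Module.Basis (Fin (Module.finrank F W)) F W) (n : ℕ)
    (y : ExteriorAlgebra F W) (hy : y ∈ (⋀[F]^n W)) :
    ∑ i, ι (0 : QuadraticForm F W) (b i) * contractLeft (b.coord i) y = (n : F) • y := by
  induction hy using Submodule.pow_induction_on_left' with
  | algebraMap r => simp
  | add x y i _ _ hx hy =>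
    simp only [map_add, mul_add, Finset.sum_add_distrib, hx, hy, smul_add]
  | mem_mul m hm i x _ hx =>
    obtain ⟨m, rfl⟩ := hm
    change ∑ i, ι (0 : QuadraticForm F W) (b i) * contractLeft (b.coord i)
      (ι (0 : QuadraticForm F W) m * x) = _ • (ι (0 : QuadraticForm F W) m * x)
    have h1 : ∀ j, ι (0 : QuadraticForm F W) (b j) * contractLeft (b.coord j)
        (ι (0 : QuadraticForm F W) m * x) = ι (0 : QuadraticForm F W) (b.coord j m • b j) * x +
          ι (0 : QuadraticForm F W) m *
            (ι (0 : QuadraticForm F W) (b j) * contractLeft (b.coord j) x) := by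
      intro j
      rw [contractLeft_ι_mul, mul_sub, mul_smul_comm, map_smul, smul_mul_assoc, ← mul_assoc,
        ι_mul_ι_swap (b j) m]
      simp [QuadraticMap.polar, sub_eq_add_neg, mul_assoc]
    rw [Finset.sum_congr rfl fun j _ => h1 j, Finset.sum_add_distrib, ← Finset.sum_mul,
      ← Finset.mul_sum, hx, ← map_sum]
    have : ∑ j, b.coord j m • b j = m := b.sum_repr m
    rw [this, mul_smul_comm]
    push_cast
    rw [add_smul, one_smul, add_comm]

variable [FiniteDimensional F W]

/-- The Euler operator multiplies the component of degree `n` by `n`, and it is built from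
contractions. If all contractions vanish, then in characteristic zero only degree 0 survives. -/
theorem mem_range_algebraMap_of_contractLeft_eq_zero (y : ExteriorAlgebra F W)
    (hy : ∀ d : Module.Dual F W, contractLeft (Q := (0 : QuadraticForm F W)) d y = 0) :
    ∃ c : F, y = algebraMap F _ c := by
  classical
  let b := Module.finBasis F W
  have hdec : ∑ n ∈ (DirectSum.decompose (fun n ↦ ⋀[F]^n W) y).support,
      (DirectSum.decompose (fun n ↦ ⋀[F]^n W) y n : ExteriorAlgebra F W) = y :=
    DirectSum.sum_support_decompose _ y
  set s := (DirectSum.decompose (fun n ↦ ⋀[F]^n W) y).support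
  set z : ℕ → ExteriorAlgebra F W := fun n =>
    (DirectSum.decompose (fun n ↦ ⋀[F]^n W) y n : ExteriorAlgebra F W) with hz
  have hzmem : ∀ n, z n ∈ (⋀[F]^n W) := fun n => SetLike.coe_mem _
  -- The Euler operator applied to `y`, computed once degree by degree and once through the
  -- vanishing contractions.
  have h0 : ∑ n ∈ s, (n : F) • z n = 0 := by
    calc ∑ n ∈ s, (n : F) • z n
        = ∑ n ∈ s, ∑ i, ι (0 : QuadraticForm F W) (b i) * contractLeft (b.coord i) (z n) :=
          Finset.sum_congr rfl fun n _ => (sum_ι_mul_contractLeft b n _ (hzmem n)).symm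
      _ = ∑ i, ι (0 : QuadraticForm F W) (b i) * contractLeft (b.coord i) (∑ n ∈ s, z n) := by
          rw [Finset.sum_comm]
          refine Finset.sum_congr rfl fun i _ => ?_
          rw [← Finset.mul_sum]
          exact congrArg _ (map_sum (contractLeft (Q := (0 : QuadraticForm F W)) (b.coord i)) z s).symm
      _ = 0 := by
          rw [hdec]
          exact Finset.sum_eq_zero fun i _ => by rw [hy, mul_zero]
  have hzero : ∀ m ∈ s, m ≠ 0 → z m = 0 := by
    intro m hm hm0
    have h := congrArg (GradedAlgebra.proj (fun n ↦ ⋀[F]^n W) m) h0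
    rw [map_sum, map_zero, Finset.sum_eq_single m] at h
    · rw [GradedAlgebra.proj_apply, DirectSum.decompose_of_mem_same (fun n ↦ ⋀[F]^n W)
        (Submodule.smul_mem _ _ (hzmem m))] at h
      exact (smul_eq_zero.1 h).resolve_left (Nat.cast_ne_zero.2 hm0)
    · intro n _ hn
      rw [GradedAlgebra.proj_apply]
      exact DirectSum.decompose_of_mem_ne (fun n ↦ ⋀[F]^n W)
        (Submodule.smul_mem _ _ (hzmem n)) hn
    · exact fun h => absurd hm h
  have hy0 : y = z 0 := by
    rw [← hdec]
    by_cases h : 0 ∈ s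
    · exact Finset.sum_eq_single 0 (fun n hn h0 => hzero n hn h0) (fun h' => absurd h h')
    · rw [Finset.sum_eq_zero fun n hn => hzero n hn (fun h' => h (h' ▸ hn))]
      have := DFinsupp.notMem_support_iff.1 h
      simp [hz, this]
  have := hzmem 0
  rw [← hy0] at this
  have h1 : y ∈ (1 : Submodule F (ExteriorAlgebra F W)) := by simpa using this
  obtain ⟨c, hc⟩ := Submodule.mem_one.1 h1
  exact ⟨c, hc.symm⟩

/-- In the Clifford algebra of a non-degenerate form only the scalars commute in the twisted sense
with all vectors. -/
theorem eq_algebraMap_of_twisted_commute (hq : ∀ v : W, (∀ w, QuadraticMap.polar q v w = 0) → v = 0)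
    (x : CliffordAlgebra q) (hx : ∀ v, involute x * ι q v = ι q v * x) :
    ∃ c : F, x = algebraMap F _ c := by
  let : Invertible (2 : F) := invertibleOfNonzero two_ne_zero
  have hinj : Function.Injective q.polarBilin := by
    refine (injective_iff_map_eq_zero _).2 fun v hv => hq v fun w => ?_
    simpa using LinearMap.congr_fun hv w
  have hsurj : Function.Surjective q.polarBilin :=
    (LinearMap.injective_iff_surjective_of_finrank_eq_finrank
      (Subspace.dual_finrank_eq (K := F) (V := W)).symm).1 hinj
  -- By non-degeneracy every functional is the pairing with some vector `v`. Contraction with it is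
  -- the twisted commutator with `v`, which vanishes on `x`; the linear isomorphism with the
  -- exterior algebra respects contractions.
  obtain ⟨c, hc⟩ := mem_range_algebraMap_of_contractLeft_eq_zero (equivExterior q x) (by
    intro d
    obtain ⟨v, rfl⟩ := hsurj d
    have h := contractLeft_polar v x
    rw [hx, sub_self] at h
    have h2 := changeForm_contractLeft (Q := q) (Q' := 0) changeForm.associated_neg_proof
      (q.polarBilin v) x
    rw [h, map_zero] at h2
    exact h2.symm)
  refine ⟨c, (equivExterior q).injective ?_⟩
  rw [hc]
  exact (changeForm_algebraMap (Q := q) (Q' := 0) changeForm.associated_neg_proof c).symm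

end CliffordGeneral

/-! ### Reflections and the Cartan–Dieudonné theorem inside the Clifford algebra -/

section Cartan

open CliffordAlgebra

variable {F : Type*} [Field F] {W : Type*} [AddCommGroup W] [Module F W] {q : QuadraticForm F W}

/-- If `α(x) v = f x` for vectors `v`, `f`, then these have the same length. -/
theorem eq_of_twisted_conj [CharZero F] {x y : CliffordAlgebra q} (hy : y * x = 1) {v f : W}
    (h : involute x * ι q v = ι q f * x) : q f = q v := by
  have := clifford_nontrivial (q := q)
  -- The grade involution turns the hypothesis into a second relation; using both in turn moves the
  -- square of `v` across `x` as the square of `f`.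
  have h1 : x * ι q v = ι q f * involute x := by
    have := congrArg involute h
    simpa [map_mul] using this
  have h2 : q v • involute x = q f • involute x := by
    calc q v • involute x = involute x * ι q v * ι q v := by
          rw [mul_assoc, ι_mul_self_eq_smul, mul_smul_comm, mul_one]
      _ = q f • involute x := by
          rw [h, mul_assoc, h1, ← mul_assoc, ι_mul_self_eq_smul, smul_mul_assoc, one_mul]
  have h3 : involute y * involute x = 1 := by rw [← map_mul, hy, map_one]
  have h4 : q v • (1 : CliffordAlgebra q) = q f • 1 := by
    rw [← h3, ← mul_smul_comm, h2, mul_smul_comm]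
  exact (smul_left_injective F one_ne_zero h4).symm

theorem polar_eq_of_twisted_conj [CharZero F] {x y : CliffordAlgebra q} (hy : y * x = 1)
    {v f v' f' : W} (h : involute x * ι q v = ι q f * x) (h' : involute x * ι q v' = ι q f' * x) :
    QuadraticMap.polar q f f' = QuadraticMap.polar q v v' := by
  have h2 : involute x * ι q (v + v') = ι q (f + f') * x := by
    rw [map_add, mul_add, h, h', map_add, add_mul]
  simp only [QuadraticMap.polar, eq_of_twisted_conj hy h, eq_of_twisted_conj hy h',
    eq_of_twisted_conj hy h2]

theorem ι_mul_ι_of_polar_eq_zero {v w : W} (h : QuadraticMap.polar q v w = 0) :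
    ι q v * ι q w = -(ι q w * ι q v) := by
  rw [ι_mul_ι_swap, h, zero_smul, zero_sub]

/-- Conjugation by an anisotropic vector maps vectors to vectors. -/
theorem exists_ι_mul_eq {a : W} (ha : q a ≠ 0) (v : W) :
    ∃ w, ι q a * ι q v = -(ι q w * ι q a) ∧
      w = v - (QuadraticMap.polar q a v * (q a)⁻¹) • a := by
  refine ⟨_, ?_, rfl⟩
  rw [ι_mul_ι_swap, map_sub, map_smul, sub_mul, smul_mul_assoc, ι_mul_self_eq_smul, smul_smul,
    mul_assoc, inv_mul_cancel₀ ha, mul_one]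
  abel

theorem involute_ι_mul (a : W) (x : CliffordAlgebra q) :
    involute (ι q a * x) = -(ι q a * involute x) := by
  rw [map_mul, involute_ι, neg_mul]

theorem exists_left_inv_ι_mul {a : W} (ha : q a ≠ 0) {x y : CliffordAlgebra q} (hy : y * x = 1) :
    (q a)⁻¹ • (y * ι q a) * (ι q a * x) = 1 := by
  rw [smul_mul_assoc, mul_assoc, ← mul_assoc (ι q a), ι_mul_self_eq_smul, smul_mul_assoc, one_mul,
    mul_smul_comm, hy, smul_smul, inv_mul_cancel₀ ha, one_smul]

theorem eq_smul_ι_mul {a : W} (ha : q a ≠ 0) (x : CliffordAlgebra q) :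
    x = (q a)⁻¹ • (ι q a * (ι q a * x)) := by
  rw [← mul_assoc, ι_mul_self_eq_smul, smul_mul_assoc, one_mul, smul_smul, inv_mul_cancel₀ ha,
    one_smul]

theorem q_sub_add_q_add (f e : W) : q (f - e) + q (f + e) = 2 * (q f + q e) := by
  have h1 := QuadraticMap.map_add q f e
  have h2 := QuadraticMap.map_add q f (-e)
  rw [← sub_eq_add_neg, QuadraticMap.polar_neg_right, QuadraticMap.map_neg] at h2
  rw [h1, h2]; ring

/-- The theorem of Cartan and Dieudonné in the form needed here: an invertible element of the
Clifford algebra which acts on the vectors, fixing the complement `D` of the span of orthogonal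
vectors `es`, is up to a scalar a product of vectors of `U = U'ᗮ`. -/
theorem exists_eq_smul_prod [CharZero F] [FiniteDimensional F W]
    (hq : ∀ v : W, (∀ w, QuadraticMap.polar q v w = 0) → v = 0)
    (U U' : Submodule F W) (hU : ∀ z, (∀ u ∈ U', QuadraticMap.polar q u z = 0) → z ∈ U)
    (es : List W) : ∀ (D : Submodule F W) (x y : CliffordAlgebra q), y * x = 1 → U' ≤ D →
    (∀ d ∈ D, involute x * ι q d = ι q d * x) →
    (∀ v, ∃ w, involute x * ι q v = ι q w * x) →
    (∀ e ∈ es, e ∈ U ∧ q e ≠ 0) → es.Pairwise (fun e e' => QuadraticMap.polar q e e' = 0) →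
    (∀ e ∈ es, ∀ d ∈ D, QuadraticMap.polar q d e = 0) →
    D ⊔ Submodule.span F {e | e ∈ es} = ⊤ →
    ∃ (c : F) (l : List W), (∀ v ∈ l, v ∈ U ∧ q v ≠ 0) ∧ l.length ≤ 2 * es.length ∧
      x = c • (l.map (ι q)).prod := by
  induction es with
  | nil =>
    intro D x y _ _ hD _ _ _ _ htop
    -- With no vector left to fix, `x` commutes in the twisted sense with every vector and is
    -- therefore a scalar.
    have hD' : D = ⊤ := by simpa using htop
    obtain ⟨c, hc⟩ := eq_algebraMap_of_twisted_commute hq x fun v => hD v (by simp [hD'])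
    exact ⟨c, [], by simp, by simp, by simp [hc, Algebra.algebraMap_eq_smul_one]⟩
  | cons e es ih =>
    intro D x y hyx hU' hD hvec hes hpair horth htop
    obtain ⟨heU, hqe⟩ := hes e (by simp)
    have hde : ∀ d ∈ D, QuadraticMap.polar q d e = 0 := horth e (by simp)
    -- The image `f` of `e` has the length of `e`, and it is orthogonal to `D` because `x` is an
    -- isometry fixing `D`. Hence it lies in `U`.
    obtain ⟨f, hf⟩ := hvec e
    have hqf : q f = q e := eq_of_twisted_conj hyx hf
    have hdf : ∀ d ∈ D, QuadraticMap.polar q d f = 0 := fun d hd => by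
      rw [polar_eq_of_twisted_conj hyx (hD d hd) hf, hde d hd]
    have hfU : f ∈ U := hU f fun u hu => hdf u (hU' hu)
    -- the step of the induction
    have key : ∀ x₁ y₁ : CliffordAlgebra q, y₁ * x₁ = 1 →
        (∀ d ∈ D, involute x₁ * ι q d = ι q d * x₁) → involute x₁ * ι q e = ι q e * x₁ →
        (∀ v, ∃ w, involute x₁ * ι q v = ι q w * x₁) →
        ∃ (c : F) (l : List W), (∀ v ∈ l, v ∈ U ∧ q v ≠ 0) ∧ l.length ≤ 2 * es.length ∧
          x₁ = c • (l.map (ι q)).prod := by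
      intro x₁ y₁ h1 h2 h3 h4
      refine ih (D ⊔ Submodule.span F {e}) x₁ y₁ h1 (hU'.trans le_sup_left) ?_ h4
        (fun e' he' => hes e' (by simp [he'])) (List.pairwise_cons.1 hpair).2 ?_ ?_
      · intro d hd
        obtain ⟨d', hd', z, hz, rfl⟩ := Submodule.mem_sup.1 hd
        obtain ⟨r, rfl⟩ := Submodule.mem_span_singleton.1 hz
        rw [map_add, mul_add, h2 d' hd', add_mul, map_smul, mul_smul_comm, h3, smul_mul_assoc]
      · intro e' he' d hd
        obtain ⟨d', hd', z, hz, rfl⟩ := Submodule.mem_sup.1 hd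
        obtain ⟨r, rfl⟩ := Submodule.mem_span_singleton.1 hz
        rw [QuadraticMap.polar_add_left, QuadraticMap.polar_smul_left,
          horth e' (by simp [he']) d' hd', (List.pairwise_cons.1 hpair).1 e' he']
        simp
      · rw [sup_assoc, ← Submodule.span_union, ← htop]
        congr 2
        ext v; simp
    have hcomm : ∀ a : W, (∀ d ∈ D, QuadraticMap.polar q d a = 0) → ∀ x₁ : CliffordAlgebra q,
        (∀ d ∈ D, involute x₁ * ι q d = ι q d * x₁) →
        ∀ d ∈ D, involute (ι q a * x₁) * ι q d = ι q d * (ι q a * x₁) := by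
      intro a ha x₁ h1 d hd
      rw [involute_ι_mul, neg_mul, mul_assoc, h1 d hd, ← mul_assoc, ← mul_assoc,
        ι_mul_ι_of_polar_eq_zero (ha d hd), neg_mul]
    have hvec' : ∀ a : W, q a ≠ 0 → ∀ x₁ : CliffordAlgebra q,
        (∀ v, ∃ w, involute x₁ * ι q v = ι q w * x₁) →
        ∀ v, ∃ w, involute (ι q a * x₁) * ι q v = ι q w * (ι q a * x₁) := by
      intro a ha x₁ h1 v
      obtain ⟨w, hw⟩ := h1 v
      obtain ⟨w', hw', -⟩ := exists_ι_mul_eq ha w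
      refine ⟨w', ?_⟩
      rw [involute_ι_mul, neg_mul, mul_assoc, hw, ← mul_assoc, hw', neg_mul, neg_neg, mul_assoc]
    -- If `f - e` is anisotropic, its reflection sends `f` to `e`. Otherwise `f + e` is anisotropic,
    -- its reflection sends `f` to `-e`, and the reflection in `e` corrects the sign. At most two
    -- vectors are used per step, whence the bound on the length.
    by_cases hfe : q (f - e) = 0
    · have hfe' : q (f + e) ≠ 0 := by
        intro h
        have := q_sub_add_q_add (q := q) f e
        rw [hfe, h, hqf, zero_add] at this
        have h4 : (4 : F) * q e = 0 := by linear_combination -this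
        exact hqe ((mul_eq_zero.1 h4).resolve_left (by norm_num))
      have ha : ∀ d ∈ D, QuadraticMap.polar q d (f + e) = 0 := fun d hd => by
        rw [QuadraticMap.polar_add_right, hdf d hd, hde d hd, add_zero]
      obtain ⟨c, l, hl, hlen, hx⟩ := key (ι q e * (ι q (f + e) * x)) _
        (exists_left_inv_ι_mul hqe (exists_left_inv_ι_mul hfe' hyx))
        (hcomm e hde _ (hcomm _ ha x hD)) (by
          rw [involute_ι_mul, involute_ι_mul, mul_neg, neg_neg, mul_assoc, mul_assoc, hf]
          simp only [← mul_assoc]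
          congr 1
          simp only [map_add, mul_add, add_mul, mul_assoc, ι_mul_self_eq_smul, hqf, mul_smul_comm,
            mul_one]
          simp only [smul_mul_assoc, one_mul]
          abel) (hvec' e hqe _ (hvec' _ hfe' x hvec))
      refine ⟨(q (f + e))⁻¹ * (q e)⁻¹ * c, (f + e) :: e :: l, ?_, ?_, ?_⟩
      · intro v hv
        rcases List.mem_cons.1 hv with rfl | hv
        · exact ⟨U.add_mem hfU heU, hfe'⟩
        rcases List.mem_cons.1 hv with rfl | hv
        · exact ⟨heU, hqe⟩
        · exact hl v hv
      · simp only [List.length_cons]; omega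
      · rw [eq_smul_ι_mul hfe' x, eq_smul_ι_mul hqe (ι q (f + e) * x), hx]
        simp only [List.map_cons, List.prod_cons, mul_smul_comm, smul_smul, mul_assoc]
    · have ha : ∀ d ∈ D, QuadraticMap.polar q d (f - e) = 0 := fun d hd => by
        rw [QuadraticMap.polar_sub_right, hdf d hd, hde d hd, sub_zero]
      obtain ⟨c, l, hl, hlen, hx⟩ := key (ι q (f - e) * x) _ (exists_left_inv_ι_mul hfe hyx)
        (hcomm _ ha x hD) (by
          rw [involute_ι_mul, neg_mul, mul_assoc, hf, ← mul_assoc, ← mul_assoc, ← neg_mul]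
          congr 1
          simp only [map_sub, mul_sub, sub_mul, ι_mul_self_eq_smul, hqf]
          abel) (hvec' _ hfe x hvec)
      refine ⟨(q (f - e))⁻¹ * c, (f - e) :: l, ?_, ?_, ?_⟩
      · intro v hv
        rcases List.mem_cons.1 hv with rfl | hv
        · exact ⟨U.sub_mem hfU heU, hfe⟩
        · exact hl v hv
      · simp only [List.length_cons]; omega
      · rw [eq_smul_ι_mul hfe x, hx]
        simp only [List.map_cons, List.prod_cons, mul_smul_comm, smul_smul]

end Cartan

/-! ### Non-degenerate subspaces, hyperbolic pairs and isotropic eigenvectors -/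

section Geometry

variable {F : Type*} [Field F] {W : Type*} [AddCommGroup W] [Module F W]

/-- The subspace `U` is non-degenerate for the quadratic form `q`. -/
def IsNondeg (q : QuadraticForm F W) (U : Submodule F W) : Prop :=
  ∀ u ∈ U, (∀ v ∈ U, QuadraticMap.polar q u v = 0) → u = 0

/-- The vectors orthogonal to `v`. -/
def orth (q : QuadraticForm F W) (v : W) : Submodule F W :=
  LinearMap.ker (q.polarBilin v)

variable {q : QuadraticForm F W} {U : Submodule F W}

theorem mem_orth {v w : W} : w ∈ orth q v ↔ QuadraticMap.polar q v w = 0 := by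
  simp [orth]

theorem polar_self' (v : W) : QuadraticMap.polar q v v = 2 * q v := by
  rw [QuadraticMap.polar_self, nsmul_eq_mul, Nat.cast_ofNat]

theorem polar_smul_add (v w : W) (a b : F) :
    q (a • v + b • w) = a ^ 2 * q v + b ^ 2 * q w + a * b * QuadraticMap.polar q v w := by
  rw [QuadraticMap.map_add q, QuadraticMap.map_smul, QuadraticMap.map_smul,
    QuadraticMap.polar_smul_left, QuadraticMap.polar_smul_right]
  simp only [smul_eq_mul]; ring

theorem IsNondeg.exists_ne_zero (hU : IsNondeg q U) (h : U ≠ ⊥) : ∃ v ∈ U, q v ≠ 0 := by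
  by_contra! hv
  obtain ⟨u, hu, hu0⟩ := Submodule.exists_mem_ne_zero_of_ne_bot h
  refine hu0 (hU u hu fun v hv' => ?_)
  rw [QuadraticMap.polar, hv _ (U.add_mem hu hv'), hv u hu, hv v hv']
  simp

theorem IsNondeg.inf_orth [CharZero F] (hU : IsNondeg q U) {v : W} (hv : v ∈ U) (hqv : q v ≠ 0) :
    IsNondeg q (U ⊓ orth q v) := by
  rintro u ⟨hu, huv⟩ h
  refine hU u hu fun w hw => ?_
  have huv : QuadraticMap.polar q u v = 0 := by
    rw [QuadraticMap.polar_comm]; exact mem_orth.1 huv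
  -- Removing from `w` its component along `v` does not change the pairing with `u`, and the result
  -- is orthogonal to `v`. The factor 2 comes from `polar q v v = 2 * q v`.
  have h1 := h (w - (QuadraticMap.polar q v w * (2 * q v)⁻¹) • v)
    ⟨U.sub_mem hw (U.smul_mem _ hv), by
      rw [SetLike.mem_coe, mem_orth, QuadraticMap.polar_sub_right, QuadraticMap.polar_smul_right, polar_self',
        smul_eq_mul, mul_assoc, inv_mul_cancel₀ (mul_ne_zero two_ne_zero hqv), mul_one, sub_self]⟩
  rwa [QuadraticMap.polar_sub_right, QuadraticMap.polar_smul_right, huv, smul_zero, sub_zero] at h1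

/-- The vectors orthogonal to `v` are the kernel of one functional, so intersecting with them loses
at most one dimension. -/
theorem finrank_le_finrank_inf_orth [FiniteDimensional F W] (U : Submodule F W) (v : W) :
    Module.finrank F U ≤ Module.finrank F ↥(U ⊓ orth q v) + 1 := by
  have h1 := Submodule.finrank_sup_add_finrank_inf_eq U (orth q v)
  have h2 := Submodule.finrank_le (U ⊔ orth q v)
  have h3 := LinearMap.finrank_range_add_finrank_ker (q.polarBilin v)
  have h4 := Submodule.finrank_le (LinearMap.range (q.polarBilin v))
  rw [Module.finrank_self] at h4
  change _ + Module.finrank F (orth q v) = _ at h3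
  omega

theorem ne_bot_of_finrank_pos {S : Submodule F W} (h : 0 < Module.finrank F S) : S ≠ ⊥ := by
  rintro rfl
  simp at h

/-- Gram–Schmidt: split off an anisotropic vector and continue in its orthogonal complement, which
stays non-degenerate. -/
theorem IsNondeg.exists_orthogonal_list [CharZero F] [FiniteDimensional F W] (n : ℕ) :
    ∀ U : Submodule F W, IsNondeg q U → Module.finrank F U ≤ n →
      ∃ es : List W, (∀ e ∈ es, e ∈ U ∧ q e ≠ 0) ∧
        es.Pairwise (fun e e' => QuadraticMap.polar q e e' = 0) ∧
        U ≤ Submodule.span F {e | e ∈ es} := by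
  induction n with
  | zero =>
    intro U _ hn
    have : U = ⊥ := Submodule.finrank_eq_zero.1 (Nat.le_zero.1 hn)
    exact ⟨[], by simp, List.Pairwise.nil, by simp [this]⟩
  | succ n ih =>
    intro U hU hn
    by_cases h0 : U = ⊥
    · exact ⟨[], by simp, List.Pairwise.nil, by simp [h0]⟩
    obtain ⟨v, hv, hqv⟩ := hU.exists_ne_zero h0
    have hlt : Module.finrank F ↥(U ⊓ orth q v) < Module.finrank F U := by
      refine Submodule.finrank_lt_finrank_of_lt (lt_of_le_of_ne inf_le_left fun h => hqv ?_)
      have : v ∈ U ⊓ orth q v := by rwa [h]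
      have := mem_orth.1 this.2
      rw [polar_self'] at this
      exact (mul_eq_zero.1 this).resolve_left two_ne_zero
    obtain ⟨es, h1, h2, h3⟩ := ih _ (hU.inf_orth hv hqv) (by omega)
    refine ⟨v :: es, ?_, List.pairwise_cons.2 ⟨fun e he => mem_orth.1 (h1 e he).1.2, h2⟩, ?_⟩
    · intro e he
      rcases List.mem_cons.1 he with rfl | he
      · exact ⟨hv, hqv⟩
      · exact ⟨(h1 e he).1.1, (h1 e he).2⟩
    · intro w hw
      have hmem : w - (QuadraticMap.polar q v w * (2 * q v)⁻¹) • v ∈ U ⊓ orth q v :=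
        ⟨U.sub_mem hw (U.smul_mem _ hv), by
          rw [SetLike.mem_coe, mem_orth, QuadraticMap.polar_sub_right,
            QuadraticMap.polar_smul_right, polar_self',
            smul_eq_mul, mul_assoc, inv_mul_cancel₀ (mul_ne_zero two_ne_zero hqv), mul_one,
            sub_self]⟩
      have hspan := Submodule.span_mono (R := F) (s := {e | e ∈ es}) (t := {e | e ∈ v :: es})
        (fun e he => List.mem_cons_of_mem v he) (h3 hmem)
      rw [← sub_add_cancel w ((QuadraticMap.polar q v w * (2 * q v)⁻¹) • v)]
      exact Submodule.add_mem _ hspan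
        (Submodule.smul_mem _ _ (Submodule.subset_span (by simp)))

/-- An isotropic vector is part of a hyperbolic pair. -/
theorem IsNondeg.exists_hyperbolic (hU : IsNondeg q U) {u : W} (hu : u ∈ U) (hu0 : u ≠ 0)
    (hqu : q u = 0) : ∃ u' ∈ U, q u' = 0 ∧ QuadraticMap.polar q u u' = 1 := by
  obtain ⟨x, hx, hux⟩ : ∃ x ∈ U, QuadraticMap.polar q u x ≠ 0 := by
    by_contra! h
    exact hu0 (hU u hu h)
  set s := QuadraticMap.polar q u x with hs
  -- Adding a multiple of `u` leaves the pairing with `u` unchanged and alters the length linearly,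
  -- so the coefficient can be chosen to make the length zero.
  refine ⟨s⁻¹ • x + (-(q x * (s ^ 2)⁻¹)) • u, U.add_mem (U.smul_mem _ hx) (U.smul_mem _ hu), ?_, ?_⟩
  · rw [polar_smul_add, hqu, QuadraticMap.polar_comm, ← hs]
    field_simp
    ring
  · rw [QuadraticMap.polar_add_right, QuadraticMap.polar_smul_right, QuadraticMap.polar_smul_right,
      polar_self', hqu, ← hs, smul_eq_mul, inv_mul_cancel₀ hux]
    simp

theorem exists_smul_eq_one [IsAlgClosed F] {v : W} (hv : q v ≠ 0) :
    ∃ c : F, c ≠ 0 ∧ q (c • v) = 1 := by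
  obtain ⟨z, hz⟩ := IsAlgClosed.exists_pow_nat_eq (q v) (n := 2) two_pos
  have hz0 : z ≠ 0 := by rintro rfl; exact hv (by rw [← hz]; simp)
  refine ⟨z⁻¹, inv_ne_zero hz0, ?_⟩
  rw [QuadraticMap.map_smul, ← hz, smul_eq_mul]
  field_simp

variable [IsAlgClosed F] [CharZero F] [FiniteDimensional F W]

theorem IsNondeg.exists_unit_orth (hU : IsNondeg q U) (hdim : 2 ≤ Module.finrank F U) {v : W}
    (hv : v ∈ U) (hqv : q v ≠ 0) : ∃ m ∈ U, QuadraticMap.polar q v m = 0 ∧ q m = 1 := by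
  have h := finrank_le_finrank_inf_orth (q := q) U v
  obtain ⟨m, hm, hqm⟩ := (hU.inf_orth hv hqv).exists_ne_zero (ne_bot_of_finrank_pos (by omega))
  obtain ⟨c, -, hc⟩ := exists_smul_eq_one hqm
  exact ⟨c • m, U.smul_mem _ hm.1, mem_orth.1 ((orth q v).smul_mem _ hm.2), hc⟩

/-- There are vectors of length one orthogonal to a hyperbolic plane. -/
theorem IsNondeg.exists_unit_orth_hyperbolic (hU : IsNondeg q U) (hdim : 3 ≤ Module.finrank F U)
    {u u' : W} (hu : u ∈ U) (hu' : u' ∈ U) (hqu : q u = 0) (hqu' : q u' = 0)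
    (h1 : QuadraticMap.polar q u u' ≠ 0) :
    ∃ m ∈ U, QuadraticMap.polar q u m = 0 ∧ QuadraticMap.polar q u' m = 0 ∧ q m = 1 := by
  have hq1 : q (u + u') ≠ 0 := by rwa [QuadraticMap.map_add q, hqu, hqu', zero_add, zero_add]
  -- The vectors `u + u'` and `u - u'` form an orthogonal basis of the plane. Both are anisotropic,
  -- so their complements can be taken one after the other.
  have hmem : u - u' ∈ U ⊓ orth q (u + u') := ⟨U.sub_mem hu hu', by
    rw [SetLike.mem_coe, mem_orth, QuadraticMap.polar_add_left, QuadraticMap.polar_sub_right,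
      QuadraticMap.polar_sub_right, polar_self', polar_self', hqu, hqu',
      QuadraticMap.polar_comm _ u' u]
    ring⟩
  have hq2 : q (u - u') ≠ 0 := by
    intro h
    have := q_sub_add_q_add (q := q) u u'
    rw [h, hqu, hqu'] at this
    exact hq1 (by linear_combination this)
  obtain ⟨m, hm, hm2, hqm⟩ := (hU.inf_orth (U.add_mem hu hu') hq1).exists_unit_orth (by
    have := finrank_le_finrank_inf_orth (q := q) U (u + u'); omega) hmem hq2
  have h3 := mem_orth.1 hm.2
  rw [QuadraticMap.polar_add_left] at h3
  rw [QuadraticMap.polar_sub_left] at hm2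
  have h4 : 2 * QuadraticMap.polar q u m = 0 := by linear_combination h3 + hm2
  have h5 := (mul_eq_zero.1 h4).resolve_left two_ne_zero
  exact ⟨m, hm.1, h5, by linear_combination h3 - h5, hqm⟩

omit [CharZero F] in
theorem exists_eigenvector (T : W →ₗ[F] W) {S : Submodule F W} (hS : S ≠ ⊥)
    (hT : ∀ v ∈ S, T v ∈ S) : ∃ v ∈ S, v ≠ 0 ∧ ∃ c : F, T v = c • v := by
  have : Nontrivial S := Submodule.nontrivial_iff_ne_bot.2 hS
  obtain ⟨c, hc⟩ := Module.End.exists_eigenvalue (T.restrict hT)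
  obtain ⟨v, hv⟩ := hc.exists_hasEigenvector
  refine ⟨v, v.2, fun h => hv.2 (Subtype.ext h), c, ?_⟩
  exact congrArg Subtype.val hv.apply_eq_smul

/-- An isometry of a space of dimension at least three has an isotropic eigenvector. -/
theorem exists_isotropic_eigenvector
    (hdim : 3 ≤ Module.finrank F U) (T : W →ₗ[F] W) (hTq : ∀ v, q (T v) = q v)
    (hT : ∀ v ∈ U, T v ∈ U) :
    ∃ u ∈ U, u ≠ 0 ∧ q u = 0 ∧ ∃ c : F, T u = c • u := by
  by_contra! hno
  have hTp : ∀ v w, QuadraticMap.polar q (T v) (T w) = QuadraticMap.polar q v w := fun v w => by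
    simp only [QuadraticMap.polar, ← map_add, hTq]
  -- Under the assumption for contradiction every eigenvector is anisotropic; an isometry then has
  -- only the eigenvalues 1 and -1 on `U`.
  have hne : ∀ v ∈ U, v ≠ 0 → ∀ c : F, T v = c • v → q v ≠ 0 ∧ (c = 1 ∨ c = -1) := by
    intro v hv hv0 c hc
    have hqv : q v ≠ 0 := fun h => hno v hv hv0 h c hc
    refine ⟨hqv, ?_⟩
    have h := hTq v
    rw [hc, QuadraticMap.map_smul, smul_eq_mul] at h
    exact mul_self_eq_one_iff.1 (mul_right_cancel₀ hqv (h.trans (one_mul _).symm))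
  have hstab : ∀ v : W, ∀ c : F, T v = c • v → c = 1 ∨ c = -1 → ∀ w ∈ orth q v,
      T w ∈ orth q v := by
    intro v c hc hc1 w hw
    have h := hTp v w
    rw [mem_orth.1 hw, hc, QuadraticMap.polar_smul_left] at h
    refine mem_orth.2 ((mul_eq_zero.1 h).resolve_left ?_)
    rcases hc1 with rfl | rfl <;> simp
  -- two orthogonal eigenvectors for the same eigenvalue give an isotropic one
  have hpair : ∀ v ∈ U, ∀ w ∈ U, v ≠ 0 → w ≠ 0 → QuadraticMap.polar q v w = 0 → ∀ c : F,
      T v = c • v → T w = c • w → False := by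
    intro v hv w hw hv0 hw0 hvw c hcv hcw
    obtain ⟨hqv, -⟩ := hne v hv hv0 c hcv
    obtain ⟨hqw, -⟩ := hne w hw hw0 c hcw
    -- This `z` makes `v + z • w` isotropic, as `v` and `w` are orthogonal.
    obtain ⟨z, hz⟩ := IsAlgClosed.exists_pow_nat_eq (-(q v / q w)) (n := 2) two_pos
    refine hno (v + z • w) (U.add_mem hv (U.smul_mem _ hw)) ?_ ?_ c ?_
    · intro h
      have h1 := congrArg (QuadraticMap.polar q v) h
      rw [QuadraticMap.polar_add_right, QuadraticMap.polar_smul_right, hvw, smul_zero, add_zero,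
        QuadraticMap.polar_zero_right, polar_self'] at h1
      exact hqv ((mul_eq_zero.1 h1).resolve_left two_ne_zero)
    · have := polar_smul_add (q := q) v w 1 z
      rw [one_smul] at this
      rw [this, hvw, hz]
      field_simp
      ring
    · rw [map_add, map_smul, hcv, hcw, smul_add, smul_comm]
  -- The complement of an anisotropic eigenvector is stable, so dimension three yields three
  -- mutually orthogonal eigenvectors. Two of them must share one of the two possible eigenvalues.
  obtain ⟨v₁, hv₁, h01, c₁, hc₁⟩ := exists_eigenvector T (ne_bot_of_finrank_pos (by omega)) hT
  obtain ⟨hq1, he1⟩ := hne v₁ hv₁ h01 c₁ hc₁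
  have hd1 := finrank_le_finrank_inf_orth (q := q) U v₁
  have hT1 : ∀ v ∈ U ⊓ orth q v₁, T v ∈ U ⊓ orth q v₁ := fun v hv =>
    ⟨hT v hv.1, hstab v₁ c₁ hc₁ he1 v hv.2⟩
  obtain ⟨v₂, hv₂, h02, c₂, hc₂⟩ := exists_eigenvector T (ne_bot_of_finrank_pos (by omega)) hT1
  obtain ⟨hq2, he2⟩ := hne v₂ hv₂.1 h02 c₂ hc₂
  have hd2 := finrank_le_finrank_inf_orth (q := q) (U ⊓ orth q v₁) v₂
  obtain ⟨v₃, hv₃, h03, c₃, hc₃⟩ := exists_eigenvector T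
    (S := (U ⊓ orth q v₁) ⊓ orth q v₂) (ne_bot_of_finrank_pos (by omega))
    (fun v hv => ⟨hT1 v hv.1, hstab v₂ c₂ hc₂ he2 v hv.2⟩)
  obtain ⟨hq3, he3⟩ := hne v₃ hv₃.1.1 h03 c₃ hc₃
  have h12 := mem_orth.1 hv₂.2
  have h13 := mem_orth.1 hv₃.1.2
  have h23 := mem_orth.1 hv₃.2
  by_cases e12 : c₁ = c₂
  · exact hpair v₁ hv₁ v₂ hv₂.1 h01 h02 h12 c₁ hc₁ (e12 ▸ hc₂)
  by_cases e13 : c₁ = c₃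
  · exact hpair v₁ hv₁ v₃ hv₃.1.1 h01 h03 h13 c₁ hc₁ (e13 ▸ hc₃)
  have e23 : c₂ = c₃ := by
    rcases he1 with rfl | rfl <;> rcases he2 with rfl | rfl <;> rcases he3 with rfl | rfl <;>
      simp_all
  exact hpair v₂ hv₂.1 v₃ hv₃.1.1 h02 h03 h23 c₂ hc₂ (e23 ▸ hc₃)

end Geometry

/-! ### The action of the spin group on vectors -/

section SpinAction

open CliffordAlgebra

variable {F : Type*} [Field F] {W : Type*} [AddCommGroup W] [Module F W]
  {q : QuadraticForm F W}

/-- The action of the spin group on the vectors. -/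
def spinAct [CharZero F] (g : spinGroup q) : W →ₗ[F] W :=
  vectorPart q ∘ₗ LinearMap.mulRight F (star (g : CliffordAlgebra q)) ∘ₗ
    LinearMap.mulLeft F (g : CliffordAlgebra q) ∘ₗ ι q

theorem coe_inv_spin (g : spinGroup q) :
    ((g⁻¹ : spinGroup q) : CliffordAlgebra q) = star (g : CliffordAlgebra q) := rfl

theorem spin_mul_star (g : spinGroup q) :
    (g : CliffordAlgebra q) * star (g : CliffordAlgebra q) = 1 :=
  spinGroup.mul_star_self_of_mem g.2

theorem spin_star_mul (g : spinGroup q) :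
    star (g : CliffordAlgebra q) * (g : CliffordAlgebra q) = 1 :=
  spinGroup.star_mul_self_of_mem g.2

/-- A unit vector squares to 1, and `star` negates vectors and reverses products, so `star (v w) = w
v` is inverse to `v w`. -/
theorem ι_mul_ι_mem_spinGroup {v w : W} (hv : q v = 1) (hw : q w = 1) :
    ι q v * ι q w ∈ spinGroup q := by
  have hunit : ∀ a : W, q a = 1 → ι q a ∈
      (lipschitzGroup q).toSubmonoid.map (Units.coeHom (CliffordAlgebra q)) := by
    intro a ha
    have h1 : ι q a * ι q a = 1 := by rw [ι_mul_self_eq_smul, ha, one_smul]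
    exact ⟨⟨ι q a, ι q a, h1, h1⟩, Subgroup.subset_closure ⟨a, rfl⟩, rfl⟩
  refine ⟨⟨Submonoid.mul_mem _ (hunit v hv) (hunit w hw), ?_, ?_⟩, ?_⟩
  · rw [star_mul, star_ι, star_ι, neg_mul_neg, mul_assoc, ← mul_assoc (ι q v), ι_mul_self_eq_smul,
      hv, one_smul, one_mul, ι_mul_self_eq_smul, hw, one_smul]
  · rw [star_mul, star_ι, star_ι, neg_mul_neg, mul_assoc, ← mul_assoc (ι q w), ι_mul_self_eq_smul,
      hw, one_smul, one_mul, ι_mul_self_eq_smul, hv, one_smul]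
  · exact ι_mul_ι_mem_evenOdd_zero q v w

variable (q) in
/-- The products of two vectors of length one in `U`. -/
def unitPairs (U : Submodule F W) : Set (spinGroup q) :=
  {g | ∃ v ∈ U, ∃ w ∈ U, q v = 1 ∧ q w = 1 ∧ (g : CliffordAlgebra q) = ι q v * ι q w}

variable [CharZero F]

/-- Conjugation by the Lipschitz group preserves the space of vectors, so the projection in
`spinAct` discards nothing. -/
theorem ι_spinAct (g : spinGroup q) (v : W) :
    ι q (spinAct g v) = (g : CliffordAlgebra q) * ι q v * star (g : CliffordAlgebra q) := by
  let : Invertible (2 : F) := invertibleOfNonzero two_ne_zero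
  obtain ⟨w, hw⟩ := spinGroup.conjAct_smul_ι_mem_range_ι (x := spinGroup.toUnits g) g.2 v
  have hw' : ι q w = (g : CliffordAlgebra q) * ι q v * star (g : CliffordAlgebra q) := hw
  have : spinAct g v = w := by
    change vectorPart q ((g : CliffordAlgebra q) * ι q v * star (g : CliffordAlgebra q)) = w
    rw [← hw', vectorPart_ι]
  rw [this, hw']

theorem mul_ι_eq (g : spinGroup q) (v : W) :
    (g : CliffordAlgebra q) * ι q v = ι q (spinAct g v) * g := by
  rw [ι_spinAct, mul_assoc, spin_star_mul, mul_one]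

theorem spinAct_eq {g : spinGroup q} {v w : W}
    (h : (g : CliffordAlgebra q) * ι q v = ι q w * g) : spinAct g v = w := by
  apply ι_injective (q := q)
  rw [ι_spinAct, h, mul_assoc, spin_mul_star, mul_one]

theorem q_spinAct (g : spinGroup q) (v : W) : q (spinAct g v) = q v := by
  apply algebraMap_injective' (q := q)
  rw [← ι_sq_scalar, ← ι_sq_scalar, ι_spinAct]
  have h1 := spin_star_mul g
  calc (g : CliffordAlgebra q) * ι q v * star (g : CliffordAlgebra q) *
        ((g : CliffordAlgebra q) * ι q v * star (g : CliffordAlgebra q))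
      = g * ι q v * (star (g : CliffordAlgebra q) * g) * ι q v * star (g : CliffordAlgebra q) := by
        simp only [mul_assoc]
    _ = g * (ι q v * ι q v) * star (g : CliffordAlgebra q) := by
        rw [h1]; simp only [mul_assoc, one_mul]
    _ = ι q v * ι q v := by
        rw [ι_sq_scalar, ← Algebra.commutes, mul_assoc, spin_mul_star, mul_one]

theorem polar_spinAct (g : spinGroup q) (v w : W) :
    QuadraticMap.polar q (spinAct g v) (spinAct g w) = QuadraticMap.polar q v w := by
  simp only [QuadraticMap.polar, ← map_add, q_spinAct]

theorem spinAct_mul (g h : spinGroup q) (v : W) :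
    spinAct (g * h) v = spinAct g (spinAct h v) := by
  apply spinAct_eq
  rw [Submonoid.coe_mul, mul_assoc, mul_ι_eq, ← mul_assoc, mul_ι_eq, mul_assoc]

theorem spinAct_one (v : W) : spinAct (1 : spinGroup q) v = v :=
  spinAct_eq (by rw [Submonoid.coe_one, one_mul, mul_one])

theorem spinAct_inv_apply (g : spinGroup q) (v : W) : spinAct g⁻¹ (spinAct g v) = v := by
  rw [← spinAct_mul, inv_mul_cancel, spinAct_one]

theorem spinAct_injective (g : spinGroup q) : Function.Injective (spinAct g) :=
  Function.LeftInverse.injective (spinAct_inv_apply g)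

/-- Conjugation in the spin group, on expressions in vectors. -/
theorem conj_ι_mul_ι (g : spinGroup q) (v w : W) :
    (g : CliffordAlgebra q) * (ι q v * ι q w) * star (g : CliffordAlgebra q) =
      ι q (spinAct g v) * ι q (spinAct g w) := by
  rw [← mul_assoc, mul_ι_eq, mul_assoc, mul_assoc, ← mul_assoc (g : CliffordAlgebra q),
    ← ι_spinAct]

/-- The action of a product of two vectors of length one. -/
theorem spinAct_unitPair {g : spinGroup q} {v w : W} (hv : q v = 1) (hw : q w = 1)
    (hg : (g : CliffordAlgebra q) = ι q v * ι q w) (x : W) :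
    spinAct g x = x - QuadraticMap.polar q w x • w -
      QuadraticMap.polar q v (x - QuadraticMap.polar q w x • w) • v := by
  -- Each of the two vectors acts by its reflection up to sign, and the two signs cancel.
  apply spinAct_eq
  have refl : ∀ a y : W, q a = 1 →
      ι q a * ι q y = -(ι q (y - QuadraticMap.polar q a y • a) * ι q a) := by
    intro a y ha
    obtain ⟨z, hz, rfl⟩ := exists_ι_mul_eq (a := a) (by rw [ha]; exact one_ne_zero) y
    simpa [ha] using hz
  rw [hg, mul_assoc, refl w x hw, mul_neg, ← mul_assoc, refl v _ hv, neg_mul, neg_neg, mul_assoc]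

theorem spinAct_unitPairs_mem {U : Submodule F W} {g : spinGroup q} (hg : g ∈ unitPairs q U)
    {S : Submodule F W} (hS : U ≤ S) {x : W} (hx : x ∈ S) : spinAct g x ∈ S := by
  obtain ⟨v, hv, w, hw, hqv, hqw, h⟩ := hg
  rw [spinAct_unitPair hqv hqw h]
  exact S.sub_mem (S.sub_mem hx (S.smul_mem _ (hS hw))) (S.smul_mem _ (hS hv))

theorem spinAct_unitPairs_orth {U : Submodule F W} {g : spinGroup q} (hg : g ∈ unitPairs q U)
    {x : W} (hx : ∀ u ∈ U, QuadraticMap.polar q u x = 0) : spinAct g x = x := by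
  obtain ⟨v, hv, w, hw, hqv, hqw, h⟩ := hg
  rw [spinAct_unitPair hqv hqw h, hx w hw]
  simp [hx v hv]

/-- The commutator of a torus element of a hyperbolic plane with an element fixing one of its
isotropic lines is unipotent. -/
theorem commutator_eq {g l : spinGroup q} {u u' y : W} {a c : F} (ha : a ≠ 0) (hc : c ≠ 0)
    (hu : q u = 0) (hu' : q u' = 0) (h1 : QuadraticMap.polar q u u' = 1)
    (hgu : spinAct g u = c • u) (hgu' : spinAct g u' = c⁻¹ • (u' + y))
    (hl : (l : CliffordAlgebra q) = ι q (u + u') * ι q (a • u + a⁻¹ • u')) :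
    QuadraticMap.polar q u y = 0 ∧
    ((l * g * l⁻¹ * g⁻¹ : spinGroup q) : CliffordAlgebra q) =
      1 + (1 - (a⁻¹) ^ 2) • (ι q u * ι q y) := by
  have hp : QuadraticMap.polar q u y = 0 := by
    have := polar_spinAct g u u'
    rw [hgu, hgu', QuadraticMap.polar_smul_left, QuadraticMap.polar_smul_right,
      QuadraticMap.polar_add_right, smul_smul, mul_inv_cancel₀ hc, one_smul, h1] at this
    exact left_eq_add.1 this.symm
  refine ⟨hp, ?_⟩
  -- Up to a scalar `u' + y` is the image of the isotropic vector `u'`.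
  have hq : q (u' + y) = 0 := by
    have := q_spinAct g u'
    rw [hgu', QuadraticMap.map_smul, hu', smul_eq_mul] at this
    exact (mul_eq_zero.1 this).resolve_left (mul_ne_zero (inv_ne_zero hc) (inv_ne_zero hc))
  have uu : ι q u * ι q u = 0 := by rw [ι_mul_self_eq_smul, hu, zero_smul]
  have uu' : ι q u' * ι q u' = 0 := by rw [ι_mul_self_eq_smul, hu', zero_smul]
  have yy : ι q (u' + y) * ι q (u' + y) = 0 := by rw [ι_mul_self_eq_smul, hq, zero_smul]
  have hswap : ι q u' * ι q u = 1 - ι q u * ι q u' := by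
    rw [ι_mul_ι_swap, QuadraticMap.polar_comm, h1, one_smul]
  have hyu : ι q y * ι q u = -(ι q u * ι q y) :=
    ι_mul_ι_of_polar_eq_zero (by rw [QuadraticMap.polar_comm, hp])
  have hlinv : star (l : CliffordAlgebra q) = ι q (a • u + a⁻¹ • u') * ι q (u + u') := by
    rw [hl, star_mul, star_ι, star_ι, neg_mul_neg]
  -- The inverse of `l` is `a u u' + a⁻¹ u' u`. Conjugation by `g` replaces `u'` by `u' + y`, the
  -- factors `c` and `c⁻¹` cancelling; since `u` and `y` anticommute, the change is a multiple of `u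
  -- y`.
  have hconj : (g : CliffordAlgebra q) * star (l : CliffordAlgebra q) *
      star (g : CliffordAlgebra q) =
      star (l : CliffordAlgebra q) + (a - a⁻¹) • (ι q u * ι q y) := by
    rw [hlinv, conj_ι_mul_ι]
    have e1 : spinAct g (a • u + a⁻¹ • u') = (a * c) • u + (a⁻¹ * c⁻¹) • (u' + y) := by
      rw [map_add, map_smul, map_smul, hgu, hgu', smul_smul, smul_smul]
    have e2 : spinAct g (u + u') = c • u + c⁻¹ • (u' + y) := by rw [map_add, hgu, hgu']
    rw [e1, e2]
    have e3 : ι q ((a * c) • u + (a⁻¹ * c⁻¹) • (u' + y)) * ι q (c • u + c⁻¹ • (u' + y)) =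
        a • (ι q u * ι q (u' + y)) + a⁻¹ • (ι q (u' + y) * ι q u) := by
      simp only [LinearMap.map_add (ι q) (_ • u), LinearMap.map_smul,
        add_mul, mul_add (_ • _), smul_mul_assoc, mul_smul_comm, uu, yy,
        smul_zero, zero_add, add_zero, smul_smul]
      congr 2
      · field_simp
      · field_simp
    have e4 : ι q (a • u + a⁻¹ • u') * ι q (u + u') =
        a • (ι q u * ι q u') + a⁻¹ • (ι q u' * ι q u) := by
      simp only [map_add, LinearMap.map_smul, add_mul, mul_add, smul_mul_assoc, uu, uu', smul_zero,
        zero_add, add_zero]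
      abel
    rw [e3, e4, map_add, mul_add, add_mul, hyu, sub_smul]
    simp only [smul_add, smul_neg]
    abel
  have : ((l * g * l⁻¹ * g⁻¹ : spinGroup q) : CliffordAlgebra q) =
      l * (g * star (l : CliffordAlgebra q) * star (g : CliffordAlgebra q)) := by
    simp only [Submonoid.coe_mul, coe_inv_spin, mul_assoc]
  rw [this, hconj, mul_add, spin_mul_star, mul_smul_comm]
  congr 1
  -- Left multiplication by `l` scales `u` by `a⁻¹`, which turns `a - a⁻¹` into `1 - a⁻²`.
  have e5 : (l : CliffordAlgebra q) * ι q u = a⁻¹ • ι q u := by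
    rw [hl]
    have : ι q (a • u + a⁻¹ • u') * ι q u = a⁻¹ • (ι q u' * ι q u) := by
      simp only [map_add, LinearMap.map_smul, add_mul, smul_mul_assoc, uu, smul_zero, zero_add]
    rw [mul_assoc, this, mul_smul_comm, map_add, add_mul, ← mul_assoc, ← mul_assoc, uu', zero_mul,
      add_zero, mul_assoc, hswap, mul_sub, mul_one, ← mul_assoc, uu, zero_mul, sub_zero]
  rw [← mul_assoc, e5, smul_mul_assoc, smul_smul]
  congr 1
  field_simp

end SpinAction

/-! ### Unipotent elements in normal subgroups -/

section Transvections

open CliffordAlgebra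

variable {F : Type*} [Field F] {W : Type*} [AddCommGroup W] [Module F W]
  {q : QuadraticForm F W} {U : Submodule F W}

theorem hyperbolic_of_polar_ne_zero {u x : W} (hqu : q u = 0)
    (hux : QuadraticMap.polar q u x ≠ 0) :
    q ((QuadraticMap.polar q u x)⁻¹ • x + (-(q x * ((QuadraticMap.polar q u x) ^ 2)⁻¹)) • u) = 0 ∧
    QuadraticMap.polar q u
      ((QuadraticMap.polar q u x)⁻¹ • x + (-(q x * ((QuadraticMap.polar q u x) ^ 2)⁻¹)) • u) = 1 := by
  constructor
  · rw [polar_smul_add, hqu, QuadraticMap.polar_comm _ x u]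
    field_simp
    ring
  · rw [QuadraticMap.polar_add_right, QuadraticMap.polar_smul_right, QuadraticMap.polar_smul_right,
      polar_self', hqu, smul_eq_mul, inv_mul_cancel₀ hux]
    simp

/-- For fixed isotropic `u` the elements `1 + u y` multiply like the vectors `y` add, since `u y u
y' = -u u y y' = 0`. This makes the directions of unipotents in a subgroup closed under addition. -/
theorem one_add_mul_one_add {u y y' : W} (hu : q u = 0) (hp : QuadraticMap.polar q u y = 0) :
    (1 + ι q u * ι q y) * (1 + ι q u * ι q y') = 1 + ι q u * ι q (y + y') := by
  have h0 : ι q u * ι q y * (ι q u * ι q y') = 0 := by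
    rw [mul_assoc, ← mul_assoc (ι q y), ι_mul_ι_of_polar_eq_zero (v := y) (w := u)
      (by rw [QuadraticMap.polar_comm, hp]), neg_mul, mul_neg, ← mul_assoc, ← mul_assoc,
      ι_mul_self_eq_smul, hu, zero_smul, zero_mul, zero_mul, neg_zero]
  rw [mul_add, mul_one, add_mul, one_mul, h0, add_zero, map_add, mul_add, add_assoc]

variable [CharZero F]

/-- The unit pairs of `U` act transitively on isotropic lines of `U`. -/
theorem IsNondeg.exists_spinAct_eq_smul [IsAlgClosed F] [FiniteDimensional F W]
    (hU : IsNondeg q U) (hdim : 3 ≤ Module.finrank F U) {G : Subgroup (spinGroup q)}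
    (hG : unitPairs q U ⊆ G) {u u₀ : W} (hu : u ∈ U) (hu0 : u ≠ 0) (hqu : q u = 0)
    (hu₀ : u₀ ∈ U) (hu₀0 : u₀ ≠ 0) (hqu₀ : q u₀ = 0) :
    ∃ l ∈ G, ∃ r : F, r ≠ 0 ∧ spinAct l u = r • u₀ := by
  have main : ∀ u ∈ U, ∀ u₀ ∈ U, q u = 0 → q u₀ = 0 → QuadraticMap.polar q u u₀ ≠ 0 →
      ∃ l ∈ G, ∃ r : F, r ≠ 0 ∧ spinAct l u = r • u₀ := by
    intro u hu u₀ hu₀ hqu hqu₀ hp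
    obtain ⟨e, he, heu, heu₀, hqe⟩ := hU.exists_unit_orth_hyperbolic hdim hu hu₀ hqu hqu₀ hp
    -- With this `r` the vector `u - r • u₀` has length one and its reflection exchanges `u` and `r
    -- • u₀`. The reflection in `e` fixes both and makes the product even.
    set r := -(QuadraticMap.polar q u u₀)⁻¹ with hr
    have hr0 : r ≠ 0 := neg_ne_zero.2 (inv_ne_zero hp)
    have hrp : r * QuadraticMap.polar q u u₀ = -1 := by
      rw [hr, neg_mul, inv_mul_cancel₀ hp]
    have hqv : q (u - r • u₀) = 1 := by
      have := polar_smul_add (q := q) u u₀ 1 (-r)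
      rw [one_smul, neg_smul, ← sub_eq_add_neg] at this
      rw [this, hqu, hqu₀]
      linear_combination -hrp
    refine ⟨⟨_, ι_mul_ι_mem_spinGroup hqe hqv⟩,
      hG ⟨e, he, _, U.sub_mem hu (U.smul_mem _ hu₀), hqe, hqv, rfl⟩, r, hr0, ?_⟩
    rw [spinAct_unitPair hqe hqv rfl]
    have h1 : QuadraticMap.polar q (u - r • u₀) u = 1 := by
      rw [QuadraticMap.polar_sub_left, polar_self', hqu, QuadraticMap.polar_smul_left,
        QuadraticMap.polar_comm, smul_eq_mul, hrp]
      ring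
    rw [h1, one_smul, sub_sub_cancel, QuadraticMap.polar_smul_right,
      QuadraticMap.polar_comm, heu₀, smul_zero, zero_smul, sub_zero]
  by_cases hp : QuadraticMap.polar q u u₀ = 0
  -- Orthogonal isotropic vectors are joined through a third isotropic vector paired with both. It
  -- comes from a vector `x` orthogonal to neither: a partner of `u`, a partner of `u₀`, or their
  -- sum.
  · obtain ⟨x, hx, hux, hu₀x⟩ : ∃ x ∈ U, QuadraticMap.polar q u x ≠ 0 ∧
        QuadraticMap.polar q u₀ x ≠ 0 := by
      obtain ⟨x₁, h₁, -, h1⟩ := hU.exists_hyperbolic hu hu0 hqu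
      obtain ⟨x₂, h₂, -, h2⟩ := hU.exists_hyperbolic hu₀ hu₀0 hqu₀
      by_cases e1 : QuadraticMap.polar q u₀ x₁ = 0
      · by_cases e2 : QuadraticMap.polar q u x₂ = 0
        · exact ⟨x₁ + x₂, U.add_mem h₁ h₂,
            by rw [QuadraticMap.polar_add_right, h1, e2, add_zero]; exact one_ne_zero,
            by rw [QuadraticMap.polar_add_right, h2, e1, zero_add]; exact one_ne_zero⟩
        · exact ⟨x₂, h₂, e2, by rw [h2]; exact one_ne_zero⟩
      · exact ⟨x₁, h₁, by rw [h1]; exact one_ne_zero, e1⟩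
    obtain ⟨hq1, hp1⟩ := hyperbolic_of_polar_ne_zero hqu hux
    set u₁ := (QuadraticMap.polar q u x)⁻¹ • x +
      (-(q x * ((QuadraticMap.polar q u x) ^ 2)⁻¹)) • u with hu₁
    have hu₁U : u₁ ∈ U := U.add_mem (U.smul_mem _ hx) (U.smul_mem _ hu)
    obtain ⟨l, hl, r, hr, h⟩ := main u hu u₁ hu₁U hqu hq1 (by rw [hp1]; exact one_ne_zero)
    obtain ⟨l', hl', r', hr', h'⟩ := main u₁ hu₁U u₀ hu₀ hq1 hqu₀ (by
      rw [QuadraticMap.polar_comm, hu₁, QuadraticMap.polar_add_right,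
        QuadraticMap.polar_smul_right, QuadraticMap.polar_smul_right,
        QuadraticMap.polar_comm _ u₀ u, hp, smul_zero, add_zero]
      exact mul_ne_zero (inv_ne_zero hux) hu₀x)
    exact ⟨l' * l, G.mul_mem hl' hl, r * r', mul_ne_zero hr hr', by
      rw [spinAct_mul, h, map_smul, h', smul_smul]⟩
  · exact main u hu u₀ hu₀ hqu hqu₀ hp

/-- An isometry which multiplies the isotropic vector `u` by `c` and all isotropic vectors paired
with `u` by `c⁻¹` is a scalar. -/
theorem IsNondeg.isScalar_of_forall_hyperbolic [IsAlgClosed F] [FiniteDimensional F W]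
    (hU : IsNondeg q U) (hdim : 3 ≤ Module.finrank F U) (T : W →ₗ[F] W) (hTq : ∀ v, q (T v) = q v)
    {u : W} (hu : u ∈ U) (hu0 : u ≠ 0) (hqu : q u = 0) {c : F} (hc : c ≠ 0) (hTu : T u = c • u)
    (h : ∀ u' ∈ U, q u' = 0 → QuadraticMap.polar q u u' = 1 → T u' = c⁻¹ • u') :
    ∀ v ∈ U, T v = c • v := by
  obtain ⟨u', hu', hqu', hp⟩ := hU.exists_hyperbolic hu hu0 hqu
  obtain ⟨m, hm, hum, hu'm, hqm⟩ := hU.exists_unit_orth_hyperbolic hdim hu hu' hqu hqu'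
    (by rw [hp]; exact one_ne_zero)
  have hcc : c⁻¹ = c := by
    -- A second isotropic vector with the same pairing with `u`. Comparing its image with that of
    -- `u'` determines `T m`, and the length of `T m` forces `c⁻² = 1`.
    have h1 := h (u' + (m - u)) (U.add_mem hu' (U.sub_mem hm hu)) (by
        have := polar_smul_add (q := q) m u 1 (-1)
        rw [one_smul, neg_smul, one_smul, ← sub_eq_add_neg, QuadraticMap.polar_comm, hum] at this
        rw [QuadraticMap.map_add q, QuadraticMap.polar_sub_right, hu'm,
          QuadraticMap.polar_comm _ u' u, hp, this, hqu, hqm, hqu']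
        ring) (by
        rw [QuadraticMap.polar_add_right, QuadraticMap.polar_sub_right, hp, hum, polar_self', hqu]
        ring)
    rw [map_add, h u' hu' hqu' hp, smul_add, add_right_inj, map_sub, hTu] at h1
    have h2 : T m = c⁻¹ • m + (c - c⁻¹) • u := by
      rw [eq_add_of_sub_eq h1, smul_sub, sub_smul]; abel
    have h3 := hTq m
    rw [h2, polar_smul_add, QuadraticMap.polar_comm, hum, hqm, hqu] at h3
    have h4 : c⁻¹ ^ 2 = 1 := by linear_combination h3
    field_simp at h4 ⊢
    exact h4
  -- A vector not orthogonal to `u` is a combination of `u` and an isotropic vector paired with it;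
  -- a vector orthogonal to `u` becomes such after adding `u'`.
  have h1 : ∀ x ∈ U, QuadraticMap.polar q u x ≠ 0 → T x = c • x := by
    intro x hx hux
    obtain ⟨hq1, hp1⟩ := hyperbolic_of_polar_ne_zero hqu hux
    have := h _ (U.add_mem (U.smul_mem _ hx) (U.smul_mem _ hu)) hq1 hp1
    rw [map_add, map_smul, map_smul, hTu, hcc, smul_add, smul_comm c _ u, add_left_inj,
      smul_comm c] at this
    exact smul_right_injective W (inv_ne_zero hux) this
  intro v hv
  by_cases hv0 : QuadraticMap.polar q u v = 0
  · have h2 := h1 (v + u') (U.add_mem hv hu') (by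
      rw [QuadraticMap.polar_add_right, hv0, hp, zero_add]; exact one_ne_zero)
    rwa [map_add, h1 u' hu' (by rw [hp]; exact one_ne_zero), smul_add, add_left_inj] at h2
  · exact h1 v hv hv0

/-- A normal subgroup which does not act by scalars on `U` contains unipotent elements attached to
some isotropic vector of `U`. -/
theorem IsNondeg.exists_unipotent [IsAlgClosed F] [FiniteDimensional F W]
    (hU : IsNondeg q U) (hdim : 3 ≤ Module.finrank F U) {G N : Subgroup (spinGroup q)}
    (hG : unitPairs q U ⊆ G) (hN : ∀ l ∈ G, ∀ n ∈ N, l * n * l⁻¹ ∈ N) {g : spinGroup q}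
    (hg : g ∈ N) (hgU : ∀ v ∈ U, spinAct g v ∈ U) (hgs : ¬ ∃ c : F, ∀ v ∈ U, spinAct g v = c • v) :
    ∃ u ∈ U, u ≠ 0 ∧ q u = 0 ∧ ∃ y ∈ U, QuadraticMap.polar q u y = 0 ∧ (∀ r : F, y ≠ r • u) ∧
      ∀ t : F, ∃ n ∈ N, (n : CliffordAlgebra q) = 1 + ι q u * ι q (t • y) := by
  obtain ⟨u, hu, hu0, hqu, c, hc⟩ :=
    exists_isotropic_eigenvector hdim (spinAct g) (q_spinAct g) hgU
  have hc0 : c ≠ 0 := by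
    rintro rfl
    rw [zero_smul] at hc
    exact hu0 (spinAct_injective g (by rw [hc, map_zero]))
  obtain ⟨u', hu', hqu', hp, hne⟩ : ∃ u' ∈ U, q u' = 0 ∧ QuadraticMap.polar q u u' = 1 ∧
      spinAct g u' ≠ c⁻¹ • u' := by
    by_contra! h
    exact hgs ⟨c, hU.isScalar_of_forall_hyperbolic hdim _ (q_spinAct g) hu hu0 hqu hc0 hc h⟩
  -- The vector `y` measures how far `g` is from acting on the plane of `u` and `u'` through the
  -- torus.
  set y := c • spinAct g u' - u' with hy
  have hgu' : spinAct g u' = c⁻¹ • (u' + y) := by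
    rw [hy, add_sub_cancel, smul_smul, inv_mul_cancel₀ hc0, one_smul]
  have hcomm : ∀ a : F, a ≠ 0 → ∃ l ∈ G,
      QuadraticMap.polar q u y = 0 ∧ ((l * g * l⁻¹ * g⁻¹ : spinGroup q) : CliffordAlgebra q) =
      1 + (1 - (a⁻¹) ^ 2) • (ι q u * ι q y) := by
    intro a ha
    have h1 : q (u + u') = 1 := by rw [QuadraticMap.map_add q, hqu, hqu', hp]; ring
    have h2 : q (a • u + a⁻¹ • u') = 1 := by
      rw [polar_smul_add, hqu, hqu', hp, mul_inv_cancel₀ ha]; ring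
    exact ⟨⟨_, ι_mul_ι_mem_spinGroup h1 h2⟩, hG ⟨_, U.add_mem hu hu', _,
      U.add_mem (U.smul_mem _ hu) (U.smul_mem _ hu'), h1, h2, rfl⟩,
      commutator_eq ha hc0 hqu hqu' hp hc hgu' rfl⟩
  have hpy : QuadraticMap.polar q u y = 0 := by
    obtain ⟨l, -, h, -⟩ := hcomm 1 one_ne_zero
    exact h
  refine ⟨u, hu, hu0, hqu, y, U.sub_mem (U.smul_mem _ (hgU u' hu')) hu', hpy, ?_, ?_⟩
  -- Were `y` equal to `r • u`, the isotropy of `u' + y` would give `r = 0`, contrary to the choice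
  -- of `u'`.
  · intro r hr
    have h1 := q_spinAct g u'
    rw [hgu', QuadraticMap.map_smul, hqu', hr] at h1
    have h2 := (mul_eq_zero.1 h1).resolve_left (mul_ne_zero (inv_ne_zero hc0) (inv_ne_zero hc0))
    have h3 := polar_smul_add (q := q) u' u 1 r
    rw [one_smul, h2, hqu', hqu, QuadraticMap.polar_comm, hp] at h3
    have h4 : r = 0 := by linear_combination -h3
    apply hne
    rw [hgu', hr, h4, zero_smul, add_zero]
  -- The commutators realise the parameters `1 - z²` with `z` non-zero, that is, all values but 1;
  -- the value 1 is reached as 1/2 + 1/2.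
  · have h1 : ∀ t : F, t ≠ 1 → ∃ n ∈ N, (n : CliffordAlgebra q) = 1 + ι q u * ι q (t • y) := by
      intro t ht
      obtain ⟨z, hz⟩ := IsAlgClosed.exists_pow_nat_eq (1 - t) (n := 2) two_pos
      have hz0 : z ≠ 0 := by
        rintro rfl
        apply ht
        linear_combination hz
      obtain ⟨l, hl, -, h⟩ := hcomm z⁻¹ (inv_ne_zero hz0)
      refine ⟨_, N.mul_mem (hN l hl g hg) (N.inv_mem hg), ?_⟩
      rw [h, inv_inv, hz, sub_sub_cancel, map_smul, mul_smul_comm]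
    intro t
    by_cases ht : t = 1
    · obtain ⟨n, hn, h⟩ := h1 (1 / 2) (by norm_num)
      refine ⟨n * n, N.mul_mem hn hn, ?_⟩
      rw [Submonoid.coe_mul, h, one_add_mul_one_add hqu, ← add_smul, ht]
      · norm_num
      · rw [QuadraticMap.polar_smul_right, hpy, smul_zero]
    · exact h1 t ht

/-- A normal subgroup which does not act by scalars on `U` contains unipotent elements attached to
a given isotropic vector of `U`. -/
theorem IsNondeg.exists_unipotent_of_isotropic [IsAlgClosed F] [FiniteDimensional F W]
    (hU : IsNondeg q U) (hdim : 3 ≤ Module.finrank F U) {G N : Subgroup (spinGroup q)}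
    (hG : unitPairs q U ⊆ G) (hGU : ∀ l ∈ G, ∀ v ∈ U, spinAct l v ∈ U)
    (hN : ∀ l ∈ G, ∀ n ∈ N, l * n * l⁻¹ ∈ N) {g : spinGroup q}
    (hg : g ∈ N) (hgU : ∀ v ∈ U, spinAct g v ∈ U) (hgs : ¬ ∃ c : F, ∀ v ∈ U, spinAct g v = c • v)
    {u₀ : W} (hu₀ : u₀ ∈ U) (hu₀0 : u₀ ≠ 0) (hqu₀ : q u₀ = 0) :
    ∃ y ∈ U, QuadraticMap.polar q u₀ y = 0 ∧ (∀ r : F, y ≠ r • u₀) ∧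
      ∀ t : F, ∃ n ∈ N, (n : CliffordAlgebra q) = 1 + ι q u₀ * ι q (t • y) := by
  obtain ⟨u, hu, hu0, hqu, y, hy, hp, hne, h⟩ := hU.exists_unipotent hdim hG hN hg hgU hgs
  obtain ⟨l, hl, r, hr, hlu⟩ := hU.exists_spinAct_eq_smul hdim hG hu hu0 hqu hu₀ hu₀0 hqu₀
  have hu₀' : u₀ = r⁻¹ • spinAct l u := by rw [hlu, smul_smul, inv_mul_cancel₀ hr, one_smul]
  refine ⟨spinAct l y, hGU l hl y hy, ?_, ?_, ?_⟩
  · rw [hu₀', QuadraticMap.polar_smul_left, polar_spinAct, hp, smul_zero]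
  · intro s hs
    refine hne (s * r⁻¹) (spinAct_injective l ?_)
    rw [hs, map_smul, hlu, smul_smul, mul_assoc, inv_mul_cancel₀ hr, mul_one]
  · intro t
    -- Conjugation by `l` replaces `u` by `r • u₀`; the parameter is rescaled to absorb `r`.
    obtain ⟨n, hn, hn'⟩ := h (r⁻¹ * t)
    refine ⟨_, hN l hl n hn, ?_⟩
    rw [Submonoid.coe_mul, Submonoid.coe_mul, hn', coe_inv_spin, mul_add, mul_one, add_mul,
      spin_mul_star, conj_ι_mul_ι, hlu]
    simp only [map_smul, smul_mul_assoc, mul_smul_comm, smul_smul]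
    rw [mul_right_comm, inv_mul_cancel₀ hr, one_mul]

end Transvections

/-! ### Zariski topology: points are closed, rational curves are connected -/

section ZariskiLemmas

variable {Ω : Type*} [Field Ω] {X : Type*} [AddCommGroup X] [Module Ω X]

theorem t1Space_zariski : @T1Space X (zariskiTopology Ω X) := by
  let := zariskiTopology Ω X
  refine ⟨fun x => ⟨isOpen_iff_forall_mem_open.2 fun y hy => ?_⟩⟩
  obtain ⟨φ, hφ⟩ : ∃ φ : Module.Dual Ω X, φ (y - x) ≠ 0 := by
    by_contra! h
    exact hy (sub_eq_zero.1 ((Module.forall_dual_apply_eq_zero_iff Ω (y - x)).1 h))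
  refine ⟨_, ?_, TopologicalSpace.isOpen_generateFrom_of_mem
    ⟨MvPolynomial.X φ - MvPolynomial.C (φ x), rfl⟩, ?_⟩
  · intro z hz hzx
    rw [Set.mem_singleton_iff] at hzx
    subst hzx
    simp at hz
  · simpa [sub_eq_zero] using hφ

/-- A polynomial function along a rational curve. -/
theorem exists_polynomial_eval_curve (d : Polynomial Ω) (γ : Ω → X) (x₀ x₁ x₂ : X)
    (hγ : ∀ t, d.eval t ≠ 0 → d.eval t • γ t = x₀ + t • x₁ + t ^ 2 • x₂)
    (f : MvPolynomial (Module.Dual Ω X) Ω) :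
    ∃ (m : ℕ) (P : Polynomial Ω), ∀ t, d.eval t ≠ 0 →
      d.eval t ^ m * MvPolynomial.eval (fun φ => φ (γ t)) f = P.eval t := by
  induction f using MvPolynomial.induction_on with
  | C a => exact ⟨0, Polynomial.C a, by simp⟩
  | add f g hf hg =>
    obtain ⟨m, P, hP⟩ := hf
    obtain ⟨m', P', hP'⟩ := hg
    refine ⟨m + m', P * d ^ m' + P' * d ^ m, fun t ht => ?_⟩
    rw [Polynomial.eval_add, Polynomial.eval_mul, Polynomial.eval_mul, Polynomial.eval_pow,
      Polynomial.eval_pow, ← hP t ht, ← hP' t ht, map_add]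
    ring
  | mul_X f φ hf =>
    obtain ⟨m, P, hP⟩ := hf
    refine ⟨m + 1, P * (Polynomial.C (φ x₀) + Polynomial.X * Polynomial.C (φ x₁) +
      Polynomial.X ^ 2 * Polynomial.C (φ x₂)), fun t ht => ?_⟩
    have h := congrArg φ (hγ t ht)
    simp only [map_add, map_smul, smul_eq_mul] at h
    simp only [map_mul, MvPolynomial.eval_X, Polynomial.eval_mul, Polynomial.eval_add,
      Polynomial.eval_C, Polynomial.eval_pow, Polynomial.eval_X, ← h, ← hP t ht]
    ring

/-- Rational curves are connected in the Zariski topology. -/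
theorem isPreconnected_curve [Infinite Ω] (d : Polynomial Ω) (hd : d ≠ 0) (γ : Ω → X)
    (x₀ x₁ x₂ : X) (hγ : ∀ t, d.eval t ≠ 0 → d.eval t • γ t = x₀ + t • x₁ + t ^ 2 • x₂) :
    @IsPreconnected X (zariskiTopology Ω X) (γ '' {t | d.eval t ≠ 0}) := by
  classical
  let := zariskiTopology Ω X
  have hfin : ∀ P : Polynomial Ω, P ≠ 0 → {t | P.eval t = 0}.Finite := fun P hP =>
    (P.roots.toFinset.finite_toSet).subset fun t ht => by
      simpa [hP, Polynomial.IsRoot] using ht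
  have : Infinite {t | d.eval t ≠ 0} := ((hfin d hd).infinite_compl).to_subtype
  -- An infinite set with the cofinite topology is connected. The curve is continuous for it because
  -- a polynomial function along the curve, once denominators are cleared, vanishes identically or
  -- at finitely many parameters.
  let e : CofiniteTopology {t | d.eval t ≠ 0} ≃ {t | d.eval t ≠ 0} := CofiniteTopology.of.symm
  have hcont : Continuous (fun s : CofiniteTopology {t | d.eval t ≠ 0} => γ (e s)) := by
    refine continuous_generateFrom_iff.2 ?_
    rintro V ⟨f, rfl⟩
    obtain ⟨m, P, hP⟩ := exists_polynomial_eval_curve d γ x₀ x₁ x₂ hγ f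
    rw [CofiniteTopology.isOpen_iff']
    by_cases hP0 : P = 0
    · left
      refine Set.eq_empty_iff_forall_notMem.2 fun s hs => ?_
      have h := hP _ (e s).2
      rw [hP0, Polynomial.eval_zero] at h
      exact hs ((mul_eq_zero.1 h).resolve_left (pow_ne_zero _ (e s).2))
    · right
      refine ((hfin P hP0).preimage (f := fun s : CofiniteTopology {t | d.eval t ≠ 0} =>
        (e s : Ω)) ?_).subset fun s hs => ?_
      · exact (Subtype.val_injective.comp e.injective).injOn
      · have h := hP _ (e s).2
        have hs' : MvPolynomial.eval (fun φ => φ (γ (e s))) f = 0 := by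
          simpa using hs
        rw [hs', mul_zero] at h
        exact h.symm
  have h := isPreconnected_range hcont
  convert! h using 1
  ext x
  constructor
  · rintro ⟨t, ht, rfl⟩
    exact ⟨e.symm ⟨t, ht⟩, by simp⟩
  · rintro ⟨s, rfl⟩
    exact ⟨_, (e s).2, rfl⟩

end ZariskiLemmas

/-! ### Identity components -/

section Component

open CliffordAlgebra

variable {V : Type*} [AddCommGroup V] [Module ℚ V] {Q : QuadraticForm ℚ V}
  {Ω : Type*} [Field Ω] [Algebra ℚ Ω]

theorem mem_identityComponent {G : Subgroup (Spin Q Ω)} {g : Spin Q Ω} :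
    g ∈ identityComponent Q Ω G ↔
      (g : Clifford Q Ω) ∈ @connectedComponentIn _ (zariskiTopology Ω _) (points Q Ω G) 1 :=
  Iff.rfl

theorem coe_mem_points {N : Subgroup (Spin Q Ω)} {g : Spin Q Ω} :
    (g : Clifford Q Ω) ∈ points Q Ω N ↔ g ∈ N :=
  ⟨fun ⟨_, h, e⟩ => Subtype.ext e ▸ h, fun h => ⟨g, h, rfl⟩⟩

theorem identityComponent_le (G : Subgroup (Spin Q Ω)) : identityComponent Q Ω G ≤ G :=
  fun _ hg => coe_mem_points.1
    (@connectedComponentIn_subset _ (zariskiTopology Ω _) _ _ _ (mem_identityComponent.1 hg))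

theorem isZariskiConnected_identityComponent (G : Subgroup (Spin Q Ω)) :
    IsZariskiConnected Q Ω (identityComponent Q Ω G) := by
  let := zariskiTopology Ω (Clifford Q Ω)
  have h1 : (1 : Clifford Q Ω) ∈ points Q Ω G := ⟨1, G.one_mem, rfl⟩
  have : points Q Ω (identityComponent Q Ω G) = connectedComponentIn (points Q Ω G) 1 := by
    ext x
    constructor
    · rintro ⟨g, hg, rfl⟩
      exact hg
    · intro hx
      obtain ⟨g, hg, rfl⟩ := connectedComponentIn_subset _ _ hx
      exact ⟨g, hx, rfl⟩
  unfold IsZariskiConnected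
  rw [this]
  exact isConnected_connectedComponentIn_iff.2 h1

/-- A connected set with two points in a T1 space is infinite. -/
theorem eq_bot_of_finite {N : Subgroup (Spin Q Ω)} (hN : IsZariskiConnected Q Ω N)
    (hfin : (points Q Ω N).Finite) : N = ⊥ := by
  let := zariskiTopology Ω (Clifford Q Ω)
  have := t1Space_zariski (Ω := Ω) (X := Clifford Q Ω)
  rw [eq_bot_iff]
  intro g hg
  by_contra hne
  refine (hN.isPreconnected.infinite_of_nontrivial ⟨g, ⟨g, hg, rfl⟩, 1, ⟨1, N.one_mem, rfl⟩,
    fun h => hne ?_⟩) hfin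
  exact Subgroup.mem_bot.2 (Subtype.ext h)

variable [IsAlgClosed Ω] [FiniteDimensional ℚ V]

/-- The products of two unit vectors of `U` lie in the identity component. -/
theorem unitPairs_subset_identityComponent {U : Submodule Ω (Ω ⊗[ℚ] V)}
    (hU : IsNondeg (Q.baseChange Ω) U) (hdim : 2 ≤ Module.finrank Ω U) {G : Subgroup (Spin Q Ω)}
    (hG : unitPairs (Q.baseChange Ω) U ⊆ G) :
    unitPairs (Q.baseChange Ω) U ⊆ identityComponent Q Ω G := by
  let := zariskiTopology Ω (Clifford Q Ω)
  have : CharZero Ω := algebraRat.charZero Ω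
  set q := Q.baseChange Ω
  have main : ∀ v ∈ U, ∀ w ∈ U, q v = 1 → q w = 1 → q (w + v) ≠ 0 → ∀ g : Spin Q Ω,
      (g : Clifford Q Ω) = ι q w * ι q v → g ∈ identityComponent Q Ω G := by
    intro v hv w hw hqv hqw hne g hg
    set b := QuadraticMap.polar q w v with hb
    set d : Polynomial Ω := 1 + Polynomial.X * Polynomial.C b + Polynomial.X ^ 2 with hd
    have hdt : ∀ t, d.eval t = 1 + t * b + t ^ 2 := fun t => by simp [hd]; ring
    have hdq : ∀ t, q (v + t • w) = d.eval t := fun t => by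
      have := polar_smul_add (q := q) v w 1 t
      rw [one_smul] at this
      rw [this, hqv, hqw, hdt, QuadraticMap.polar_comm, ← hb]
      ring
    have hwv : ι q w * ι q v * (ι q w * ι q v) = b • (ι q w * ι q v) - 1 := by
      rw [mul_assoc, ← mul_assoc (ι q v), ι_mul_ι_swap v w, QuadraticMap.polar_comm, ← hb,
        sub_mul, mul_assoc (ι q w), ι_mul_self_eq_smul, hqv, one_smul, mul_one, mul_sub,
        ι_mul_self_eq_smul, hqw, one_smul, smul_mul_assoc, one_mul, mul_smul_comm]
    -- This is the square of the product of the normalised vector `v + t • w` with `v`. Squaring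
    -- removes the square root needed for the normalisation, so the curve is rational. It equals 1
    -- at `t = 0`, and `w v` at `t = 1` by `hwv`.
    set γ : Ω → Clifford Q Ω := fun t =>
      (d.eval t)⁻¹ • ((1 + t • (ι q w * ι q v)) * (1 + t • (ι q w * ι q v))) with hγ
    have hpre : IsPreconnected (γ '' {t | d.eval t ≠ 0}) := by
      refine isPreconnected_curve d ?_ γ 1 ((2 : Ω) • (ι q w * ι q v))
        (ι q w * ι q v * (ι q w * ι q v)) fun t ht => ?_
      · intro h
        have := hdt 0
        rw [h] at this
        simp at this
      · simp only [hγ]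
        rw [smul_smul, mul_inv_cancel₀ ht, one_smul]
        simp only [mul_add, add_mul, mul_one, one_mul, smul_mul_assoc, mul_smul_comm, two_smul,
          smul_add, pow_two, smul_smul]
        abel
    have hsub : γ '' {t | d.eval t ≠ 0} ⊆ points Q Ω G := by
      rintro _ ⟨t, ht, rfl⟩
      obtain ⟨c, hc0, hc⟩ := exists_smul_eq_one (q := q) (v := v + t • w) (by rwa [hdq])
      have hp : (⟨_, ι_mul_ι_mem_spinGroup hc hqv⟩ : Spin Q Ω) ∈ G :=
        hG ⟨_, U.smul_mem _ (U.add_mem hv (U.smul_mem _ hw)), v, hv, hc, hqv, rfl⟩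
      refine ⟨_, G.mul_mem hp hp, ?_⟩
      have hcd : c * c = (d.eval t)⁻¹ := by
        rw [QuadraticMap.map_smul, hdq, smul_eq_mul] at hc
        exact eq_inv_of_mul_eq_one_left hc
      have hxv : ι q (c • (v + t • w)) * ι q v = c • (1 + t • (ι q w * ι q v)) := by
        simp only [map_smul, map_add, smul_mul_assoc, add_mul, ι_mul_self_eq_smul, hqv, one_smul]
      change ι q (c • (v + t • w)) * ι q v * (ι q (c • (v + t • w)) * ι q v) = γ t
      rw [hxv, smul_mul_assoc, mul_smul_comm, smul_smul, hcd]
    rw [mem_identityComponent, hg]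
    refine hpre.subset_connectedComponentIn ⟨0, ?_, ?_⟩ hsub ⟨1, ?_, ?_⟩
    · simp [hdt]
    · simp [hγ, hdt]
    · have := hdq 1
      rw [one_smul, add_comm] at this
      change d.eval 1 ≠ 0
      rwa [← this]
    · have h2 : d.eval 1 ≠ 0 := by
        have := hdq 1
        rw [one_smul, add_comm] at this
        rwa [← this]
      rw [hγ]
      simp only [one_smul, mul_add, add_mul, mul_one, one_mul, hwv]
      rw [inv_smul_eq_iff₀ h2, hdt, one_mul, one_pow, add_smul, add_smul, one_smul]
      abel
  rintro g ⟨v, hv, w, hw, hqv, hqw, hg⟩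
  -- When the curve has a pole at 1, replace `v` by `-v`. The sign is recovered from `(m v)² = -1`
  -- for a unit vector `m` orthogonal to `v`.
  by_cases hvw : q (v + w) = 0
  · have hvw' : q (-v + w) ≠ 0 := by
      intro h
      have := q_sub_add_q_add (q := q) v w
      rw [hvw, hqv, hqw, ← QuadraticMap.map_neg, neg_sub, sub_eq_neg_add, h] at this
      norm_num at this
    have hqv' : q (-v) = 1 := by rw [QuadraticMap.map_neg, hqv]
    obtain ⟨m, hm, hvm, hqm⟩ := hU.exists_unit_orth hdim hv (by rw [hqv]; exact one_ne_zero)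
    have h1 := main w hw (-v) (U.neg_mem hv) hqw hqv' hvw'
      ⟨_, ι_mul_ι_mem_spinGroup hqv' hqw⟩ rfl
    have h2 := main v hv m hm hqv hqm (by
      rw [add_comm, QuadraticMap.map_add q, hqv, hqm, hvm]; norm_num)
      ⟨_, ι_mul_ι_mem_spinGroup hqm hqv⟩ rfl
    have h3 : g = (⟨_, ι_mul_ι_mem_spinGroup hqm hqv⟩ * ⟨_, ι_mul_ι_mem_spinGroup hqm hqv⟩ *
        ⟨_, ι_mul_ι_mem_spinGroup hqv' hqw⟩ : Spin Q Ω) := by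
      apply Subtype.ext
      change _ = ι q m * ι q v * (ι q m * ι q v) * (ι q (-v) * ι q w)
      rw [hg, mul_assoc (ι q m), ← mul_assoc (ι q v), ι_mul_ι_of_polar_eq_zero hvm, neg_mul,
        mul_neg, mul_assoc (ι q m), ι_mul_self_eq_smul (q := q) v, hqv, one_smul, mul_one,
        ι_mul_self_eq_smul, hqm, one_smul, map_neg, neg_mul, neg_mul, one_mul, neg_neg]
    rw [h3]
    exact Subgroup.mul_mem _ (Subgroup.mul_mem _ h2 h2) h1
  · exact main w hw v hv hqw hqv hvw g hg

end Component

/-! ### Orthogonal decompositions and the kernel of the spin action -/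

section Decomposition

open CliffordAlgebra

variable {F : Type*} [Field F] {W : Type*} [AddCommGroup W] [Module F W]

/-- The non-degenerate quadratic space is the orthogonal sum of `U` and `U'`. -/
structure IsOrthDecomp (q : QuadraticForm F W) (U U' : Submodule F W) : Prop where
  sup_eq : U ⊔ U' = ⊤
  polar_eq : ∀ u ∈ U, ∀ u' ∈ U', QuadraticMap.polar q u u' = 0
  nondeg : ∀ v, (∀ w, QuadraticMap.polar q v w = 0) → v = 0

variable {q : QuadraticForm F W} {U U' : Submodule F W}

theorem IsOrthDecomp.symm (h : IsOrthDecomp q U U') : IsOrthDecomp q U' U :=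
  ⟨by rw [sup_comm]; exact h.sup_eq,
    fun u hu u' hu' => by rw [QuadraticMap.polar_comm]; exact h.polar_eq u' hu' u hu, h.nondeg⟩

theorem IsOrthDecomp.exists_add (h : IsOrthDecomp q U U') (w : W) :
    ∃ u ∈ U, ∃ u' ∈ U', u + u' = w :=
  Submodule.mem_sup.1 (by rw [h.sup_eq]; trivial)

theorem IsOrthDecomp.isNondeg (h : IsOrthDecomp q U U') : IsNondeg q U := by
  refine fun u hu hu0 => h.nondeg u fun w => ?_
  obtain ⟨v, hv, v', hv', rfl⟩ := h.exists_add w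
  rw [QuadraticMap.polar_add_right, hu0 v hv, h.polar_eq u hu v' hv', add_zero]

theorem IsOrthDecomp.mem_of_orth (h : IsOrthDecomp q U U') {z : W}
    (hz : ∀ u ∈ U', QuadraticMap.polar q u z = 0) : z ∈ U := by
  obtain ⟨v, hv, v', hv', rfl⟩ := h.exists_add z
  have : v' = 0 := h.symm.isNondeg v' hv' fun u hu => by
    have := hz u hu
    rwa [QuadraticMap.polar_add_right, h.symm.polar_eq u hu v hv, zero_add,
      QuadraticMap.polar_comm] at this
  rw [this, add_zero]
  exact hv

variable [CharZero F]

/-- `U'` consists of the vectors orthogonal to `U`, and pairing with `g v` is pairing of `g⁻¹` of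
the other vector with `v`. -/
theorem IsOrthDecomp.spinAct_mem (h : IsOrthDecomp q U U') {G : Subgroup (spinGroup q)}
    (hG : ∀ g ∈ G, ∀ v ∈ U, spinAct g v ∈ U) : ∀ g ∈ G, ∀ v ∈ U', spinAct g v ∈ U' := by
  intro g hg v hv
  refine h.symm.mem_of_orth fun u hu => ?_
  rw [← polar_spinAct g⁻¹, spinAct_inv_apply]
  exact h.polar_eq _ (hG _ (G.inv_mem hg) u hu) v hv

/-- The quotient of the two elements is even and commutes with all vectors, so it is a scalar;
unitarity makes its square 1. -/
theorem eq_or_eq_neg_of_spinAct_eq [FiniteDimensional F W]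
    (hq : ∀ v : W, (∀ w, QuadraticMap.polar q v w = 0) → v = 0) {g h : spinGroup q}
    (hgh : ∀ v, spinAct g v = spinAct h v) :
    (g : CliffordAlgebra q) = h ∨ (g : CliffordAlgebra q) = -h := by
  have := clifford_nontrivial (q := q)
  obtain ⟨c, hc⟩ := eq_algebraMap_of_twisted_commute hq
    ((h⁻¹ * g : spinGroup q) : CliffordAlgebra q) (fun v => by
      rw [spinGroup.involute_eq (h⁻¹ * g).2, mul_ι_eq, spinAct_mul, hgh, spinAct_inv_apply])
  have h1 := spin_star_mul (h⁻¹ * g)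
  rw [hc, star_algebraMap, ← map_mul, ← map_one (algebraMap F _)] at h1
  have h2 : (g : CliffordAlgebra q) = h * algebraMap F _ c := by
    rw [← hc, ← Submonoid.coe_mul, mul_inv_cancel_left]
  rw [h2]
  rcases mul_self_eq_one_iff.1 (algebraMap_injective' h1) with rfl | rfl
  · left; rw [map_one, mul_one]
  · right; rw [map_neg, map_one, mul_neg, mul_one]

end Decomposition

/-! ### The stabilizer of a subspace in the spin group -/

section StabilizerGroup

open CliffordAlgebra

variable {V : Type*} [AddCommGroup V] [Module ℚ V] {Q : QuadraticForm ℚ V}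
  {Ω : Type*} [Field Ω] [Algebra ℚ Ω]

theorem inv_mem_unitPairs {U : Submodule Ω (Ω ⊗[ℚ] V)} {g : Spin Q Ω}
    (hg : g ∈ unitPairs (Q.baseChange Ω) U) : g⁻¹ ∈ unitPairs (Q.baseChange Ω) U := by
  obtain ⟨v, hv, w, hw, hqv, hqw, h⟩ := hg
  refine ⟨w, hw, v, hv, hqw, hqv, ?_⟩
  rw [coe_inv_spin, h, star_mul, star_ι, star_ι, neg_mul_neg]

variable [CharZero Ω]

/-- A connected group acting by scalars on both summands is trivial. -/
theorem eq_bot_of_isScalar [FiniteDimensional ℚ V] {U U' : Submodule Ω (Ω ⊗[ℚ] V)}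
    (hUU' : IsOrthDecomp (Q.baseChange Ω) U U') (hU : U ≠ ⊥) (hU' : U' ≠ ⊥)
    {N : Subgroup (Spin Q Ω)} (hN : IsZariskiConnected Q Ω N)
    (h : ∀ g ∈ N, ∃ c : Ω, ∀ v ∈ U, spinAct g v = c • v)
    (h' : ∀ g ∈ N, ∃ c : Ω, ∀ v ∈ U', spinAct g v = c • v) : N = ⊥ := by
  set q := Q.baseChange Ω with hq
  refine eq_bot_of_finite hN ?_
  -- An isometry that is scalar on a space with an anisotropic vector has scalar 1 or -1.
  have sq : ∀ (S : Submodule Ω (Ω ⊗[ℚ] V)), IsNondeg q S → S ≠ ⊥ → ∀ (g : Spin Q Ω) (c : Ω),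
      (∀ v ∈ S, spinAct g v = c • v) → c ∈ ({1, -1} : Set Ω) := by
    intro S hS hS0 g c hc
    obtain ⟨v, hv, hqv⟩ := hS.exists_ne_zero hS0
    have h1 := q_spinAct g v
    rw [hc v hv, QuadraticMap.map_smul, smul_eq_mul] at h1
    exact mul_self_eq_one_iff.1 (mul_right_cancel₀ hqv (h1.trans (one_mul _).symm))
  -- An element is determined up to sign by its pair of scalars, and there are four pairs of signs,
  -- so the group is finite.
  let A : Ω × Ω → Set (Clifford Q Ω) := fun s => {x | ∃ g : Spin Q Ω, (g : Clifford Q Ω) = x ∧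
    (∀ v ∈ U, spinAct g v = s.1 • v) ∧ ∀ v ∈ U', spinAct g v = s.2 • v}
  have hA : ∀ s, (A s).Finite := by
    intro s
    rcases (A s).eq_empty_or_nonempty with h0 | ⟨x, g, hg, h1, h2⟩
    · rw [h0]; exact Set.finite_empty
    · refine (Set.toFinite ({x, -x} : Set (Clifford Q Ω))).subset ?_
      rintro y ⟨g', hg', h1', h2'⟩
      have := eq_or_eq_neg_of_spinAct_eq hUU'.nondeg (g := g') (h := g) (fun v => by
        obtain ⟨u, hu, u', hu', rfl⟩ := hUU'.exists_add v
        rw [map_add, map_add, h1 u hu, h2 u' hu', h1' u hu, h2' u' hu'])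
      rwa [hg, hg'] at this
  refine (((Set.toFinite ({1, -1} : Set Ω)).prod (Set.toFinite ({1, -1} : Set Ω))).biUnion
    (t := A) fun s _ => hA s).subset ?_
  rintro _ ⟨g, hg, rfl⟩
  obtain ⟨c, hc⟩ := h g hg
  obtain ⟨c', hc'⟩ := h' g hg
  exact Set.mem_biUnion (x := (c, c')) ⟨sq U hUU'.isNondeg hU g c hc,
    sq U' hUU'.symm.isNondeg hU' g c' hc'⟩ ⟨g, rfl, hc, hc'⟩

/-- The stabilizer is defined by an equality of subspaces inside the Clifford algebra. The two
inclusions amount to stability under `g` and under its inverse. -/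
theorem mem_spinStabilizer_iff {L : Submodule ℚ V} {g : Spin Q Ω} :
    g ∈ spinStabilizer Q Ω L ↔ (∀ v ∈ L.baseChange Ω, spinAct g v ∈ L.baseChange Ω) ∧
      ∀ v ∈ L.baseChange Ω, spinAct g⁻¹ v ∈ L.baseChange Ω := by
  set S := (L.baseChange Ω).map (ι (Q.baseChange Ω)) with hS
  have key : ∀ g : Spin Q Ω, (∀ v ∈ L.baseChange Ω, spinAct g v ∈ L.baseChange Ω) ↔
      ConjAct.toConjAct (spinGroup.toUnits g) • S ≤ S := by
    intro g
    constructor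
    · intro h
      rw [Submodule.pointwise_smul_def, Submodule.map_le_iff_le_comap]
      rintro _ ⟨v, hv, rfl⟩
      exact ⟨spinAct g v, h v hv, ι_spinAct g v⟩
    · intro h v hv
      have h1 : ConjAct.toConjAct (spinGroup.toUnits g) • ι (Q.baseChange Ω) v ∈
          ConjAct.toConjAct (spinGroup.toUnits g) • S :=
        Submodule.smul_mem_pointwise_smul _ _ _ ⟨v, hv, rfl⟩
      obtain ⟨w, hw, hw'⟩ := h h1
      have h2 : ι (Q.baseChange Ω) w = ι (Q.baseChange Ω) (spinAct g v) :=
        hw'.trans (ι_spinAct g v).symm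
      rw [← ι_injective h2]
      exact hw
  rw [key, key]
  change ConjAct.toConjAct (spinGroup.toUnits g) • S = S ↔ _
  rw [map_inv, map_inv]
  constructor
  · intro h
    exact ⟨h.le, by rw [inv_smul_eq_iff.2 h.symm]⟩
  · rintro ⟨h1, h2⟩
    refine le_antisymm h1 ?_
    have := smul_mono_right (ConjAct.toConjAct (spinGroup.toUnits g)) h2
    rwa [smul_inv_smul] at this

theorem unitPairs_subset_spinStabilizer {L : Submodule ℚ V} {U' : Submodule Ω (Ω ⊗[ℚ] V)}
    (hUU' : IsOrthDecomp (Q.baseChange Ω) (L.baseChange Ω) U') :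
    unitPairs (Q.baseChange Ω) (L.baseChange Ω) ⊆ spinStabilizer Q Ω L ∧
    unitPairs (Q.baseChange Ω) U' ⊆ spinStabilizer Q Ω L := by
  constructor
  · intro g hg
    exact mem_spinStabilizer_iff.2 ⟨fun v hv => spinAct_unitPairs_mem hg le_rfl hv,
      fun v hv => spinAct_unitPairs_mem (inv_mem_unitPairs hg) le_rfl hv⟩
  · have : ∀ g ∈ unitPairs (Q.baseChange Ω) U', ∀ v ∈ L.baseChange Ω,
        spinAct g v ∈ L.baseChange Ω := fun g hg v hv => by
      rwa [spinAct_unitPairs_orth hg fun u hu => hUU'.symm.polar_eq u hu v hv]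
    intro g hg
    exact mem_spinStabilizer_iff.2 ⟨this g hg, this _ (inv_mem_unitPairs hg)⟩

end StabilizerGroup

/-! ### Extending the decomposition from the rationals -/

section BaseChange

variable {V : Type*} [AddCommGroup V] [Module ℚ V] {Q : QuadraticForm ℚ V}
  {F : Type*} [Field F] [Algebra ℚ F]

theorem mem_baseChange_induction {L : Submodule ℚ V} {p : F ⊗[ℚ] V → Prop}
    (tmul : ∀ v ∈ L, p (1 ⊗ₜ v)) (zero : p 0) (add : ∀ x y, p x → p y → p (x + y))
    (smul : ∀ (a : F) x, p x → p (a • x)) {x : F ⊗[ℚ] V} (hx : x ∈ L.baseChange F) : p x := by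
  rw [Submodule.baseChange_eq_span] at hx
  induction hx using Submodule.span_induction with
  | mem x hx =>
    obtain ⟨v, hv, rfl⟩ := hx
    exact tmul v hv
  | zero => exact zero
  | add x y _ _ hx hy => exact add x y hx hy
  | smul a x _ hx => exact smul a x hx

theorem isCompl_orthogonalComplement [FiniteDimensional ℚ V] (hQ : Q.PosDef) (L : Submodule ℚ V) :
    IsCompl L (orthogonalComplement Q L) := by
  have hrefl : LinearMap.BilinForm.IsRefl Q.polarBilin := fun x y h => by
    simpa [QuadraticMap.polar_comm] using h
  refine (LinearMap.BilinForm.isCompl_orthogonal_iff_disjoint hrefl).2 ?_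
  rw [Submodule.disjoint_def]
  intro v hv hv'
  have h := hv' v hv
  by_contra h0
  have h1 : QuadraticMap.polar Q v v = 0 := by simpa using h
  rw [polar_self'] at h1
  have := hQ v h0
  linarith

theorem finrank_baseChange_submodule [FiniteDimensional ℚ V] (L : Submodule ℚ V) :
    Module.finrank F (L.baseChange F) = Module.finrank ℚ L := by
  rw [← Module.finrank_baseChange (R := F) (S := ℚ) (M' := L)]
  refine LinearMap.finrank_range_of_inj ?_
  exact Module.Flat.lTensor_preserves_injective_linearMap (M := F) L.subtype L.injective_subtype

variable [CharZero F]

theorem polar_baseChange_tmul (a b : F) (v w : V) :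
    QuadraticMap.polar (Q.baseChange F) (a ⊗ₜ[ℚ] v) (b ⊗ₜ[ℚ] w) =
      a * b * algebraMap ℚ F (QuadraticMap.polar Q v w) := by
  let : Invertible (2 : F) := invertibleOfNonzero two_ne_zero
  have := congrArg (fun B : LinearMap.BilinForm F (F ⊗[ℚ] V) => B (a ⊗ₜ[ℚ] v) (b ⊗ₜ[ℚ] w))
    (QuadraticForm.polarBilin_baseChange (A := F) Q)
  simpa [Algebra.smul_def, mul_comm] using this

theorem isOrthDecomp_baseChange [FiniteDimensional ℚ V] (hQ : Q.PosDef) (L : Submodule ℚ V) :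
    IsOrthDecomp (Q.baseChange F) (L.baseChange F) ((orthogonalComplement Q L).baseChange F) := by
  refine ⟨?_, ?_, ?_⟩
  · rw [eq_top_iff, ← Submodule.baseChange_top]
    intro x hx
    refine mem_baseChange_induction ?_ (Submodule.zero_mem _)
      (fun _ _ => Submodule.add_mem _) (fun a _ => Submodule.smul_mem _ a) hx
    intro v _
    obtain ⟨u, hu, u', hu', rfl⟩ := Submodule.mem_sup.1
      (show v ∈ L ⊔ orthogonalComplement Q L by
        rw [(isCompl_orthogonalComplement hQ L).sup_eq_top]; trivial)
    rw [TensorProduct.tmul_add]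
    exact Submodule.add_mem_sup (Submodule.tmul_mem_baseChange_of_mem _ hu)
      (Submodule.tmul_mem_baseChange_of_mem _ hu')
  · intro u hu u' hu'
    refine mem_baseChange_induction (p := fun u => QuadraticMap.polar (Q.baseChange F) u u' = 0)
      ?_ (QuadraticMap.polar_zero_left _ _)
      (fun x y hx hy => by rw [QuadraticMap.polar_add_left, hx, hy, add_zero])
      (fun a x hx => by rw [QuadraticMap.polar_smul_left, hx, smul_zero]) hu
    intro v hv
    refine mem_baseChange_induction (p := fun u => QuadraticMap.polar (Q.baseChange F) _ u = 0)
      ?_ (QuadraticMap.polar_zero_right _ _)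
      (fun x y hx hy => by rw [QuadraticMap.polar_add_right, hx, hy, add_zero])
      (fun a x hx => by rw [QuadraticMap.polar_smul_right, hx, smul_zero]) hu'
    intro w hw
    have h : QuadraticMap.polar Q v w = 0 := by simpa using hw v hv
    rw [polar_baseChange_tmul, h, map_zero, mul_zero]
  -- Positivity is meaningless over `F`. An orthogonal rational basis has non-zero lengths, and
  -- these stay non-zero after extension of scalars.
  · have hsymm : LinearMap.IsSymm Q.polarBilin := ⟨fun x y => by
      simp [QuadraticMap.polar_comm _ x y]⟩
    obtain ⟨b, hb⟩ := LinearMap.BilinForm.exists_orthogonal_basis (B := Q.polarBilin) hsymm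
    intro v hv
    refine (b.baseChange F).ext_elem_iff.2 fun i => ?_
    have h := hv (1 ⊗ₜ b i)
    rw [← (b.baseChange F).sum_repr v, QuadraticMap.polar_comm, ← QuadraticMap.polarBilin_apply_apply,
      map_sum, Finset.sum_eq_single i] at h
    · rw [map_smul, QuadraticMap.polarBilin_apply_apply, Module.Basis.baseChange_apply,
        polar_baseChange_tmul, polar_self', smul_eq_mul] at h
      have hne : algebraMap ℚ F (2 * Q (b i)) ≠ 0 := by
        rw [map_ne_zero]
        exact mul_ne_zero two_ne_zero (hQ _ (b.ne_zero i)).ne'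
      rw [map_zero, Finsupp.zero_apply]
      refine (mul_eq_zero.1 h).resolve_right ?_
      rwa [one_mul, one_mul]
    · intro j _ hj
      have : QuadraticMap.polar Q (b i) (b j) = 0 := by
        simpa using hb (Ne.symm hj)
      rw [map_smul, QuadraticMap.polarBilin_apply_apply, Module.Basis.baseChange_apply,
        polar_baseChange_tmul, this, map_zero, mul_zero, smul_zero]
    · simp

end BaseChange

/-! ### Rational coordinates on the Clifford algebra -/

section Coordinates

open CliffordAlgebra

variable {V : Type*} [AddCommGroup V] [Module ℚ V] {Q : QuadraticForm ℚ V}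
  {F : Type*} [Field F] [Algebra ℚ F]

/-- The coordinate functions are linear. -/
def coordinateLinear (Q : QuadraticForm ℚ V) (F : Type*) [Field F] [Algebra ℚ F]
    (φ : Module.Dual ℚ (CliffordAlgebra Q)) : Clifford Q F →ₗ[F] F :=
  (Module.Dual.baseChange F φ) ∘ₗ (equivBaseChange F Q).toLinearMap

theorem coordinateLinear_apply (φ : Module.Dual ℚ (CliffordAlgebra Q)) (x : Clifford Q F) :
    coordinateLinear Q F φ x = coordinate Q F φ x := rfl

/-- The Clifford algebra over `ℚ` inside the one over `F`. -/
def ratMap (Q : QuadraticForm ℚ V) (F : Type*) [Field F] [Algebra ℚ F] :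
    CliffordAlgebra Q →+* Clifford Q F :=
  (equivBaseChange F Q).symm.toRingEquiv.toRingHom.comp
    (Algebra.TensorProduct.includeRight (R := ℚ) (A := F) (B := CliffordAlgebra Q)).toRingHom

theorem ratMap_apply (a : CliffordAlgebra Q) :
    ratMap Q F a = (equivBaseChange F Q).symm (1 ⊗ₜ a) := rfl

theorem coordinate_ratMap (φ : Module.Dual ℚ (CliffordAlgebra Q)) (a : CliffordAlgebra Q) :
    coordinate Q F φ (ratMap Q F a) = algebraMap ℚ F (φ a) := by
  rw [ratMap_apply, coordinate, AlgEquiv.apply_symm_apply]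
  simp [Algebra.smul_def]

theorem ratMap_algebraMap (r : ℚ) :
    ratMap Q F (algebraMap ℚ _ r) = algebraMap F _ (algebraMap ℚ F r) := by
  rw [ratMap_apply, AlgEquiv.symm_apply_eq, AlgEquiv.commutes,
    Algebra.TensorProduct.algebraMap_apply, Algebra.algebraMap_eq_smul_one r,
    TensorProduct.tmul_smul, TensorProduct.smul_tmul', ← Algebra.algebraMap_eq_smul_one]
  rfl

theorem ratMap_ι (v : V) : ratMap Q F (ι Q v) = ι (Q.baseChange F) (1 ⊗ₜ v) := by
  rw [ratMap_apply, AlgEquiv.symm_apply_eq]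
  exact (toBaseChange_ι F Q 1 v).symm

theorem clifford_induction {p : Clifford Q F → Prop} (rat : ∀ (c : F) a, p (c • ratMap Q F a))
    (add : ∀ x y, p x → p y → p (x + y)) (x : Clifford Q F) : p x := by
  obtain ⟨z, rfl⟩ := (equivBaseChange F Q).symm.surjective x
  induction z with
  | zero => simpa using rat 0 0
  | add x y hx hy => rw [map_add]; exact add _ _ hx hy
  | tmul c a =>
    have := rat c a
    rwa [ratMap_apply, ← map_smul, TensorProduct.smul_tmul', smul_eq_mul, mul_one] at this

theorem eq_sum_coordinate [FiniteDimensional ℚ V] (x : Clifford Q F) :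
    have := clifford_finite (q := Q)
    x = ∑ i, coordinate Q F ((Module.finBasis ℚ (CliffordAlgebra Q)).coord i) x •
      ratMap Q F (Module.finBasis ℚ (CliffordAlgebra Q) i) := by
  intro this
  induction x using clifford_induction with
  | add x y hx hy =>
    conv_lhs => rw [hx, hy]
    simp only [← coordinateLinear_apply, map_add, add_smul, Finset.sum_add_distrib]
  | rat c a =>
    simp only [← coordinateLinear_apply, map_smul, smul_eq_mul, mul_smul, ← Finset.smul_sum]
    simp only [coordinateLinear_apply, coordinate_ratMap, Module.Basis.coord_apply]
    congr 1
    conv_lhs => rw [← (Module.finBasis ℚ (CliffordAlgebra Q)).sum_repr a, map_sum]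
    refine Finset.sum_congr rfl fun i _ => ?_
    rw [Algebra.smul_def, map_mul, Algebra.smul_def]
    rw [ratMap_algebraMap]

theorem eq_zero_of_coordinate [FiniteDimensional ℚ V] (x : Clifford Q F)
    (h : ∀ φ, coordinate Q F φ x = 0) : x = 0 := by
  rw [eq_sum_coordinate x]
  simp [h]

/-- Being a vector is a system of linear equations with rational coefficients: the projection to
vectors is defined over the rationals, and `φ` minus its composition with that projection kills
vectors. This form passes to Zariski closures and descends to subfields. -/
theorem range_ι_of_coordinate [FiniteDimensional ℚ V] (x : Clifford Q F)
    (h : ∀ φ : Module.Dual ℚ (CliffordAlgebra Q), (∀ v, φ (ι Q v) = 0) → coordinate Q F φ x = 0) :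
    ∃ w, x = ι (Q.baseChange F) w := by
  let T : Clifford Q F →ₗ[F] Clifford Q F := (equivBaseChange F Q).symm.toLinearMap ∘ₗ
    ((ι Q ∘ₗ vectorPart Q).baseChange F) ∘ₗ (equivBaseChange F Q).toLinearMap
  have hT : ∀ a, T (ratMap Q F a) = ratMap Q F (ι Q (vectorPart Q a)) := by
    intro a
    simp [T, ratMap_apply]
  have hTx : x = T x := by
    rw [← sub_eq_zero]
    refine eq_zero_of_coordinate _ fun φ => ?_
    have key : ∀ y, coordinateLinear Q F φ (y - T y) =
        coordinateLinear Q F (φ - φ ∘ₗ ι Q ∘ₗ vectorPart Q) y := by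
      intro y
      induction y using clifford_induction with
      | add x y hx hy => rw [map_add, add_sub_add_comm, map_add, hx, hy, map_add]
      | rat c a =>
        rw [map_smul, ← smul_sub, map_smul, map_smul, hT, map_sub]
        simp only [coordinateLinear_apply, coordinate_ratMap, LinearMap.sub_apply,
          LinearMap.comp_apply, map_sub]
    rw [← coordinateLinear_apply, key]
    exact h _ fun v => by simp
  rw [hTx]
  clear hTx h
  induction x using clifford_induction with
  | add x y hx hy =>
    obtain ⟨w, hw⟩ := hx
    obtain ⟨w', hw'⟩ := hy
    exact ⟨w + w', by rw [map_add, hw, hw', map_add]⟩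
  | rat c a => exact ⟨c • (1 ⊗ₜ vectorPart Q a), by rw [map_smul, hT, ratMap_ι, map_smul]⟩

theorem coordinate_ι_eq_zero (φ : Module.Dual ℚ (CliffordAlgebra Q)) (hφ : ∀ v, φ (ι Q v) = 0)
    (w : F ⊗[ℚ] V) : coordinate Q F φ (ι (Q.baseChange F) w) = 0 := by
  rw [← coordinateLinear_apply]
  induction w with
  | zero => simp
  | add x y hx hy => rw [map_add, map_add, hx, hy, add_zero]
  | tmul c v =>
    have : (c ⊗ₜ[ℚ] v : F ⊗[ℚ] V) = c • (1 ⊗ₜ v) := by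
      rw [TensorProduct.smul_tmul', smul_eq_mul, mul_one]
    rw [this, map_smul, map_smul, ← ratMap_ι, coordinateLinear_apply, coordinate_ratMap, hφ]
    simp

theorem coordinate_involute (φ : Module.Dual ℚ (CliffordAlgebra Q)) (x : Clifford Q F) :
    coordinate Q F φ (involute x) = coordinate Q F (φ ∘ₗ involute.toLinearMap) x := by
  have hr : ∀ a, involute (ratMap Q F a) = ratMap Q F (involute a) := by
    intro a
    induction a using CliffordAlgebra.induction with
    | algebraMap r => simp
    | ι v => rw [ratMap_ι, involute_ι, involute_ι, map_neg, ratMap_ι]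
    | mul a b ha hb => rw [map_mul, map_mul, ha, hb, map_mul, map_mul]
    | add a b ha hb => rw [map_add, map_add, ha, hb, map_add, map_add]
  simp only [← coordinateLinear_apply]
  induction x using clifford_induction with
  | add x y hx hy => rw [map_add, map_add, hx, hy, map_add]
  | rat c a =>
    rw [map_smul, map_smul, map_smul, hr]
    simp only [coordinateLinear_apply, coordinate_ratMap]
    rfl

theorem coordinate_star (φ : Module.Dual ℚ (CliffordAlgebra Q)) (x : Clifford Q F) :
    coordinate Q F φ (star x) =
      coordinate Q F (φ ∘ₗ reverse ∘ₗ involute.toLinearMap) x := by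
  have hr : ∀ a, star (ratMap Q F a) = ratMap Q F (star a) := by
    intro a
    induction a using CliffordAlgebra.induction with
    | algebraMap r => rw [star_algebraMap, ratMap_algebraMap, star_algebraMap]
    | ι v => rw [ratMap_ι, star_ι, star_ι, map_neg, ratMap_ι]
    | mul a b ha hb => rw [map_mul, star_mul, star_mul, ha, hb, map_mul]
    | add a b ha hb => rw [map_add, star_add, star_add, ha, hb, map_add]
  simp only [← coordinateLinear_apply]
  induction x using clifford_induction with
  | add x y hx hy => rw [star_add, map_add, hx, hy, map_add]
  | rat c a =>
    rw [CliffordAlgebra.star_smul, map_smul, map_smul, hr]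
    simp only [coordinateLinear_apply, coordinate_ratMap]
    rfl

/-! ### Functoriality in the field of scalars -/

section Extension

variable {F' : Type*} [Field F'] [Algebra ℚ F'] (σ : F →ₐ[ℚ] F')

/-- Extension of scalars for vectors. -/
def extendVector : F ⊗[ℚ] V →ₗ[ℚ] F' ⊗[ℚ] V := LinearMap.rTensor V σ.toLinearMap

variable (Q) in
/-- Extension of scalars for Clifford algebras. -/
def extendClifford : Clifford Q F →+* Clifford Q F' :=
  ((equivBaseChange F' Q).symm.toRingEquiv.toRingHom.comp
    (Algebra.TensorProduct.map σ (AlgHom.id ℚ (CliffordAlgebra Q))).toRingHom).comp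
    (equivBaseChange F Q).toRingEquiv.toRingHom

theorem extendVector_tmul (c : F) (v : V) :
    extendVector σ (c ⊗ₜ[ℚ] v) = σ c ⊗ₜ[ℚ] v := rfl

theorem extendVector_smul (c : F) (w : F ⊗[ℚ] V) :
    extendVector σ (c • w) = σ c • extendVector σ w := by
  induction w with
  | zero => simp
  | add x y hx hy => rw [smul_add, map_add, hx, hy, map_add, smul_add]
  | tmul a v => simp [TensorProduct.smul_tmul', extendVector_tmul]

theorem extendClifford_ratMap (a : CliffordAlgebra Q) :
    extendClifford Q σ (ratMap Q F a) = ratMap Q F' a := by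
  change (equivBaseChange F' Q).symm (Algebra.TensorProduct.map σ
    (AlgHom.id ℚ (CliffordAlgebra Q)) (equivBaseChange F Q ((equivBaseChange F Q).symm _))) = _
  rw [AlgEquiv.apply_symm_apply]
  simp [ratMap_apply]

theorem extendClifford_algebraMap (c : F) :
    extendClifford Q σ (algebraMap F _ c) = algebraMap F' _ (σ c) := by
  change (equivBaseChange F' Q).symm (Algebra.TensorProduct.map σ
    (AlgHom.id ℚ (CliffordAlgebra Q)) (equivBaseChange F Q (algebraMap F _ c))) = _
  rw [AlgEquiv.commutes, AlgEquiv.symm_apply_eq, AlgEquiv.commutes]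
  simp [Algebra.TensorProduct.algebraMap_apply]

theorem extendClifford_smul (c : F) (x : Clifford Q F) :
    extendClifford Q σ (c • x) = σ c • extendClifford Q σ x := by
  rw [Algebra.smul_def, map_mul, extendClifford_algebraMap, Algebra.smul_def]

theorem extendClifford_ι (w : F ⊗[ℚ] V) :
    extendClifford Q σ (ι (Q.baseChange F) w) = ι (Q.baseChange F') (extendVector σ w) := by
  induction w with
  | zero => simp
  | add x y hx hy => rw [map_add, map_add, hx, hy, map_add, map_add]
  | tmul c v =>
    have : (c ⊗ₜ[ℚ] v : F ⊗[ℚ] V) = c • (1 ⊗ₜ v) := by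
      rw [TensorProduct.smul_tmul', smul_eq_mul, mul_one]
    rw [this, map_smul, extendClifford_smul, ← ratMap_ι, extendClifford_ratMap, ratMap_ι,
      ← map_smul, extendVector_smul, extendVector_tmul, map_one]

theorem coordinate_extendClifford (φ : Module.Dual ℚ (CliffordAlgebra Q)) (x : Clifford Q F) :
    coordinate Q F' φ (extendClifford Q σ x) = σ (coordinate Q F φ x) := by
  simp only [← coordinateLinear_apply]
  induction x using clifford_induction with
  | add x y hx hy => simp only [map_add, hx, hy]
  | rat c a =>
    rw [extendClifford_smul, extendClifford_ratMap, map_smul, map_smul]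
    simp only [coordinateLinear_apply, coordinate_ratMap, smul_eq_mul, map_mul]
    rw [AlgHom.commutes]

theorem extendClifford_injective [FiniteDimensional ℚ V] :
    Function.Injective (extendClifford Q σ) := by
  refine (injective_iff_map_eq_zero _).2 fun x hx => eq_zero_of_coordinate x fun φ => ?_
  have := coordinate_extendClifford σ φ x
  rw [hx, ← coordinateLinear_apply, map_zero] at this
  exact (map_eq_zero σ).1 this.symm

theorem extendClifford_involute (x : Clifford Q F) :
    extendClifford Q σ (involute x) = involute (extendClifford Q σ x) := by
  induction x using CliffordAlgebra.induction with
  | algebraMap r => simp [extendClifford_algebraMap]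
  | ι v => rw [involute_ι, map_neg, extendClifford_ι, involute_ι]
  | mul a b ha hb => rw [map_mul, map_mul, ha, hb, map_mul, map_mul]
  | add a b ha hb => rw [map_add, map_add, ha, hb, map_add, map_add]

theorem extendClifford_star (x : Clifford Q F) :
    extendClifford Q σ (star x) = star (extendClifford Q σ x) := by
  induction x using CliffordAlgebra.induction with
  | algebraMap r => simp [extendClifford_algebraMap]
  | ι v => rw [star_ι, map_neg, extendClifford_ι, star_ι]
  | mul a b ha hb => rw [star_mul, map_mul, ha, hb, map_mul, star_mul]
  | add a b ha hb => rw [star_add, map_add, ha, hb, map_add, star_add]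

theorem extendVector_injective : Function.Injective (extendVector (V := V) σ) :=
  Module.Flat.rTensor_preserves_injective_linearMap (M := V) σ.toLinearMap σ.toRingHom.injective

variable [CharZero F']

theorem baseChange_extendVector (w : F ⊗[ℚ] V) :
    Q.baseChange F' (extendVector σ w) = σ (Q.baseChange F w) := by
  apply algebraMap_injective' (q := Q.baseChange F')
  rw [← ι_sq_scalar, ← extendClifford_ι, ← map_mul, ι_sq_scalar, extendClifford_algebraMap]

theorem polar_extendVector (v w : F ⊗[ℚ] V) :
    QuadraticMap.polar (Q.baseChange F') (extendVector σ v) (extendVector σ w) =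
      σ (QuadraticMap.polar (Q.baseChange F) v w) := by
  simp only [QuadraticMap.polar, ← map_add, baseChange_extendVector, map_sub]

omit [CharZero F'] in
theorem extendVector_mem {L : Submodule ℚ V} {w : F ⊗[ℚ] V} (hw : w ∈ L.baseChange F) :
    extendVector σ w ∈ L.baseChange F' :=
  mem_baseChange_induction (p := fun w => extendVector σ w ∈ L.baseChange F')
    (fun v hv => by
      rw [extendVector_tmul, map_one]; exact Submodule.tmul_mem_baseChange_of_mem _ hv)
    (by rw [map_zero]; exact Submodule.zero_mem _)
    (fun x y hx hy => by rw [map_add]; exact Submodule.add_mem _ hx hy)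
    (fun a x hx => by rw [extendVector_smul]; exact Submodule.smul_mem _ _ hx) hw

end Extension

end Coordinates

/-! ### The group generated by products of two unit vectors -/

section RotationGroup

open CliffordAlgebra

variable {F : Type*} [Field F] {W : Type*} [AddCommGroup W] [Module F W]
  {q : QuadraticForm F W} {U : Submodule F W}

/-- Consecutive vectors are paired and scaled to length one, which is possible over an algebraically
closed field. -/
theorem exists_closure_unitPairs_of_even [IsAlgClosed F] (n : ℕ) : ∀ l : List W, l.length = 2 * n →
    (∀ v ∈ l, v ∈ U ∧ q v ≠ 0) →
    ∃ g ∈ Subgroup.closure (unitPairs q U), ∃ c : F,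
      (l.map (ι q)).prod = c • (g : CliffordAlgebra q) := by
  induction n with
  | zero =>
    intro l hl _
    rw [List.length_eq_zero_iff.1 (by omega : l.length = 0)]
    exact ⟨1, Subgroup.one_mem _, 1, by simp⟩
  | succ n ih =>
    intro l hl h
    match l, hl, h with
    | v :: w :: l, hl, h =>
      obtain ⟨g, hg, c, hc⟩ := ih l (by simp only [List.length_cons] at hl; omega)
        (fun x hx => h x (by simp [hx]))
      obtain ⟨hv, hqv⟩ := h v (by simp)
      obtain ⟨hw, hqw⟩ := h w (by simp)
      obtain ⟨a, ha, hav⟩ := exists_smul_eq_one hqv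
      obtain ⟨b, hb, hbw⟩ := exists_smul_eq_one hqw
      refine ⟨⟨_, ι_mul_ι_mem_spinGroup hav hbw⟩ * g, Subgroup.mul_mem _
        (Subgroup.subset_closure ⟨_, U.smul_mem _ hv, _, U.smul_mem _ hw, hav, hbw, rfl⟩) hg,
        a⁻¹ * b⁻¹ * c, ?_⟩
      rw [List.map_cons, List.map_cons, List.prod_cons, List.prod_cons, hc, Submonoid.coe_mul]
      simp only [map_smul, smul_mul_assoc, mul_smul_comm, smul_smul, mul_assoc]
      congr 1
      field_simp

variable [CharZero F]

/-- Products of anisotropic vectors of `U` which satisfy the equations of the spin group lie in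
the subgroup generated by products of two unit vectors. -/
theorem exists_closure_unitPairs_eq [IsAlgClosed F] [FiniteDimensional F W] (hU : IsNondeg q U)
    (hU0 : U ≠ ⊥) {x : CliffordAlgebra q}
    {c : F} {l : List W} (hl : ∀ v ∈ l, v ∈ U ∧ q v ≠ 0) (hx : x = c • (l.map (ι q)).prod)
    (hinv : involute x = x) (hstar : star x * x = 1) :
    ∃ g ∈ Subgroup.closure (unitPairs q U), (g : CliffordAlgebra q) = x := by
  have := clifford_nontrivial (q := q)
  -- A product of an odd number of vectors changes sign under the grade involution, so an even one
  -- would vanish.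
  have heven : Even l.length := by
    by_contra hodd
    rw [Nat.not_even_iff_odd] at hodd
    have h1 : involute x = -x := by
      rw [hx, map_smul, involute_prod_map_ι, hodd.neg_one_pow, neg_smul, one_smul, smul_neg]
    have h2 : x = 0 := by
      have h3 : (2 : F) • x = 0 := by rw [two_smul]; nth_rw 1 [← hinv, h1]; exact neg_add_cancel x
      exact (smul_eq_zero.1 h3).resolve_left two_ne_zero
    rw [h2, mul_zero] at hstar
    exact zero_ne_one hstar
  obtain ⟨n, hn⟩ := heven
  obtain ⟨g, hg, d, hd⟩ := exists_closure_unitPairs_of_even n l (by omega) hl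
  rw [hd, smul_smul] at hx
  have h1 : (c * d) * (c * d) = 1 := by
    rw [hx, CliffordAlgebra.star_smul, smul_mul_assoc, mul_smul_comm, spin_star_mul, smul_smul,
      ← Algebra.algebraMap_eq_smul_one, ← map_one (algebraMap F _)] at hstar
    exact algebraMap_injective' hstar
  rcases mul_self_eq_one_iff.1 h1 with h1 | h1
  · exact ⟨g, hg, by rw [hx, h1, one_smul]⟩
  -- The remaining sign lies in the group: -1 is the product of `-a • v` and `a • v`.
  · obtain ⟨v, hv, hqv⟩ := hU.exists_ne_zero hU0
    obtain ⟨a, -, ha⟩ := exists_smul_eq_one hqv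
    have ha' : q (-(a • v)) = 1 := by rw [QuadraticMap.map_neg, ha]
    refine ⟨⟨_, ι_mul_ι_mem_spinGroup ha' ha⟩ * g, Subgroup.mul_mem _
      (Subgroup.subset_closure ⟨_, U.neg_mem (U.smul_mem _ hv), _, U.smul_mem _ hv, ha', ha, rfl⟩)
      hg, ?_⟩
    change ι q (-(a • v)) * ι q (a • v) * (g : CliffordAlgebra q) = x
    rw [hx, h1, map_neg, neg_mul, ι_mul_self_eq_smul, ha, one_smul, neg_mul, one_mul, neg_smul,
      one_smul]

/-- The group contains -1, a product of two opposite unit vectors. -/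
theorem closure_unitPairs_ne_bot [IsAlgClosed F] [FiniteDimensional F W] (hU : IsNondeg q U)
    (hdim : 2 ≤ Module.finrank F U) : Subgroup.closure (unitPairs q U) ≠ ⊥ := by
  have := clifford_nontrivial (q := q)
  obtain ⟨v, hv, hqv⟩ := hU.exists_ne_zero (ne_bot_of_finrank_pos (by omega))
  obtain ⟨a, -, ha⟩ := exists_smul_eq_one hqv
  have ha' : q (-(a • v)) = 1 := by rw [QuadraticMap.map_neg, ha]
  intro h
  have h1 : (⟨_, ι_mul_ι_mem_spinGroup ha' ha⟩ : spinGroup q) ∈ (⊥ : Subgroup (spinGroup q)) :=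
    h ▸ Subgroup.subset_closure
      ⟨_, U.neg_mem (U.smul_mem _ hv), _, U.smul_mem _ hv, ha', ha, rfl⟩
  have h2 : ι q (-(a • v)) * ι q (a • v) = 1 := congrArg Subtype.val (Subgroup.mem_bot.1 h1)
  rw [map_neg, neg_mul, ι_mul_self_eq_smul, ha, one_smul] at h2
  have h3 : (2 : F) • (1 : CliffordAlgebra q) = 0 := by
    rw [two_smul]; nth_rw 1 [← h2]; exact neg_add_cancel _
  exact two_ne_zero ((smul_eq_zero.1 h3).resolve_right one_ne_zero)

/-- The elements of the Clifford algebra which satisfy the equations of the spin group of `U` are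
products of vectors of `U`. -/
theorem IsOrthDecomp.exists_eq_smul_prod [FiniteDimensional F W] {U' : Submodule F W}
    (h : IsOrthDecomp q U U') :
    ∃ r : ℕ, ∀ x : CliffordAlgebra q, involute x = x → star x * x = 1 →
      (∀ v, ∃ w, x * ι q v * star x = ι q w) → (∀ v ∈ U', x * ι q v = ι q v * x) →
      ∃ (c : F) (l : List W), (∀ v ∈ l, v ∈ U ∧ q v ≠ 0) ∧ l.length ≤ r ∧
        x = c • (l.map (ι q)).prod := by
  obtain ⟨es, h1, h2, h3⟩ := IsNondeg.exists_orthogonal_list _ U h.isNondeg le_rfl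
  -- The bound depends only on an orthogonal basis of `U` and not on `x`; the compactness argument
  -- needs this uniformity.
  refine ⟨2 * es.length, fun x hinv hstar hvec hcomm => ?_⟩
  refine SpinStabilizer.exists_eq_smul_prod h.nondeg U U' (fun z hz => h.mem_of_orth hz) es U' x
    (star x) hstar le_rfl ?_ ?_ h1 h2 ?_ ?_
  · intro d hd
    rw [hinv, hcomm d hd]
  · intro v
    obtain ⟨w, hw⟩ := hvec v
    refine ⟨w, ?_⟩
    rw [hinv, ← hw, mul_assoc _ (star x), hstar, mul_one]
  · intro e he d hd
    exact h.symm.polar_eq d hd e (h1 e he).1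
  · rw [eq_top_iff, ← h.sup_eq]
    exact sup_le (h3.trans le_sup_right) le_sup_left

/-- The equations of the spin group of `U`. -/
theorem equations_of_mem_closure {U' : Submodule F W} (h : IsOrthDecomp q U U') {g : spinGroup q}
    (hg : g ∈ Subgroup.closure (unitPairs q U)) {v : W} (hv : v ∈ U') :
    (g : CliffordAlgebra q) * ι q v = ι q v * g := by
  induction hg using Subgroup.closure_induction with
  | mem g hg =>
    rw [mul_ι_eq, spinAct_unitPairs_orth hg fun u hu => h.polar_eq u hu v hv]
  | one => rw [Submonoid.coe_one, one_mul, mul_one]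
  | mul x y _ _ hx hy => rw [Submonoid.coe_mul, mul_assoc, hy, ← mul_assoc, hx, mul_assoc]
  | inv x _ hx =>
    have h1 : spinAct x v = v := spinAct_eq hx
    rw [mul_ι_eq]
    nth_rw 1 [← h1]
    rw [spinAct_inv_apply]

end RotationGroup

/-! ### Equations of the spin group of a subspace -/

section PolynomialMaps

open CliffordAlgebra

variable {V : Type*} [AddCommGroup V] [Module ℚ V] (Q : QuadraticForm ℚ V)
  (K : Type*) [Field K] {Ω : Type*} [Field Ω] [Algebra ℚ Ω] [Algebra K Ω]

/-- The polynomial functions with coefficients in `K` on the Clifford algebra. -/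
def IsPolynomial (f : Clifford Q Ω → Ω) : Prop :=
  ∃ p : MvPolynomial (Module.Dual ℚ (CliffordAlgebra Q)) K,
    ∀ x, MvPolynomial.aeval (fun φ => coordinate Q Ω φ x) p = f x

/-- The polynomial maps with coefficients in `K` of the Clifford algebra to itself. -/
def IsPolynomialMap (T : Clifford Q Ω → Clifford Q Ω) : Prop :=
  ∀ φ, IsPolynomial Q K fun x => coordinate Q Ω φ (T x)

variable {Q K}

theorem IsPolynomial.add {f g : Clifford Q Ω → Ω} (hf : IsPolynomial Q K f)
    (hg : IsPolynomial Q K g) : IsPolynomial Q K fun x => f x + g x := by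
  obtain ⟨p, hp⟩ := hf
  obtain ⟨p', hp'⟩ := hg
  exact ⟨p + p', fun x => by rw [map_add, hp, hp']⟩

theorem IsPolynomial.mul {f g : Clifford Q Ω → Ω} (hf : IsPolynomial Q K f)
    (hg : IsPolynomial Q K g) : IsPolynomial Q K fun x => f x * g x := by
  obtain ⟨p, hp⟩ := hf
  obtain ⟨p', hp'⟩ := hg
  exact ⟨p * p', fun x => by rw [map_mul, hp, hp']⟩

theorem isPolynomialMap_id : IsPolynomialMap Q K fun x : Clifford Q Ω => x :=
  fun φ => ⟨MvPolynomial.X φ, fun x => by simp⟩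

theorem IsPolynomialMap.star {T : Clifford Q Ω → Clifford Q Ω} (hT : IsPolynomialMap Q K T) :
    IsPolynomialMap Q K fun x => star (T x) := fun φ => by
  simp only [coordinate_star]
  exact hT _

theorem IsPolynomialMap.involute {T : Clifford Q Ω → Clifford Q Ω} (hT : IsPolynomialMap Q K T) :
    IsPolynomialMap Q K fun x => CliffordAlgebra.involute (T x) := fun φ => by
  simp only [coordinate_involute]
  exact hT _

variable [Algebra ℚ K]

theorem isPolynomial_const (r : ℚ) :
    IsPolynomial Q K fun _ : Clifford Q Ω => algebraMap ℚ Ω r := by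
  refine ⟨MvPolynomial.C (algebraMap ℚ K r), fun x => ?_⟩
  rw [MvPolynomial.aeval_C]
  exact RingHom.congr_fun (Subsingleton.elim ((algebraMap K Ω).comp (algebraMap ℚ K))
    (algebraMap ℚ Ω)) r

theorem IsPolynomial.sum {ι : Type*} (s : Finset ι) {f : ι → Clifford Q Ω → Ω}
    (hf : ∀ i ∈ s, IsPolynomial Q K (f i)) : IsPolynomial Q K fun x => ∑ i ∈ s, f i x := by
  classical
  induction s using Finset.induction_on with
  | empty => simpa using isPolynomial_const (Q := Q) (K := K) (Ω := Ω) 0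
  | insert i s hi ih =>
    simp only [Finset.sum_insert hi]
    exact (hf i (by simp)).add (ih fun j hj => hf j (by simp [hj]))

theorem isPolynomialMap_ratMap (a : CliffordAlgebra Q) :
    IsPolynomialMap Q K fun _ : Clifford Q Ω => ratMap Q Ω a := fun φ => by
  simp only [coordinate_ratMap]
  exact isPolynomial_const _

theorem IsPolynomialMap.sub {S T : Clifford Q Ω → Clifford Q Ω} (hS : IsPolynomialMap Q K S)
    (hT : IsPolynomialMap Q K T) : IsPolynomialMap Q K fun x => S x - T x := fun φ => by
  have h : (fun x => coordinate Q Ω φ (S x - T x)) =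
      fun x => coordinate Q Ω φ (S x) + algebraMap ℚ Ω (-1) * coordinate Q Ω φ (T x) := by
    funext x
    simp only [← coordinateLinear_apply, map_sub, map_neg, map_one]
    ring
  rw [h]
  exact (hS φ).add ((isPolynomial_const _).mul (hT φ))

theorem IsPolynomialMap.mul [FiniteDimensional ℚ V] {S T : Clifford Q Ω → Clifford Q Ω}
    (hS : IsPolynomialMap Q K S) (hT : IsPolynomialMap Q K T) :
    IsPolynomialMap Q K fun x => S x * T x := fun φ => by
  have := clifford_finite (q := Q)
  let b := Module.finBasis ℚ (CliffordAlgebra Q)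
  have h : (fun x => coordinate Q Ω φ (S x * T x)) = fun x => ∑ i, ∑ j,
      coordinate Q Ω (b.coord i) (S x) * (coordinate Q Ω (b.coord j) (T x) *
        algebraMap ℚ Ω (φ (b i * b j))) := by
    funext x
    conv_lhs => rw [eq_sum_coordinate (S x), eq_sum_coordinate (T x)]
    simp only [← coordinateLinear_apply, Finset.sum_mul_sum, map_sum, smul_mul_assoc,
      mul_smul_comm, map_smul, ← map_mul, smul_eq_mul]
    simp only [coordinateLinear_apply, coordinate_ratMap]
    exact Finset.sum_congr rfl fun i _ => Finset.sum_congr rfl fun j _ => mul_left_comm _ _ _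
  rw [h]
  exact IsPolynomial.sum _ fun i _ => IsPolynomial.sum _ fun j _ =>
    (hS _).mul ((hT _).mul (isPolynomial_const _))

/-- The subgroup generated by products of two unit vectors of `L` is closed and defined
over `K`. -/
theorem isClosedDefinedOver_closure_unitPairs [IsAlgClosed Ω] [FiniteDimensional ℚ V]
    {L L' : Submodule ℚ V}
    (h : IsOrthDecomp (Q.baseChange Ω) (L.baseChange Ω) (L'.baseChange Ω))
    (h0 : L.baseChange Ω ≠ ⊥) :
    IsClosedDefinedOver Q K Ω
      (Subgroup.closure (unitPairs (Q.baseChange Ω) (L.baseChange Ω))) := by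
  have : CharZero Ω := algebraRat.charZero Ω
  set N := Subgroup.closure (unitPairs (Q.baseChange Ω) (L.baseChange Ω)) with hN
  -- Take all polynomials over `K` vanishing on the group. A common zero inherits every identity
  -- with rational coefficients valid on the group, and those suffice to write it as a product of
  -- vectors.
  refine ⟨{f | ∀ x ∈ points Q Ω N, MvPolynomial.aeval (fun φ => coordinate Q Ω φ x) f = 0},
    Set.Subset.antisymm (fun x hx f hf => hf x hx) fun x hx => ?_⟩
  have hpol : ∀ f : Clifford Q Ω → Ω, IsPolynomial Q K f → (∀ g ∈ N, f (g : Clifford Q Ω) = 0) →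
      f x = 0 := by
    rintro f ⟨p, hp⟩ hf
    rw [← hp]
    refine hx p ?_
    rintro _ ⟨g, hg, rfl⟩
    rw [hp, hf g hg]
  have hmap : ∀ T : Clifford Q Ω → Clifford Q Ω, IsPolynomialMap Q K T →
      (∀ g ∈ N, T (g : Clifford Q Ω) = 0) → T x = 0 := fun T hT hT0 =>
    eq_zero_of_coordinate _ fun φ => hpol _ (hT φ) fun g hg => by
      rw [hT0 g hg, ← coordinateLinear_apply, map_zero]
  have id := isPolynomialMap_id (Q := Q) (K := K) (Ω := Ω)
  have hinv : involute x = x := sub_eq_zero.1 <| hmap (fun x => involute x - x)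
    (id.involute.sub id) fun g _ => by rw [spinGroup.involute_eq g.2, sub_self]
  have hstar : star x * x = 1 := by
    have := hmap (fun x => star x * x - ratMap Q Ω 1) ((id.star.mul id).sub
      (isPolynomialMap_ratMap 1)) fun g _ => by rw [spin_star_mul, map_one, sub_self]
    rwa [map_one, sub_eq_zero] at this
  have hcomm : ∀ v ∈ L'.baseChange Ω, x * ι (Q.baseChange Ω) v = ι (Q.baseChange Ω) v * x := by
    intro v hv
    refine mem_baseChange_induction
      (p := fun v => x * ι (Q.baseChange Ω) v = ι (Q.baseChange Ω) v * x) ?_ (by simp)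
      (fun x y hx hy => by rw [map_add, mul_add, hx, hy, add_mul])
      (fun a x hx => by rw [map_smul, mul_smul_comm, hx, smul_mul_assoc]) hv
    intro w hw
    rw [← ratMap_ι]
    exact sub_eq_zero.1 <| hmap (fun x => x * ratMap Q Ω (ι Q w) - ratMap Q Ω (ι Q w) * x)
      ((id.mul (isPolynomialMap_ratMap _)).sub ((isPolynomialMap_ratMap _).mul id)) fun g hg => by
        rw [ratMap_ι, equations_of_mem_closure h hg (Submodule.tmul_mem_baseChange_of_mem _ hw),
          sub_self]
  have hvec : ∀ v, ∃ w, x * ι (Q.baseChange Ω) v * star x = ι (Q.baseChange Ω) w := by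
    intro v
    have hv : v ∈ (⊤ : Submodule ℚ V).baseChange Ω := by rw [Submodule.baseChange_top]; trivial
    refine mem_baseChange_induction
      (p := fun v => ∃ w, x * ι (Q.baseChange Ω) v * star x = ι (Q.baseChange Ω) w) ?_
      ⟨0, by simp⟩ ?_ ?_ hv
    · intro w _
      refine range_ι_of_coordinate _ fun φ hφ => ?_
      rw [← ratMap_ι]
      exact hpol _ (((id.mul (isPolynomialMap_ratMap (ι Q w))).mul id.star) φ) fun g _ => by
        simp only [ratMap_ι, ← ι_spinAct]
        exact coordinate_ι_eq_zero φ hφ _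
    · rintro a b ⟨w, hw⟩ ⟨w', hw'⟩
      exact ⟨w + w', by rw [map_add, mul_add, add_mul, hw, hw', map_add]⟩
    · rintro c a ⟨w, hw⟩
      exact ⟨c • w, by rw [map_smul, mul_smul_comm, smul_mul_assoc, hw, map_smul]⟩
  obtain ⟨r, hr⟩ := h.exists_eq_smul_prod
  obtain ⟨c, l, hl, -, hxl⟩ := hr x hinv hstar hvec hcomm
  obtain ⟨g, hg, hgx⟩ := exists_closure_unitPairs_eq h.isNondeg h0 hl hxl hinv hstar
  exact ⟨g, hg, hgx⟩

end PolynomialMaps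

/-! ### Isotropy of the restricted form -/

section Isotropy

variable {V : Type*} [AddCommGroup V] [Module ℚ V] {Q : QuadraticForm ℚ V}
  {F : Type*} [Field F] [Algebra ℚ F]

theorem restrictBaseChange_apply (L : Submodule ℚ V) (w : F ⊗[ℚ] L) :
    restrictBaseChange Q F L w = Q.baseChange F (L.subtype.baseChange F w) := by
  have h : restrictBaseChange Q F L = (Q.baseChange F).comp (L.subtype.baseChange F) := by
    refine baseChange_ext fun m => ?_
    simp [restrictBaseChange, QuadraticForm.baseChange_tmul]
  rw [h, QuadraticMap.comp_apply]

theorem isIsotropic_restrictBaseChange_iff {L : Submodule ℚ V} :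
    IsIsotropic (restrictBaseChange Q F L) ↔
      ∃ w ∈ L.baseChange F, w ≠ 0 ∧ Q.baseChange F w = 0 := by
  have hinj : Function.Injective (L.subtype.baseChange F) :=
    Module.Flat.lTensor_preserves_injective_linearMap (M := F) L.subtype L.injective_subtype
  constructor
  · rintro ⟨w, hw, hq⟩
    refine ⟨L.subtype.baseChange F w, ⟨w, rfl⟩, fun h => hw (hinj (by rw [h, map_zero])), ?_⟩
    rw [← restrictBaseChange_apply, hq]
  · rintro ⟨_, ⟨w, rfl⟩, hw, hq⟩
    exact ⟨w, fun h => hw (by rw [h, map_zero]), by rw [restrictBaseChange_apply]; exact hq⟩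

end Isotropy

/-! ### Compactness for anisotropic spaces -/

section Compactness

open CliffordAlgebra

variable {K : Type*} [NontriviallyNormedField K]
  {W : Type*} [AddCommGroup W] [Module K W] {q : QuadraticForm K W}

/-- The spinor norm of a product of vectors. -/
theorem star_prod_mul_prod (l : List W) :
    star (l.map (ι q)).prod * (l.map (ι q)).prod = (l.map fun v => -q v).prod • 1 := by
  induction l with
  | nil => simp
  | cons v l ih =>
    rw [List.map_cons, List.prod_cons, star_mul, star_ι, mul_assoc, ← mul_assoc (-ι q v), neg_mul,
      ι_mul_self_eq_smul, neg_mul, smul_mul_assoc, one_mul, mul_neg, mul_smul_comm, ih,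
      List.map_cons, List.prod_cons, smul_smul, neg_mul, neg_smul]

/-- Vectors can be normalised. -/
theorem exists_normalised_list [FiniteDimensional K W] {U : Submodule K W} {k : ℕ}
    (b : Module.Basis (Fin k) K U) (l : List W) (hl : ∀ v ∈ l, v ∈ U ∧ q v ≠ 0) :
    ∃ (s : K) (l' : List (Fin k → K)), (∀ a ∈ l', ‖a‖ = 1) ∧ l'.length = l.length ∧
      (l.map (ι q)).prod =
        s • ((l'.map fun a => ((b.equivFun.symm a : U) : W)).map (ι q)).prod := by
  induction l with
  | nil => exact ⟨1, [], by simp, rfl, by simp⟩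
  | cons v l ih =>
    obtain ⟨s, l', h1, h2, h3⟩ := ih fun x hx => hl x (by simp [hx])
    obtain ⟨hv, hqv⟩ := hl v (by simp)
    set a := b.equivFun ⟨v, hv⟩ with ha
    have ha0 : a ≠ 0 := by
      intro h
      have h0 : (⟨v, hv⟩ : U) = 0 := b.equivFun.injective (by rw [← ha, h, map_zero])
      have h0' : v = 0 := congrArg Subtype.val h0
      exact hqv (by rw [h0', QuadraticMap.map_zero])
    obtain ⟨i, hi⟩ := Function.ne_iff.1 ha0
    have : Nonempty (Fin k) := ⟨i⟩
    -- Dividing by a coordinate of largest norm gives norm exactly one by means of a scalar of `K`.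
    obtain ⟨j, hj⟩ := Finite.exists_max fun i => ‖a i‖
    have hnorm : ‖a‖ = ‖a j‖ := le_antisymm
      ((pi_norm_le_iff_of_nonneg (norm_nonneg _)).2 hj) (norm_le_pi_norm a j)
    have haj : a j ≠ 0 := by
      intro h
      rw [h, norm_zero] at hj
      exact hi (norm_le_zero_iff.1 (hj i))
    refine ⟨a j * s, ((a j)⁻¹ • a) :: l', ?_, by simp [h2], ?_⟩
    · intro c hc
      rcases List.mem_cons.1 hc with rfl | hc
      · rw [norm_smul, hnorm, norm_inv, inv_mul_cancel₀ (norm_ne_zero_iff.2 haj)]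
      · exact h1 c hc
    · have hv' : (b.equivFun.symm ((a j)⁻¹ • a) : U) = (a j)⁻¹ • (⟨v, hv⟩ : U) := by
        rw [map_smul, ha, LinearEquiv.symm_apply_apply]
      rw [List.map_cons, List.prod_cons, h3, List.map_cons, List.map_cons, List.prod_cons, hv',
        Submodule.coe_smul, map_smul]
      simp only [smul_mul_assoc, mul_smul_comm, smul_smul]
      congr 1
      field_simp

variable [CharZero K]

/-- The products of boundedly many vectors from an anisotropic space which satisfy the unitarity
equation lie in a compact set. -/
theorem exists_isCompact_of_anisotropic [ProperSpace K] [FiniteDimensional K W] {U : Submodule K W}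
    (hU : ∀ v ∈ U, v ≠ 0 → q v ≠ 0) (r : ℕ) :
    ∃ C : Set (CliffordAlgebra q), @IsCompact _ (moduleTopology K (CliffordAlgebra q)) C ∧
      ∀ x, star x * x = 1 → (∃ (c : K) (l : List W), (∀ v ∈ l, v ∈ U ∧ q v ≠ 0) ∧
        l.length ≤ r ∧ x = c • (l.map (ι q)).prod) → x ∈ C := by
  have := clifford_finite (q := q)
  have := clifford_nontrivial (q := q)
  let := moduleTopology K (CliffordAlgebra q)
  have : IsModuleTopology K (CliffordAlgebra q) := ⟨rfl⟩
  have := IsModuleTopology.isTopologicalRing K (CliffordAlgebra q)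
  let b := Module.finBasis K U
  let par : (Fin (Module.finrank K U) → K) →ₗ[K] W := U.subtype ∘ₗ b.equivFun.symm.toLinearMap
  let f : (Fin (Module.finrank K U) → K) →ₗ[K] CliffordAlgebra q := ι q ∘ₗ par
  have hf : Continuous f := IsModuleTopology.continuous_of_linearMap f
  set S : Set (Fin (Module.finrank K U) → K) := Metric.sphere 0 1 with hS
  have hScomp : IsCompact S := isCompact_sphere 0 1
  have hmemS : ∀ a, a ∈ S ↔ ‖a‖ = 1 := fun a => by rw [hS, mem_sphere_zero_iff_norm]
  have hprod : ∀ n : ℕ, ∃ C : Set (CliffordAlgebra q), IsCompact C ∧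
      ∀ l : List (Fin (Module.finrank K U) → K), (∀ a ∈ l, ‖a‖ = 1) → l.length ≤ n →
        ((l.map fun a => par a).map (ι q)).prod ∈ C := by
    intro n
    induction n with
    | zero =>
      refine ⟨{1}, isCompact_singleton, fun l _ hl => ?_⟩
      rw [List.length_eq_zero_iff.1 (Nat.le_zero.1 hl)]
      rfl
    | succ n ih =>
      obtain ⟨C, hC, h⟩ := ih
      refine ⟨C ∪ f '' S * C, hC.union ((hScomp.image hf).mul hC), fun l hl hlen => ?_⟩
      match l, hl, hlen with
      | [], hl, _ => exact Or.inl (h [] hl (Nat.zero_le n))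
      | a :: l, hl, hlen =>
        right
        rw [List.map_cons, List.map_cons, List.prod_cons]
        exact Set.mul_mem_mul ⟨a, (hmemS a).2 (hl a (by simp)), rfl⟩
          (h l (fun a' ha' => hl a' (by simp [ha'])) (by simpa using hlen))
  -- A functional not vanishing at 1 reads off `q v` from the square of `v`, which shows that the
  -- form is continuous.
  obtain ⟨Λ, hΛ⟩ : ∃ Λ : Module.Dual K (CliffordAlgebra q), Λ 1 ≠ 0 := by
    by_contra! h
    exact one_ne_zero ((Module.forall_dual_apply_eq_zero_iff K (1 : CliffordAlgebra q)).1 h)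
  have hΛc : Continuous Λ := IsModuleTopology.continuous_of_linearMap Λ
  have hqcont : Continuous fun a => q (par a) := by
    have h : (fun a => q (par a)) = fun a => Λ (f a * f a) * (Λ 1)⁻¹ := by
      funext a
      have : f a * f a = q (par a) • (1 : CliffordAlgebra q) := ι_mul_self_eq_smul _
      rw [this, map_smul, smul_eq_mul, mul_assoc, mul_inv_cancel₀ hΛ, mul_one]
    rw [h]
    exact (hΛc.comp (hf.mul hf)).mul continuous_const
  have hqne : ∀ a ∈ S, q (par a) ≠ 0 := by
    intro a ha
    refine hU _ (b.equivFun.symm a).2 fun h => ?_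
    have h1 : b.equivFun.symm a = 0 := Subtype.ext h
    have h2 : a = 0 := b.equivFun.symm.injective (by rw [h1, map_zero])
    rw [hmemS, h2, norm_zero] at ha
    exact zero_ne_one ha
  -- Anisotropy enters here: the inverse of the form is continuous, hence bounded, on the compact
  -- unit sphere.
  obtain ⟨M₀, hM₀⟩ := hScomp.exists_bound_of_continuousOn
    (f := fun a => (q (par a))⁻¹) (hqcont.continuousOn.inv₀ hqne)
  set M := max M₀ 1 with hM
  have hM1 : 1 ≤ M := le_max_right _ _
  have hbound : ∀ l : List (Fin (Module.finrank K U) → K), (∀ a ∈ l, ‖a‖ = 1) →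
      ((l.map fun a => par a).map fun v => -q v).prod ≠ 0 ∧
      ‖(((l.map fun a => par a).map fun v => -q v).prod)⁻¹‖ ≤ M ^ l.length := by
    intro l hl
    induction l with
    | nil => simp
    | cons a l ih =>
      obtain ⟨h1, h2⟩ := ih fun a' ha' => hl a' (by simp [ha'])
      have ha := (hmemS a).2 (hl a (by simp))
      rw [List.map_cons, List.map_cons, List.prod_cons]
      refine ⟨mul_ne_zero (neg_ne_zero.2 (hqne a ha)) h1, ?_⟩
      rw [mul_inv, norm_mul, List.length_cons, pow_succ', inv_neg, norm_neg]
      exact mul_le_mul ((hM₀ a ha).trans (le_max_left _ _)) h2 (norm_nonneg _) (by positivity)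
  obtain ⟨C, hC, hCmem⟩ := hprod r
  refine ⟨Metric.closedBall (0 : K) (M ^ r) • C, (isCompact_closedBall _ _).smul_set hC, ?_⟩
  rintro x hx ⟨c, l, hl, hlen, rfl⟩
  obtain ⟨s, l', h1, h2, h3⟩ := exists_normalised_list b l hl
  rw [h3, smul_smul] at hx ⊢
  refine Set.smul_mem_smul ?_ (hCmem l' h1 (by omega))
  obtain ⟨hP0, hP⟩ := hbound l' h1
  -- Unitarity determines the square of the scalar as the inverse of a product of at most `r` values
  -- of `-q` on the sphere, which bounds the scalar.
  have h4 : (c * s) * (c * s) * ((l'.map fun a => par a).map fun v => -q v).prod = 1 := by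
    have h5 := star_prod_mul_prod (q := q) (l'.map fun a => par a)
    have h6 : star ((c * s) • ((l'.map fun a => par a).map (ι q)).prod) *
        ((c * s) • ((l'.map fun a => par a).map (ι q)).prod) = 1 := hx
    rw [CliffordAlgebra.star_smul, smul_mul_assoc, mul_smul_comm, h5, smul_smul, smul_smul,
      ← Algebra.algebraMap_eq_smul_one, ← map_one (algebraMap K _)] at h6
    exact (algebraMap_injective' h6)
  have h5 : ‖c * s‖ * ‖c * s‖ ≤ M ^ r := by
    rw [← norm_mul, eq_inv_of_mul_eq_one_left h4]
    exact hP.trans (pow_le_pow_right₀ hM1 (by omega))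
  rw [mem_closedBall_zero_iff]
  by_contra! h
  have h6 : 1 ≤ M ^ r := one_le_pow₀ hM1
  nlinarith

end Compactness

/-! ### Rational points of the spin group of an anisotropic space -/

section RationalPoints

open CliffordAlgebra

variable {V : Type*} [AddCommGroup V] [Module ℚ V] [FiniteDimensional ℚ V] {Q : QuadraticForm ℚ V}
  {K : Type*} [NontriviallyNormedField K] [Algebra ℚ K] {Ω : Type*} [Field Ω] [Algebra ℚ Ω]
  [Algebra K Ω] [IsScalarTower ℚ K Ω]

omit [FiniteDimensional ℚ V] in
-- The defining polynomials have coefficients in `K` and the coordinates commute with the embedding,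
-- so the equations can be read over `K`, where they are continuous.
theorem isClosed_rationalPoints {N : Subgroup (Spin Q Ω)} (hN : IsClosedDefinedOver Q K Ω N) :
    @IsClosed _ (moduleTopology K (Clifford Q K)) (rationalPoints Q K Ω N) := by
  let := moduleTopology K (Clifford Q K)
  have : IsModuleTopology K (Clifford Q K) := ⟨rfl⟩
  obtain ⟨S, hS⟩ := hN
  have h : rationalPoints Q K Ω N = ⋂ f ∈ S,
      {x | MvPolynomial.eval (fun φ => coordinate Q K φ x) f = 0} := by
    ext x
    simp only [rationalPoints, hS, Set.mem_ofPred_eq, Set.mem_iInter]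
    refine forall₂_congr fun f _ => ?_
    have : (fun φ => coordinate Q Ω φ (cliffordMap Q K Ω x)) =
        algebraMap K Ω ∘ fun φ => coordinate Q K φ x :=
      funext fun φ => coordinate_extendClifford (IsScalarTower.toAlgHom ℚ K Ω) φ x
    rw [this, MvPolynomial.aeval_algebraMap_apply, map_eq_zero, MvPolynomial.aeval_eq_eval]
  rw [h]
  refine isClosed_biInter fun f _ => isClosed_eq ?_ continuous_const
  refine (MvPolynomial.continuous_eval f).comp (continuous_pi fun φ => ?_)
  exact IsModuleTopology.continuous_of_linearMap (coordinateLinear Q K φ)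

/-- The rational points of the rotation group of an anisotropic space form a compact set. -/
theorem isCompact_rationalPoints [IsAlgClosed Ω] [ProperSpace K] {L L' : Submodule ℚ V}
    (hK : IsOrthDecomp (Q.baseChange K) (L.baseChange K) (L'.baseChange K))
    (hΩ : IsOrthDecomp (Q.baseChange Ω) (L.baseChange Ω) (L'.baseChange Ω))
    (h0 : L.baseChange Ω ≠ ⊥) (haniso : ∀ v ∈ L.baseChange K, v ≠ 0 → Q.baseChange K v ≠ 0) :
    @IsCompact _ (moduleTopology K (Clifford Q K)) (rationalPoints Q K Ω
      (Subgroup.closure (unitPairs (Q.baseChange Ω) (L.baseChange Ω)))) := by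
  have : CharZero K := algebraRat.charZero K
  have : CharZero Ω := algebraRat.charZero Ω
  obtain ⟨r, hr⟩ := hK.exists_eq_smul_prod
  obtain ⟨C, hC, hCmem⟩ := exists_isCompact_of_anisotropic haniso r
  let := moduleTopology K (Clifford Q K)
  refine hC.of_isClosed_subset
    (isClosed_rationalPoints (isClosedDefinedOver_closure_unitPairs hΩ h0)) ?_
  rintro x ⟨g, hg, hgx⟩
  set σ := IsScalarTower.toAlgHom ℚ K Ω with hσ
  have hgx : (g : Clifford Q Ω) = extendClifford Q σ x := hgx
  have hinj := extendClifford_injective (Q := Q) σ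
  -- The equations of the spin group hold over `Ω` and descend because the embedding of Clifford
  -- algebras is injective.
  have hstar : star x * x = 1 := hinj <| by
    rw [map_mul, extendClifford_star, ← hgx, spin_star_mul, map_one]
  refine hCmem x hstar (hr x ?_ hstar ?_ ?_)
  · exact hinj (by rw [extendClifford_involute, ← hgx, spinGroup.involute_eq g.2])
  · intro v
    refine range_ι_of_coordinate _ fun φ hφ => ?_
    have h := coordinate_extendClifford σ φ (x * ι (Q.baseChange K) v * star x)
    rw [map_mul, map_mul, extendClifford_star, extendClifford_ι, ← hgx, ← ι_spinAct,
      coordinate_ι_eq_zero φ hφ] at h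
    exact (map_eq_zero σ).1 h.symm
  · intro v hv
    apply hinj
    rw [map_mul, map_mul, extendClifford_ι, ← hgx]
    exact equations_of_mem_closure hΩ hg (extendVector_mem σ hv)

end RationalPoints

/-! ### Galois descent for vectors -/

section Descent

variable {V : Type*} [AddCommGroup V] [Module ℚ V] [FiniteDimensional ℚ V]

/-- The coordinates of an extended vector. -/
theorem repr_extendVector {F F' : Type*} [Field F] [Algebra ℚ F] [Field F'] [Algebra ℚ F']
    (σ : F →ₐ[ℚ] F') (w : F ⊗[ℚ] V) (i) :
    ((Module.finBasis ℚ V).baseChange F').repr (extendVector σ w) i =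
      σ (((Module.finBasis ℚ V).baseChange F).repr w i) := by
  induction w with
  | zero => simp
  | add x y hx hy => simp only [map_add, Finsupp.add_apply, hx, hy]
  | tmul c v => simp [extendVector_tmul, Algebra.smul_def]

variable {K : Type*} [Field K] [Algebra ℚ K] {Ω : Type*} [Field Ω] [Algebra ℚ Ω]
  [Algebra K Ω] [IsScalarTower ℚ K Ω]

/-- A vector fixed by the Galois group is rational. -/
theorem exists_extendVector_eq [IsGalois K Ω] {z : Ω ⊗[ℚ] V}
    (hz : ∀ τ : Ω ≃ₐ[K] Ω, extendVector (τ.toAlgHom.restrictScalars ℚ) z = z) :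
    ∃ w : K ⊗[ℚ] V, extendVector (IsScalarTower.toAlgHom ℚ K Ω) w = z := by
  set b := (Module.finBasis ℚ V).baseChange Ω
  set b' := (Module.finBasis ℚ V).baseChange K
  have h : ∀ i, ∃ c : K, algebraMap K Ω c = b.repr z i := fun i => by
    have h1 : b.repr z i ∈ (⊥ : IntermediateField K Ω) := by
      rw [InfiniteGalois.mem_bot_iff_fixed]
      intro τ
      have h2 := repr_extendVector (τ.toAlgHom.restrictScalars ℚ) z i
      rw [hz] at h2
      exact h2.symm
    exact IntermediateField.mem_bot.1 h1
  choose c hc using h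
  refine ⟨b'.equivFun.symm c, b.repr.injective (Finsupp.ext fun i => ?_)⟩
  rw [repr_extendVector, ← hc]
  change algebraMap K Ω (b'.equivFun (b'.equivFun.symm c) i) = _
  rw [LinearEquiv.apply_symm_apply]

/-- The Galois orbit of a vector is finite. -/
theorem finite_range_extendVector [Algebra.IsAlgebraic K Ω] (z : Ω ⊗[ℚ] V) :
    (Set.range fun τ : Ω ≃ₐ[K] Ω => extendVector (τ.toAlgHom.restrictScalars ℚ) z).Finite := by
  set b := (Module.finBasis ℚ V).baseChange Ω
  refine Set.Finite.of_finite_image (f := b.equivFun) ?_ b.equivFun.injective.injOn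
  -- Every coordinate of a conjugate is a root of the minimal polynomial of the original coordinate.
  refine (Set.Finite.pi' fun i => ((minpoly K (b.repr z i)).rootSet_finite Ω)).subset ?_
  rintro _ ⟨_, ⟨τ, rfl⟩, rfl⟩ i
  have h : b.equivFun (extendVector (τ.toAlgHom.restrictScalars ℚ) z) i = τ (b.repr z i) :=
    repr_extendVector _ z i
  have hint : IsIntegral K (b.repr z i) := (Algebra.IsAlgebraic.isAlgebraic _).isIntegral
  rw [h, Polynomial.mem_rootSet]
  refine ⟨minpoly.ne_zero hint, ?_⟩
  rw [Polynomial.aeval_algHom_apply, minpoly.aeval, map_zero]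

/-- A Galois stable subspace which contains a rational vector and a vector independent of it
contains a rational vector independent of it. -/
theorem exists_extendVector_mem [IsGalois K Ω] (A : Submodule Ω (Ω ⊗[ℚ] V))
    (hA : ∀ (τ : Ω ≃ₐ[K] Ω), ∀ w ∈ A, extendVector (τ.toAlgHom.restrictScalars ℚ) w ∈ A)
    {u : K ⊗[ℚ] V} (hu0 : u ≠ 0) (hu : extendVector (IsScalarTower.toAlgHom ℚ K Ω) u ∈ A)
    {y : Ω ⊗[ℚ] V} (hy : y ∈ A)
    (hyu : ∀ r : Ω, y ≠ r • extendVector (IsScalarTower.toAlgHom ℚ K Ω) u) :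
    ∃ w : K ⊗[ℚ] V, extendVector (IsScalarTower.toAlgHom ℚ K Ω) w ∈ A ∧ ∀ r : K, w ≠ r • u := by
  classical
  have : CharZero Ω := algebraRat.charZero Ω
  set σ := IsScalarTower.toAlgHom ℚ K Ω
  set b := (Module.finBasis ℚ V).baseChange Ω with hb
  set b' := (Module.finBasis ℚ V).baseChange K with hb'
  obtain ⟨i₀, hi₀⟩ : ∃ i, b'.repr u i ≠ 0 := by
    by_contra! h
    exact hu0 (b'.repr.injective (Finsupp.ext fun i => by simp [h i]))
  have hi₀' : b.repr (extendVector σ u) i₀ ≠ 0 := by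
    rw [repr_extendVector]
    exact (map_ne_zero σ).2 hi₀
  -- Normalise `y` modulo `u`: coordinate 0 at a place where `u` does not vanish, and afterwards
  -- coordinate 1 at some other place. Both values are fixed by the Galois group.
  set y₁ := y - (b.repr y i₀ * (b.repr (extendVector σ u) i₀)⁻¹) • extendVector σ u with hy₁
  have hy₁A : y₁ ∈ A := A.sub_mem hy (A.smul_mem _ hu)
  have hy₁0 : b.repr y₁ i₀ = 0 := by
    rw [hy₁, map_sub, map_smul, Finsupp.sub_apply, Finsupp.smul_apply, smul_eq_mul,
      inv_mul_cancel_right₀ hi₀', sub_self]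
  obtain ⟨i₁, hi₁⟩ : ∃ i, b.repr y₁ i ≠ 0 := by
    by_contra! h
    exact hyu _ (sub_eq_zero.1 (b.repr.injective (Finsupp.ext fun i => by
      rw [← hy₁, h i, map_zero, Finsupp.zero_apply])))
  set y₂ := (b.repr y₁ i₁)⁻¹ • y₁ with hy₂
  have hy₂A : y₂ ∈ A := A.smul_mem _ hy₁A
  have hy₂0 : b.repr y₂ i₀ = 0 := by
    rw [hy₂, map_smul, Finsupp.smul_apply, hy₁0, smul_zero]
  have hy₂1 : b.repr y₂ i₁ = 1 := by
    rw [hy₂, map_smul, Finsupp.smul_apply, smul_eq_mul, inv_mul_cancel₀ hi₁]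
  have hfin := finite_range_extendVector (K := K) y₂
  set O := hfin.toFinset with hO
  have hmem : ∀ w, w ∈ O ↔
      ∃ τ : Ω ≃ₐ[K] Ω, extendVector (τ.toAlgHom.restrictScalars ℚ) y₂ = w := fun w => by
    rw [hO, Set.Finite.mem_toFinset]; rfl
  have hcomp : ∀ (τ τ' : Ω ≃ₐ[K] Ω) (w : Ω ⊗[ℚ] V),
      extendVector (τ.toAlgHom.restrictScalars ℚ)
        (extendVector (τ'.toAlgHom.restrictScalars ℚ) w) =
      extendVector ((τ * τ').toAlgHom.restrictScalars ℚ) w := by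
    intro τ τ' w
    refine b.repr.injective (Finsupp.ext fun i => ?_)
    rw [repr_extendVector, repr_extendVector, repr_extendVector]
    rfl
  -- The sum over the finite Galois orbit is invariant, hence rational. It still has coordinate 0 at
  -- `i₀`, while at `i₁` its coordinate is the size of the orbit, which is non-zero in
  -- characteristic zero.
  obtain ⟨w, hw⟩ := exists_extendVector_eq (K := K) (z := ∑ w ∈ O, w) fun τ => by
    have hinj := extendVector_injective (V := V) (τ.toAlgHom.restrictScalars ℚ)
    rw [map_sum, ← Finset.sum_image (f := fun w => w) hinj.injOn]
    congr 1
    refine Finset.eq_of_subset_of_card_le ?_ (Finset.card_image_of_injective _ hinj).ge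
    intro w hw
    obtain ⟨w', hw', rfl⟩ := Finset.mem_image.1 hw
    obtain ⟨τ', rfl⟩ := (hmem w').1 hw'
    exact (hmem _).2 ⟨τ * τ', (hcomp τ τ' y₂).symm⟩
  have hrepr : ∀ i (c : ℕ), b.repr y₂ i = c → σ (b'.repr w i) = O.card * c := by
    intro i c hc
    rw [← repr_extendVector, hw, map_sum, Finsupp.finsetSum_apply, ← nsmul_eq_mul]
    refine Finset.sum_eq_card_nsmul fun w hw => ?_
    obtain ⟨τ, rfl⟩ := (hmem w).1 hw
    rw [repr_extendVector, hc, map_natCast]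
  refine ⟨w, ?_, ?_⟩
  · rw [hw]
    refine A.sum_mem fun w hw => ?_
    obtain ⟨τ, rfl⟩ := (hmem w).1 hw
    exact hA τ _ hy₂A
  · rintro r rfl
    have h0 := hrepr i₀ 0 (by rw [hy₂0, Nat.cast_zero])
    have h1 := hrepr i₁ 1 (by rw [hy₂1, Nat.cast_one])
    rw [Nat.cast_zero, mul_zero, map_eq_zero, map_smul, Finsupp.smul_apply, smul_eq_mul,
      mul_eq_zero, or_iff_left hi₀] at h0
    rw [h0, zero_smul, map_zero, Finsupp.zero_apply, map_zero, Nat.cast_one, mul_one] at h1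
    have hne : y₂ ∈ O := (hmem _).2 ⟨1, b.repr.injective (Finsupp.ext fun i => by
      rw [repr_extendVector]; rfl)⟩
    exact (Finset.card_ne_zero_of_mem hne) (by exact_mod_cast h1.symm)

variable {Q : QuadraticForm ℚ V}

omit [FiniteDimensional ℚ V] in
/-- The points of a group defined over `K` are stable under the Galois group. -/
theorem extendClifford_mem_points {N : Subgroup (Spin Q Ω)} (hN : IsClosedDefinedOver Q K Ω N)
    (τ : Ω ≃ₐ[K] Ω) {x : Clifford Q Ω} (hx : x ∈ points Q Ω N) :
    extendClifford Q (τ.toAlgHom.restrictScalars ℚ) x ∈ points Q Ω N := by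
  obtain ⟨S, hS⟩ := hN
  rw [hS] at hx ⊢
  intro f hf
  have h := hx f hf
  simp only [coordinate_extendClifford]
  have h1 := MvPolynomial.comp_aeval_apply (fun φ => coordinate Q Ω φ x) τ.toAlgHom f
  rw [h, map_zero] at h1
  exact h1.symm

end Descent

/-! ### Non-compactness for isotropic spaces -/

section Noncompactness

open CliffordAlgebra

/-- A compact set contains no line. -/
theorem not_isCompact_of_line {K M : Type*} [NontriviallyNormedField K] [AddCommGroup M]
    [Module K M] {C : Set M} {a m : M} (hm : m ≠ 0) (h : ∀ t : K, a + t • m ∈ C) :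
    ¬ @IsCompact M (moduleTopology K M) C := by
  let := moduleTopology K M
  have : IsModuleTopology K M := ⟨rfl⟩
  intro hC
  obtain ⟨Λ, hΛ⟩ : ∃ Λ : Module.Dual K M, Λ m ≠ 0 := by
    by_contra! h
    exact hm ((Module.forall_dual_apply_eq_zero_iff K m).1 h)
  have hΛc : Continuous Λ := IsModuleTopology.continuous_of_linearMap Λ
  obtain ⟨B, hB⟩ := hC.exists_bound_of_continuousOn (f := Λ) hΛc.continuousOn
  obtain ⟨t, ht⟩ := NormedField.exists_lt_norm K ((B + ‖Λ a‖) / ‖Λ m‖)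
  have h1 := hB _ (h t)
  rw [map_add, map_smul, smul_eq_mul] at h1
  have h2 := norm_sub_le (Λ a + t * Λ m) (Λ a)
  rw [add_sub_cancel_left, norm_mul] at h2
  rw [div_lt_iff₀ (norm_pos_iff.2 hΛ)] at ht
  linarith

/-- Take `u'` forming a hyperbolic pair with `u`, so that `u u' + u' u = 1`. If `u w = 0`, then also
`w u = 0`, and multiplying this identity by `w` exhibits `w` as a multiple of `u`. The lemma
guarantees that the line of unipotents is not constant. -/
theorem ι_mul_ι_ne_zero {F W : Type*} [Field F] [CharZero F] [AddCommGroup W] [Module F W]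
    [FiniteDimensional F W] {q : QuadraticForm F W} {U : Submodule F W} (hU : IsNondeg q U)
    {u w : W} (hu : u ∈ U) (hu0 : u ≠ 0) (hqu : q u = 0) (hw : ∀ r : F, w ≠ r • u)
    (hp : QuadraticMap.polar q u w = 0) : ι q u * ι q w ≠ 0 := by
  intro h
  obtain ⟨u', -, -, h1⟩ := hU.exists_hyperbolic hu hu0 hqu
  refine hw (QuadraticMap.polar q u' w) (ι_injective (q := q) ?_)
  have h2 := ι_mul_ι_add_swap (Q := q) u u'
  have h3 := ι_mul_ι_add_swap (Q := q) u' w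
  have h4 : ι q w * ι q u = 0 := by
    rw [← neg_eq_zero, ← h, ι_mul_ι_of_polar_eq_zero hp]
  have h5 := ι_mul_ι_add_swap (Q := q) w u'
  rw [h1, map_one] at h2
  rw [map_smul, Algebra.smul_def, ← h3]
  calc ι q w = (ι q u * ι q u' + ι q u' * ι q u) * ι q w := by rw [h2, one_mul]
    _ = ι q u * (ι q u' * ι q w) := by rw [add_mul, mul_assoc, mul_assoc, h, mul_zero, add_zero]
    _ = ι q u * (ι q u' * ι q w + ι q w * ι q u') := by
      rw [mul_add, ← mul_assoc _ (ι q w), h, zero_mul, add_zero]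
    _ = _ := by rw [h3, Algebra.commutes]

variable {V : Type*} [AddCommGroup V] [Module ℚ V] [FiniteDimensional ℚ V] {Q : QuadraticForm ℚ V}
  {K : Type*} [NontriviallyNormedField K] [Algebra ℚ K] {Ω : Type*} [Field Ω] [Algebra ℚ Ω]
  [Algebra K Ω] [IsScalarTower ℚ K Ω] [IsAlgClosed Ω] [Algebra.IsAlgebraic K Ω]

/-- A group defined over `K` and normalised by the rotations of an isotropic space, on which it does
not act by scalars, has a non-compact group of rational points. -/
theorem not_isCompact_rationalPoints [CharZero Ω] {L : Submodule ℚ V}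
    (hK : IsNondeg (Q.baseChange K) (L.baseChange K))
    (hΩ : IsNondeg (Q.baseChange Ω) (L.baseChange Ω)) (hdim : 3 ≤ Module.finrank ℚ L)
    {G N : Subgroup (Spin Q Ω)} (hG : unitPairs (Q.baseChange Ω) (L.baseChange Ω) ⊆ G)
    (hGU : ∀ l ∈ G, ∀ v ∈ L.baseChange Ω, spinAct l v ∈ L.baseChange Ω)
    (hN : ∀ l ∈ G, ∀ n ∈ N, l * n * l⁻¹ ∈ N) (hNG : N ≤ G)
    (hNK : IsClosedDefinedOver Q K Ω N) {g : Spin Q Ω} (hg : g ∈ N)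
    (hgs : ¬∃ c : Ω, ∀ v ∈ L.baseChange Ω, spinAct g v = c • v)
    (hiso : ∃ u ∈ L.baseChange K, u ≠ 0 ∧ Q.baseChange K u = 0) :
    ¬ @IsCompact _ (moduleTopology K (Clifford Q K)) (rationalPoints Q K Ω N) := by
  have : CharZero K := algebraRat.charZero K
  have : IsAlgClosure K Ω := ⟨inferInstance, inferInstance⟩
  have : Normal K Ω := IsAlgClosure.normal K Ω
  have : IsGalois K Ω := ⟨⟩
  obtain ⟨u, hu, hu0, hqu⟩ := hiso
  set σ := IsScalarTower.toAlgHom ℚ K Ω with hσ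
  have hqσ : Q.baseChange Ω (extendVector σ u) = 0 := by
    rw [baseChange_extendVector, hqu, map_zero]
  have hu0' : extendVector σ u ≠ 0 :=
    fun h => hu0 (extendVector_injective σ (by rw [h, map_zero]))
  obtain ⟨y, -, hpy, hyu, hyN⟩ := hΩ.exists_unipotent_of_isotropic
    (by rwa [finrank_baseChange_submodule]) hG hGU hN hg (hGU g (hNG hg)) hgs
    (extendVector_mem σ hu) hu0' hqσ
  set u₀ := extendVector σ u with hu₀
  -- The directions `w` whose whole one-parameter unipotent group at `u₀` lies in `N`. Requiring all
  -- `t` makes this a linear subspace, and Galois stable since `N` is defined over `K` and `u₀` is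
  -- rational.
  let A : Submodule Ω (Ω ⊗[ℚ] V) :=
    { carrier := {w | QuadraticMap.polar (Q.baseChange Ω) u₀ w = 0 ∧
        ∀ t : Ω, 1 + ι (Q.baseChange Ω) u₀ * ι (Q.baseChange Ω) (t • w) ∈ points Q Ω N}
      zero_mem' := ⟨QuadraticMap.polar_zero_right _ _, fun t => by
        rw [smul_zero, map_zero, mul_zero, add_zero]; exact ⟨1, N.one_mem, rfl⟩⟩
      add_mem' := by
        rintro w w' ⟨h1, h2⟩ ⟨h1', h2'⟩
        refine ⟨by rw [QuadraticMap.polar_add_right, h1, h1', add_zero], fun t => ?_⟩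
        obtain ⟨n, hn, hnt⟩ := h2 t
        obtain ⟨n', hn', hnt'⟩ := h2' t
        refine ⟨n * n', N.mul_mem hn hn', ?_⟩
        rw [smul_add, ← one_add_mul_one_add hqσ, ← hnt, ← hnt']
        · rfl
        · rw [QuadraticMap.polar_smul_right, h1, smul_zero]
      smul_mem' := by
        rintro c w ⟨h1, h2⟩
        exact ⟨by rw [QuadraticMap.polar_smul_right, h1, smul_zero], fun t => by
          rw [smul_smul]; exact h2 _⟩ }
  have hfix : ∀ τ : Ω ≃ₐ[K] Ω, extendVector (τ.toAlgHom.restrictScalars ℚ) u₀ = u₀ := by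
    intro τ
    refine ((Module.finBasis ℚ V).baseChange Ω).repr.injective (Finsupp.ext fun i => ?_)
    rw [repr_extendVector, hu₀, repr_extendVector]
    exact τ.commutes _
  obtain ⟨w, hwA, hw⟩ := exists_extendVector_mem (K := K) A (fun τ w hw => by
      obtain ⟨h1, h2⟩ := hw
      refine ⟨?_, fun t => ?_⟩
      · have := polar_extendVector (Q := Q) (τ.toAlgHom.restrictScalars ℚ) u₀ w
        rwa [hfix, h1, map_zero] at this
      -- The automorphism also moves the parameter, so membership is used at `τ.symm t`.
      · have := extendClifford_mem_points hNK τ (h2 (τ.symm t))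
        rw [map_add, map_one, map_mul, extendClifford_ι, extendClifford_ι, hfix,
          extendVector_smul] at this
        convert this
        exact (τ.apply_symm_apply t).symm) hu0
    ⟨by rw [polar_self', hqσ, mul_zero], fun t => by
      rw [map_smul, mul_smul_comm, ι_mul_self_eq_smul, hqσ, zero_smul, smul_zero, add_zero]
      exact ⟨1, N.one_mem, rfl⟩⟩ (y := y)
    ⟨hpy, fun t => by
      obtain ⟨n, hn, hnt⟩ := hyN t
      exact ⟨n, hn, hnt⟩⟩ hyu
  obtain ⟨hp, hpts⟩ := hwA
  have hp' : QuadraticMap.polar (Q.baseChange K) u w = 0 := by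
    rw [hu₀, polar_extendVector] at hp
    exact (map_eq_zero σ).1 hp
  -- For `t` in `K` the points `1 + t u w` are rational and form an affine line with non-zero
  -- direction.
  refine not_isCompact_of_line (K := K) (a := 1) (ι_mul_ι_ne_zero hK hu hu0 hqu hw hp') fun t => ?_
  have h1 := hpts (σ t)
  change extendClifford Q σ _ ∈ points Q Ω N
  rwa [← mul_smul_comm, ← map_smul, map_add, map_one, map_mul, extendClifford_ι, extendClifford_ι,
    extendVector_smul]

end Noncompactness

/-! ### The two implications -/

section Main

open CliffordAlgebra

variable {V : Type*} [AddCommGroup V] [Module ℚ V] [FiniteDimensional ℚ V] {Q : QuadraticForm ℚ V}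
  {K : Type*} [NontriviallyNormedField K] [Algebra ℚ K] {Ω : Type*} [Field Ω] [Algebra ℚ Ω]
  [Algebra K Ω] [IsScalarTower ℚ K Ω] [IsAlgClosed Ω]

omit [FiniteDimensional ℚ V] [IsAlgClosed Ω] in
-- An isometry preserving `U` carries unit vectors of `U` to unit vectors of `U`, and conjugation
-- acts on the generators through it.
theorem conj_mem_closure_unitPairs [CharZero Ω] {U : Submodule Ω (Ω ⊗[ℚ] V)} {g n : Spin Q Ω}
    (hg : ∀ v ∈ U, spinAct g v ∈ U)
    (hn : n ∈ Subgroup.closure (unitPairs (Q.baseChange Ω) U)) :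
    g * n * g⁻¹ ∈ Subgroup.closure (unitPairs (Q.baseChange Ω) U) := by
  induction hn using Subgroup.closure_induction with
  | mem n hn =>
    obtain ⟨v, hv, w, hw, hqv, hqw, h⟩ := hn
    refine Subgroup.subset_closure ⟨_, hg v hv, _, hg w hw, by rw [q_spinAct, hqv],
      by rw [q_spinAct, hqw], ?_⟩
    rw [← conj_ι_mul_ι, ← h]
    rfl
  | one => rw [mul_one, mul_inv_cancel]; exact Subgroup.one_mem _
  | mul x y _ _ hx hy =>
    have : g * (x * y) * g⁻¹ = g * x * g⁻¹ * (g * y * g⁻¹) := by group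
    rw [this]
    exact Subgroup.mul_mem _ hx hy
  | inv x _ hx =>
    have : g * x⁻¹ * g⁻¹ = (g * x * g⁻¹)⁻¹ := by group
    rw [this]
    exact Subgroup.inv_mem _ hx

/-- The identity component of this group contains its generators, so it is the whole group. -/
theorem isZariskiConnected_closure_unitPairs {U : Submodule Ω (Ω ⊗[ℚ] V)}
    (hU : IsNondeg (Q.baseChange Ω) U) (hdim : 2 ≤ Module.finrank Ω U) :
    IsZariskiConnected Q Ω (Subgroup.closure (unitPairs (Q.baseChange Ω) U)) := by
  have h : identityComponent Q Ω (Subgroup.closure (unitPairs (Q.baseChange Ω) U)) =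
      Subgroup.closure (unitPairs (Q.baseChange Ω) U) :=
    le_antisymm (identityComponent_le _) ((Subgroup.closure_le _).2
      (unitPairs_subset_identityComponent hU hdim Subgroup.subset_closure))
  rw [← h]
  exact isZariskiConnected_identityComponent _

/-- A strongly isotropic group which contains the rotations of `L` and preserves `L` exists only for
isotropic `L`. -/
theorem isIsotropic_of_isStronglyIsotropic [CharZero Ω] [ProperSpace K] {L L' : Submodule ℚ V}
    (hK : IsOrthDecomp (Q.baseChange K) (L.baseChange K) (L'.baseChange K))
    (hΩ : IsOrthDecomp (Q.baseChange Ω) (L.baseChange Ω) (L'.baseChange Ω))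
    (hdim : 3 ≤ Module.finrank ℚ L) {G : Subgroup (Spin Q Ω)}
    (hG : unitPairs (Q.baseChange Ω) (L.baseChange Ω) ⊆ G)
    (hGU : ∀ l ∈ G, ∀ v ∈ L.baseChange Ω, spinAct l v ∈ L.baseChange Ω)
    (h : IsStronglyIsotropic Q K Ω G) : IsIsotropic (restrictBaseChange Q K L) := by
  rw [isIsotropic_restrictBaseChange_iff]
  by_contra! haniso
  have hdim' : 2 ≤ Module.finrank Ω (L.baseChange Ω) := by
    rw [finrank_baseChange_submodule]; omega
  have h0 := ne_bot_of_finrank_pos (S := L.baseChange Ω) (by omega)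
  refine h (Subgroup.closure (unitPairs (Q.baseChange Ω) (L.baseChange Ω)))
    ((Subgroup.closure_le _).2 hG) ⟨fun n hn g => ?_⟩
    (isClosedDefinedOver_closure_unitPairs hΩ h0)
    (isZariskiConnected_closure_unitPairs hΩ.isNondeg hdim')
    (closure_unitPairs_ne_bot hΩ.isNondeg hdim') (isCompact_rationalPoints hK hΩ h0 haniso)
  exact conj_mem_closure_unitPairs (hGU g g.2) hn

/-- Strong isotropy of the identity component of the stabilizer of a rational subspace. -/
theorem isStronglyIsotropic_iff [ProperSpace K] [Algebra.IsAlgebraic K Ω] (hQ : Q.PosDef)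
    (L : Submodule ℚ V) (hL : 3 ≤ Module.finrank ℚ L)
    (hL' : 3 ≤ Module.finrank ℚ (orthogonalComplement Q L)) :
    IsStronglyIsotropic Q K Ω (H Q Ω L) ↔ IsIsotropic (restrictBaseChange Q K L) ∧
      IsIsotropic (restrictBaseChange Q K (orthogonalComplement Q L)) := by
  have : CharZero K := algebraRat.charZero K
  have : CharZero Ω := algebraRat.charZero Ω
  have hK := isOrthDecomp_baseChange (F := K) hQ L
  have hΩ := isOrthDecomp_baseChange (F := Ω) hQ L
  have hd : 3 ≤ Module.finrank Ω (L.baseChange Ω) := by rwa [finrank_baseChange_submodule]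
  have hd' : 3 ≤ Module.finrank Ω ((orthogonalComplement Q L).baseChange Ω) := by
    rwa [finrank_baseChange_submodule]
  have hG : unitPairs (Q.baseChange Ω) (L.baseChange Ω) ⊆ H Q Ω L :=
    unitPairs_subset_identityComponent hΩ.isNondeg (by omega) (unitPairs_subset_spinStabilizer hΩ).1
  have hG' : unitPairs (Q.baseChange Ω) ((orthogonalComplement Q L).baseChange Ω) ⊆ H Q Ω L :=
    unitPairs_subset_identityComponent hΩ.symm.isNondeg (by omega)
      (unitPairs_subset_spinStabilizer hΩ).2
  have hGU : ∀ g ∈ H Q Ω L, ∀ v ∈ L.baseChange Ω, spinAct g v ∈ L.baseChange Ω := fun g hg =>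
    (mem_spinStabilizer_iff.1 (identityComponent_le _ hg)).1
  have hGU' := hΩ.spinAct_mem hGU
  constructor
  · intro h
    exact ⟨isIsotropic_of_isStronglyIsotropic hK hΩ hL hG hGU h,
      isIsotropic_of_isStronglyIsotropic hK.symm hΩ.symm hL' hG' hGU' h⟩
  · rintro ⟨h1, h2⟩ N hNG hnormal hNK hconn hbot
    rw [isIsotropic_restrictBaseChange_iff] at h1 h2
    have hN : ∀ l ∈ H Q Ω L, ∀ n ∈ N, l * n * l⁻¹ ∈ N := fun l hl n hn =>
      hnormal.conj_mem ⟨n, hNG hn⟩ hn ⟨l, hl⟩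
    -- A non-trivial connected group cannot be scalar on both summands; either case is handled by
    -- the isotropic vector of that summand.
    have hns : (∃ g ∈ N, ¬∃ c : Ω, ∀ v ∈ L.baseChange Ω, spinAct g v = c • v) ∨
        ∃ g ∈ N, ¬∃ c : Ω, ∀ v ∈ (orthogonalComplement Q L).baseChange Ω,
          spinAct g v = c • v := by
      by_contra! hcon
      exact hbot (eq_bot_of_isScalar hΩ (ne_bot_of_finrank_pos (by omega))
        (ne_bot_of_finrank_pos (by omega)) hconn hcon.1 hcon.2)
    rcases hns with ⟨g, hg, hgs⟩ | ⟨g, hg, hgs⟩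
    · exact not_isCompact_rationalPoints hK.isNondeg hΩ.isNondeg hL hG hGU hN hNG hNK hg hgs h1
    · exact not_isCompact_rationalPoints hK.symm.isNondeg hΩ.symm.isNondeg hL' hG' hGU' hN hNG hNK
        hg hgs h2

end Main

end SpinStabilizer

end

theorem mainTheorem8 (n k : ℕ) (hk : 3 ≤ k) (hnk : k + 3 ≤ n)
    (Q : QuadraticForm ℚ (Fin n → ℚ)) (hQ : Q.PosDef)
    (L : Submodule ℚ (Fin n → ℚ)) (hL : Module.finrank ℚ L = k)
    (p : ℕ) [Fact p.Prime] (hp : p ≠ 2) :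
    SpinStabilizer.IsStronglyIsotropicAt Q p
        (SpinStabilizer.H Q (AlgebraicClosure ℚ_[p]) L) ↔
      SpinStabilizer.IsIsotropic (SpinStabilizer.restrictBaseChange Q ℚ_[p] L) ∧
      SpinStabilizer.IsIsotropic (SpinStabilizer.restrictBaseChange Q ℚ_[p]
        (SpinStabilizer.orthogonalComplement Q L)) := by
  refine SpinStabilizer.isStronglyIsotropic_iff hQ L (by omega) ?_
  have h := Submodule.finrank_add_eq_of_isCompl (SpinStabilizer.isCompl_orthogonalComplement hQ L)
  rw [Module.finrank_fin_fun] at h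
  omega
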